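/- **Degenerate self-similar measures.** Let $n\ge 2$, let $0=\alpha_1<\alpha_2<\dots<\alpha_{n+1}=1$, put $a_k=\alpha_{k+1}-\alpha_k$, and let $e_k\in\{0,1\}$ and $d_k,\beta_k\in\mathbb R$ ($1\le k\le n$). Let $S_k(t)=a_kt+\alpha_k$ if $e_k=0$ and $S_k(t)=\alpha_{k+1}-a_kt$ if $e_k=1$. Assume that exactly one of the $d_k$, say $d_m$, is nonzero, and that $|d_m|<1$. Let $f\in L_\infty(0,1)$ be the (unique) solution of $$f(t)=\sum_{k=1}^n\bigl(d_k\,f(S_k^{-1}(t))+\beta_k\bigr)\,\chi_{(\alpha_k,\alpha_{k+1})}(t)\quad\text{for a.e. } t\in(0,1),$$ taken left-continuous, extended to $t=0$ by its right limit there and constant to the left of $0$ and to the right of $1$. Assume that $f$ has a jump at each of $\alpha_2,\dots,\alpha_n$, and that $\mu([a,b])=f(b+0)-f(a)$, $0\le a\le b\le1$, defines a probability measure $\mu$ on $[0,1]$. **Operator.** Let $\ell\ge1$, let $P_0,\dots,P_{\ell-1}\in L_1(0,1)$ be real-valued, and let $\mathcal L$ be a self-adjoint operator in the complex space $L_2(0,1)$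 with $\langle \mathcal Ly,y\rangle\ge c\|y\|^2$ for some $c>0$, generated by the expression $$\mathcal Ly=(-1)^\ell y^{(2\ell)}+\bigl(P_{\ell-1}y^{(\ell-1)}\bigr)^{(\ell-1)}+\dots+P_0y$$ with any boundary conditions that make it self-adjoint and positive definite; that is, every $y$ in its domain lies in $W_2^\ell(0,1)$ and $\mathcal Ly$ is given by this expression in the sense of distributions on $(0,1)$. Consider the eigenvalue problem $\lambda\mathcal Ly=\mu y$ with the boundary conditions of $\mathcal L$, understood weakly: $y$ belongs to the domain of the closed quadratic form $Q_{\mathcal L}$ of $\mathcal L$, has a continuous representative, and $\lambda Q_{\mathcal L}(y,v)=\int_0^1 y\,\overline v\,d\mu$ for all $v$ in the domain of $\mathcal L$, where $Q_{\mathcal L}(y,v)=\langle y,\mathcal Lv\rangle$ and continuous representatives are used in the integral. **Theorem.** Put $q=\dfrac1{|d_m|\,a_m^{2\ell-1}}$. Then $q>1$. There are no negative eigenvalues, and the positive ones, repeated according to multiplicity, form an infinite nonincreasing sequence $\lambda_1\ge\lambda_2\ge\dots>0$ with only finitely many terms above each positive level. The counting function $\mathcal N(\lambda)=\#\{j:\lambda_j>\lambda\}$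 satisfies $$\mathcal N(\lambda)\sim (n-1)\,\frac{\ln(1/\lambda)}{\ln q},\qquad \lambda\to0+ ,$$ and accordingly the eigenvalues decay exponentially, in the sense that $$\ln\frac1{\lambda_j}\sim \frac{\ln q}{n-1}\,j,\qquad j\to\infty .$$ -/

import Mathlib

open MeasureTheory Filter Topology Set
open scoped ContDiff ComplexConjugate

noncomputable section

namespace DegenerateString

/-! ### Degenerate self-similar measures on the unit interval -/

/-- Parameters of a similarity operator with exactly one nonzero ratio `d m`, where `|d m| < 1`.
The point `α k.castSucc` is the left end and `α k.succ` the right end of the `k`-th interval of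
the partition (with `k` counted from `0`). -/
structure SimilarityData (n : ℕ) where
  α : Fin (n + 1) → ℝ
  e : Fin n → Bool
  d : Fin n → ℝ
  β : Fin n → ℝ
  m : Fin n
  α_strictMono : StrictMono α
  α_zero : α 0 = 0
  α_last : α (Fin.last n) = 1
  d_m_ne_zero : d m ≠ 0
  d_eq_zero : ∀ k, k ≠ m → d k = 0
  abs_d_m_lt_one : |d m| < 1

namespace SimilarityData

variable {n : ℕ} (p : SimilarityData n)

/-- The length of the `k`-th interval of the partition. -/
def a (k : Fin n) : ℝ := p.α k.succ - p.α k.castSucc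

/-- The affine map of `[0, 1]` onto the `k`-th interval, reversing orientation if `e k` holds. -/
def S (k : Fin n) (t : ℝ) : ℝ :=
  if p.e k then p.α k.succ - p.a k * t else p.a k * t + p.α k.castSucc

/-- The inverse of the affine map `S k`. -/
def invS (k : Fin n) (t : ℝ) : ℝ :=
  if p.e k then (p.α k.succ - t) / p.a k else (t - p.α k.castSucc) / p.a k

theorem a_pos (k : Fin n) : 0 < p.a k :=
  sub_pos.2 (p.α_strictMono Fin.castSucc_lt_succ)

theorem invS_S (k : Fin n) (t : ℝ) : p.invS k (p.S k t) = t := by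
  have h := (p.a_pos k).ne'
  unfold invS S
  split_ifs <;> field_simp <;> ring

theorem S_invS (k : Fin n) (t : ℝ) : p.S k (p.invS k t) = t := by
  have h := (p.a_pos k).ne'
  unfold invS S
  split_ifs <;> field_simp <;> ring

/-- The similarity operator. -/
def similarityOperator (f : ℝ → ℝ) (t : ℝ) : ℝ :=
  ∑ k, (Ioo (p.α k.castSucc) (p.α k.succ)).indicator (fun s => p.d k * f (p.invS k s) + p.β k) t

/-- `f` represents the fixed point of the similarity operator in `L_∞(0, 1)`. -/
def IsSelfSimilar (f : ℝ → ℝ) : Prop :=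
  MemLp f ⊤ (volume.restrict (Ioo 0 1)) ∧
    p.similarityOperator f =ᵐ[volume.restrict (Ioo 0 1)] f

/-- `μ` is the (nonnegative) measure on `[0, 1]` given by `μ [a, b] = f (b + 0) - f a`, where `f` is
the left-continuous representative of the self-similar function and `f` jumps at every interior
point of the partition.  The function `f` is extended to `0` by continuity from the right and is
constant on each side of `(0, 1)`, so that there are no atoms at the end-points. -/
def IsDegenerateSelfSimilarMeasure (μ : Measure ℝ) : Prop :=
  μ (Icc 0 1)ᶜ = 0 ∧
    ∃ f : ℝ → ℝ, p.IsSelfSimilar f ∧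
      (∀ t ∈ Ioc (0 : ℝ) 1, ContinuousWithinAt f (Iic t) t) ∧
      ContinuousWithinAt f (Ici 0) 0 ∧
      (∀ t ≤ 0, f t = f 0) ∧
      (∀ t, 1 ≤ t → f t = f 1) ∧
      (∀ k, k ≠ 0 → k ≠ Fin.last n → Function.rightLim f (p.α k) ≠ f (p.α k)) ∧
      ∀ a b : ℝ, 0 ≤ a → a ≤ b → b ≤ 1 → μ.real (Icc a b) = Function.rightLim f b - f a

/-- The number `q = 1 / (|d_m| a_m ^ (2ℓ - 1))`, for `ℓ ≥ 1`. -/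
def q (ℓ : ℕ) : ℝ := 1 / (|p.d p.m| * p.a p.m ^ (2 * ℓ - 1))

end SimilarityData

/-! ### Self-adjoint ordinary differential operators on `(0, 1)` -/

/-- The complex Hilbert space `L_2(0, 1)`. -/
abbrev H : Type := Lp ℂ 2 (volume.restrict (Ioo (0 : ℝ) 1))

/-- `D 0` belongs to the Sobolev space `W_2^ℓ(0, 1)` and `D i` is its `i`-th derivative, `i ≤ ℓ`:
for `i < ℓ` the function `D i` is absolutely continuous on `[0, 1]`, being the indefinite integral
of `D (i + 1)`, and `D ℓ` is square integrable. -/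
structure IsSobolevChain (ℓ : ℕ) (D : ℕ → ℝ → ℂ) : Prop where
  integrable : ∀ i < ℓ, IntervalIntegrable (D (i + 1)) volume 0 1
  eq_integral : ∀ i < ℓ, ∀ t ∈ Icc (0 : ℝ) 1, D i t = D i 0 + ∫ s in (0 : ℝ)..t, D (i + 1) s
  memLp : MemLp (D ℓ) 2 (volume.restrict (Ioo 0 1))

/-- Test functions on the open interval `(0, 1)`. -/
structure IsTestFunction (φ : ℝ → ℝ) : Prop where
  contDiff : ContDiff ℝ ∞ φ
  hasCompactSupport : HasCompactSupport φ
  tsupport_subset : tsupport φ ⊆ Ioo 0 1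

/-- `u ∈ W_2^ℓ(0, 1)` and
`(-1)^ℓ u^(2ℓ) + (P_{ℓ-1} u^(ℓ-1))^(ℓ-1) + ⋯ + P_0 u = g` in the sense of distributions on `(0, 1)`.
The outer derivatives are moved to the test function; in the leading term the derivative of order
`ℓ` of `u^(ℓ)` gives the sign `(-1)^ℓ (-1)^ℓ = 1`. -/
def SatisfiesODE (ℓ : ℕ) (P : Fin ℓ → ℝ → ℝ) (u g : H) : Prop :=
  ∃ D : ℕ → ℝ → ℂ, IsSobolevChain ℓ D ∧ D 0 =ᵐ[volume.restrict (Ioo 0 1)] u ∧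
    ∀ φ : ℝ → ℝ, IsTestFunction φ →
      ∫ t in Ioo (0 : ℝ) 1, (D ℓ t * ((iteratedDeriv ℓ φ t : ℝ) : ℂ) +
          ∑ i : Fin ℓ, (-1) ^ (i : ℕ) * (P i t : ℂ) * D i t * ((iteratedDeriv i φ t : ℝ) : ℂ)) =
        ∫ t in Ioo (0 : ℝ) 1, g t * (φ t : ℂ)

/-- A self-adjoint positive definite operator in `L_2(0, 1)` generated by the differential
expression with coefficients `P`.  A self-adjoint restriction of the maximal operator is the same
thing as the choice of self-adjoint boundary conditions at the end-points. -/
structure SelfAdjointRealization (ℓ : ℕ) (P : Fin ℓ → ℝ → ℝ) where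
  toLinearPMap : H →ₗ.[ℂ] H
  isSelfAdjoint : IsSelfAdjoint toLinearPMap
  posDef : ∃ c : ℝ, 0 < c ∧ ∀ x : toLinearPMap.domain,
    c * ‖(x : H)‖ ^ 2 ≤ (inner ℂ (toLinearPMap x) (x : H)).re
  satisfiesODE : ∀ x : toLinearPMap.domain, SatisfiesODE ℓ P x (toLinearPMap x)

namespace SelfAdjointRealization

variable {ℓ : ℕ} {P : Fin ℓ → ℝ → ℝ} (L : SelfAdjointRealization ℓ P)

/-- The quadratic form `⟨L x, x⟩` on the domain of `L`. -/
def form (x : L.toLinearPMap.domain) : ℝ := (inner ℂ (L.toLinearPMap x) (x : H)).re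

theorem form_nonneg (x : L.toLinearPMap.domain) : 0 ≤ L.form x := by
  obtain ⟨c, hc, h⟩ := L.posDef
  exact le_trans (by positivity) (h x)

theorem form_add_le (x y : L.toLinearPMap.domain) :
    L.form (x + y) ≤ 2 * L.form x + 2 * L.form y := by
  have h := L.form_nonneg (x - y)
  simp only [form, LinearPMap.map_sub, LinearPMap.map_add, Submodule.coe_sub, Submodule.coe_add,
    inner_sub_left, inner_sub_right, inner_add_left, inner_add_right, Complex.sub_re,
    Complex.add_re] at h ⊢
  linarith

theorem form_smul (c : ℂ) (x : L.toLinearPMap.domain) :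
    L.form (c • x) = ‖c‖ ^ 2 * L.form x := by
  simp only [form, LinearPMap.map_smul, Submodule.coe_smul, inner_smul_left, inner_smul_right]
  rw [← mul_assoc, Complex.mul_conj', ← Complex.ofReal_pow, Complex.re_ofReal_mul]

/-- The domain of the closed quadratic form of `L` (the energy space): all limits in `L_2(0, 1)` of
sequences in the domain of `L` that are Cauchy for the form. -/
def formDomain : Submodule ℂ H where
  carrier := {u | ∃ s : ℕ → L.toLinearPMap.domain,
    Tendsto (fun k => (s k : H)) atTop (𝓝 u) ∧
      ∀ ε : ℝ, 0 < ε → ∃ N, ∀ j ≥ N, ∀ k ≥ N, L.form (s j - s k) < ε}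
  zero_mem' := ⟨fun _ => 0, by simp, fun ε hε => ⟨0, fun _ _ _ _ => by simpa [form] using hε⟩⟩
  add_mem' := by
    rintro u v ⟨s, hs, hs'⟩ ⟨r, hr, hr'⟩
    refine ⟨fun k => s k + r k, by simpa using hs.add hr, fun ε hε => ?_⟩
    obtain ⟨N, hN⟩ := hs' (ε / 4) (by positivity)
    obtain ⟨M, hM⟩ := hr' (ε / 4) (by positivity)
    refine ⟨max N M, fun j hj k hk => ?_⟩
    have h1 := hN j (le_of_max_le_left hj) k (le_of_max_le_left hk)
    have h2 := hM j (le_of_max_le_right hj) k (le_of_max_le_right hk)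
    have h3 := L.form_add_le (s j - s k) (r j - r k)
    rw [sub_add_sub_comm] at h3
    linarith
  smul_mem' := by
    rintro c u ⟨s, hs, hs'⟩
    refine ⟨fun k => c • s k, by simpa using hs.const_smul c, fun ε hε => ?_⟩
    obtain ⟨N, hN⟩ := hs' (ε / (‖c‖ ^ 2 + 1)) (by positivity)
    refine ⟨N, fun j hj k hk => ?_⟩
    have h1 := hN j hj k hk
    rw [lt_div_iff₀ (by positivity)] at h1
    rw [← smul_sub, form_smul]
    nlinarith [L.form_nonneg (s j - s k)]

/-- The space of solutions of `ν L y = μ y` together with the boundary conditions, in the weak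
sense: `y` lies in the energy space, is continuous on `[0, 1]`, and
`ν Q_L(y, v) = ∫ y conj v dμ` for all `v` in the domain of `L`, where `Q_L(y, v) = ⟨y, L v⟩` (the
domain of `L` is dense in the energy space).  Here `z` is the continuous representative of `v`;
Mathlib's inner product is linear in the second variable. -/
def eigenspace (μ : Measure ℝ) [IsFiniteMeasure μ] (ν : ℝ) : Submodule ℂ H where
  carrier := {u | u ∈ L.formDomain ∧ ∃ y : ℝ → ℂ, ContinuousOn y (Icc 0 1) ∧
    y =ᵐ[volume.restrict (Ioo 0 1)] u ∧
    ∀ (v : L.toLinearPMap.domain) (z : ℝ → ℂ), ContinuousOn z (Icc 0 1) →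
      z =ᵐ[volume.restrict (Ioo 0 1)] (v : H) →
      (ν : ℂ) * inner ℂ (L.toLinearPMap v) u = ∫ t in Icc (0 : ℝ) 1, y t * conj (z t) ∂μ}
  zero_mem' := ⟨L.formDomain.zero_mem, fun _ => 0, continuousOn_const,
    (Lp.coeFn_zero ℂ 2 (volume.restrict (Ioo (0 : ℝ) 1))).symm, fun _ _ _ _ => by simp⟩
  add_mem' := by
    rintro u₁ u₂ ⟨h₁, y₁, hc₁, he₁, hy₁⟩ ⟨h₂, y₂, hc₂, he₂, hy₂⟩
    refine ⟨L.formDomain.add_mem h₁ h₂, y₁ + y₂, hc₁.add hc₂,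
      (he₁.add he₂).trans (Lp.coeFn_add u₁ u₂).symm, fun v z hz hv => ?_⟩
    have hz' : ContinuousOn (fun t => conj (z t)) (Icc 0 1) :=
      Complex.continuous_conj.comp_continuousOn hz
    have h := integral_add (μ := μ.restrict (Icc 0 1))
      ((hc₁.mul hz').integrableOn_compact isCompact_Icc)
      ((hc₂.mul hz').integrableOn_compact isCompact_Icc)
    simp only [Pi.mul_apply] at h
    rw [inner_add_right, mul_add, hy₁ v z hz hv, hy₂ v z hz hv, ← h]
    simp only [Pi.add_apply, add_mul]
  smul_mem' := by
    rintro c u ⟨h, y, hc, he, hy⟩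
    refine ⟨L.formDomain.smul_mem c h, c • y, hc.const_smul c,
      (he.const_smul c).trans (Lp.coeFn_smul c u).symm, fun v z hz hv => ?_⟩
    rw [inner_smul_right, mul_left_comm, hy v z hz hv, ← integral_const_mul]
    simp only [Pi.smul_apply, smul_eq_mul, mul_assoc]

/-- `ev` is the sequence of the eigenvalues of `ν L y = μ y`, positive, in decreasing order and
repeated according to multiplicity, with finitely many terms above every positive level. -/
structure IsEigenvalueSequence (μ : Measure ℝ) [IsFiniteMeasure μ] (ev : ℕ → ℝ) : Prop where
  antitone : Antitone ev
  pos : ∀ j, 0 < ev j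
  multiplicity : ∀ ν : ℝ, ν ≠ 0 → {j | ev j = ν}.encard = (Module.rank ℂ (L.eigenspace μ ν)).toENat
  finite : ∀ ν : ℝ, 0 < ν → {j | ν < ev j}.Finite

end SelfAdjointRealization

/-- The counting function of a sequence: the number of terms above the level `ν`. -/
def countingFunction (ev : ℕ → ℝ) (ν : ℝ) : ℕ := {j | ν < ev j}.ncard

end DegenerateString

end

noncomputable section

namespace DegenerateString

/-! ### Eigenvalues of compact positive operators -/

section CompactPositive

variable {V : Type*} [NormedAddCommGroup V] [InnerProductSpace ℂ V]

open Module.End ContinuousLinearMap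

/-! Complete the domain of `L` in the energy norm `⟨L u, u⟩` and let `E` be the embedding of the
completion into `L_2(μ)`. The weak eigenvalue problem is the eigenvalue equation of the positive
operator `E* E` (`toL2_jet_mem_eigenspace_iff`), whose quadratic form is `∫ |v|² dμ`. Everything
then reduces to minimax bounds for this form against the energy.

Only one `d_k` is nonzero, so `μ` is a tower of atoms (`atomicTower`): level `j` consists of the
images of the `n - 1` partition points under the `j`-th iterate of `S_m`, with masses of order
`|d_m|^j`. What the levels below `J` leave over lies in the `J`-th image of `(0,1)`, an interval of
length `a_m^J` and mass at most `|d_m|^J`. Put `r = |d_m| a_m^(2ℓ-1) = 1/q`.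

Upper bound: require `v` to vanish at the atoms of the first `J` levels and all its derivatives of
order below `ℓ` to vanish at one point of the tail, `(n-1)J + ℓ` conditions in all. Taylor's formula
with Cauchy–Schwarz gives `|v|² ≤ (a_m^J)^(2ℓ-1) ‖v^(ℓ)‖²` on the tail, whence `∫ |v|² dμ ≤ C r^J
‖v‖²` (`norm_sq_embedding_le`). The same estimate makes `E` compact.

Lower bound: put a bump of width comparable to `a_m^j` around each atom of level `j ≤ J`, with
disjoint supports. Such a bump has energy of order `a_m^(-j(2ℓ-1))` and `L_2(μ)` norm squared at
least of order `|d_m|^j`, so on their span, of dimension `(n-1)(J+1)`, the form is at least `c r^J`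
times the energy (`exists_submodule_le`).

Thus every `n - 1` further eigenvalues cost a factor `q` up to constants, and both asymptotics
follow by taking logarithms (`log_bounds`).

The analytic difficulty is that the coefficients are merely integrable and the boundary conditions
arbitrary. Two facts deal with this. First, the energy norm dominates the `W_2^ℓ` norm
(`exists_norm_toJet_le`): if `u` and its derivatives of order below `ℓ` vanish on a fine grid
containing both end-points, then `u` may test its own equation, the lower-order terms are absorbed,
and the finitely many grid conditions are removed by an abstract argument. Secondly, bumps need not
lie in the domain of `L`, but `u ↦ ⟨φ, L u⟩` is bounded in the energy norm, so Riesz representation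
places them in the energy space (`exists_representer`). -/

theorem hasEigenvalue_norm_of_isPositive [CompleteSpace V] {A : V →L[ℂ] V} (hc : IsCompactOperator A)
    (hA : A.IsPositive) (h0 : A ≠ 0) : HasEigenvalue (A : Module.End ℂ V) ((‖A‖ : ℝ) : ℂ) := by
  have hn : ((‖A‖ : ℝ) : ℂ) ≠ 0 := by simpa using h0
  have : Nontrivial V := by
    by_contra h
    rw [not_nontrivial_iff_subsingleton] at h
    exact h0 (by ext x; exact Subsingleton.elim _ _)
  -- By the Fredholm alternative the only other case is that `‖A‖` is in the resolvent set. This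
  -- keeps the Rayleigh quotients away from `‖A‖`, although for a positive operator their supremum
  -- is `‖A‖`.
  refine (hc.hasEigenvalue_or_mem_resolventSet hn).resolve_right fun hr => ?_
  obtain ⟨ε, hε, h⟩ := A.rayleighQuotient_le_of_norm_mem_resolventSet (𝕜 := ℂ) hr
  have h1 : ‖A‖ = ⨆ x, |A.rayleighQuotient x| :=
    norm_eq_iSup_rayleighQuotient A hA.isSelfAdjoint.isSymmetric
  have h2 : ⨆ x, |A.rayleighQuotient x| ≤ ‖A‖ - ε := ciSup_le fun x => by
    have h3 : 0 ≤ A.rayleighQuotient x :=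
      div_nonneg (hA.re_inner_nonneg_left x) (by positivity)
    rw [abs_of_nonneg h3]
    exact h x
  linarith

/-- A finite-dimensional invariant subspace can be enlarged by an eigenvector that maximizes the
quadratic form on the orthogonal complement. -/
theorem exists_max_eigenvector [CompleteSpace V] {A : V →L[ℂ] V} (hc : IsCompactOperator A) (hA : A.IsPositive)
    (U : Submodule ℂ V) [FiniteDimensional ℂ U] (hU : ∀ u ∈ U, A u ∈ U)
    (hv : ∃ v ∈ Uᗮ, 0 < (inner ℂ (A v) v).re) :
    ∃ e ∈ Uᗮ, ∃ r : ℝ, ‖e‖ = 1 ∧ 0 < r ∧ A e = (r : ℂ) • e ∧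
      ∀ v ∈ Uᗮ, (inner ℂ (A v) v).re ≤ r * ‖v‖ ^ 2 := by
  have hU' : ∀ v ∈ Uᗮ, A v ∈ Uᗮ := fun v hv u hu => by
    rw [← hA.isSelfAdjoint.isSymmetric.apply_clm u v]
    exact hv _ (hU u hu)
  -- The restriction to the invariant complement is again compact and positive, so its norm is an
  -- eigenvalue and at the same time bounds its quadratic form.
  let B : Uᗮ →L[ℂ] Uᗮ := A.restrict hU'
  have hBA : ∀ v : Uᗮ, ((B v : Uᗮ) : V) = A v := fun v => rfl
  have hBc : IsCompactOperator B := hc.restrict' hU'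
  have hB : B.IsPositive := by
    refine ⟨fun x y => ?_, fun x => ?_⟩
    · exact hA.isSelfAdjoint.isSymmetric x y
    · exact hA.2 x
  have hB0 : B ≠ 0 := by
    rintro h
    obtain ⟨v, hv, hv'⟩ := hv
    have : A v = 0 := by rw [← hBA ⟨v, hv⟩, h]; rfl
    simp [this] at hv'
  obtain ⟨w, hw, hw0⟩ := (hasEigenvalue_norm_of_isPositive hBc hB hB0).exists_hasEigenvector
  have hwB : B w = ((‖B‖ : ℝ) : ℂ) • w := by simpa using mem_eigenspace_iff.1 hw
  have hwn : ‖w‖ ≠ 0 := norm_ne_zero_iff.2 hw0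
  refine ⟨((‖w‖⁻¹ : ℝ) : ℂ) • (w : V), Submodule.smul_mem _ _ w.2, ‖B‖, ?_,
    (norm_nonneg B).lt_of_ne' fun h => hB0 (B.opNorm_zero_iff.1 h), ?_,
    fun v hv => ?_⟩
  · rw [norm_smul]
    simp only [Complex.norm_real, norm_inv, norm_norm, Submodule.coe_norm]
    exact inv_mul_cancel₀ hwn
  · rw [map_smul, ← hBA, hwB, Submodule.coe_smul, smul_comm]
  · have := B.le_opNorm ⟨v, hv⟩
    calc (inner ℂ (A v) v).re ≤ ‖inner ℂ (A v) v‖ := Complex.re_le_norm _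
      _ ≤ ‖A v‖ * ‖v‖ := norm_inner_le_norm _ _
      _ ≤ ‖B‖ * ‖v‖ * ‖v‖ := by gcongr; exact this
      _ = ‖B‖ * ‖v‖ ^ 2 := by ring

theorem exists_mem_orthogonal_of_finrank_lt {U M : Submodule ℂ V} [FiniteDimensional ℂ U]
    (h : Module.finrank ℂ U < Module.finrank ℂ M) : ∃ v ∈ M, v ∈ Uᗮ ∧ v ≠ 0 := by
  -- `finrank` is zero on infinite-dimensional spaces, so the strict inequality already forces `M`
  -- to be finite-dimensional.
  have hfin : FiniteDimensional ℂ M := Module.finite_of_finrank_pos (by omega)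
  let P : M →ₗ[ℂ] U := (U.orthogonalProjectionOnto : V →ₗ[ℂ] U).comp M.subtype
  obtain ⟨v, hv, hv0⟩ := (Submodule.ne_bot_iff _).1 (P.ker_ne_bot_of_finrank_lt h)
  refine ⟨v, v.2, ?_, by simpa using hv0⟩
  exact Submodule.orthogonalProjectionOnto_eq_zero_iff.1 hv

/-- The maximal eigenvectors and eigenvalues of a compact positive operator of infinite rank. -/
structure IsEigenSystem (A : V →L[ℂ] V) (ev : ℕ → ℝ) (e : ℕ → V) : Prop where
  antitone : Antitone ev
  pos : ∀ j, 0 < ev j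
  orthonormal : Orthonormal ℂ e
  apply_eq : ∀ j, A (e j) = (ev j : ℂ) • e j
  le : ∀ j v, (∀ i < j, inner ℂ (e i) v = 0) → (inner ℂ (A v) v).re ≤ ev j * ‖v‖ ^ 2

/-- Greedy construction: adjoin again and again a top eigenvector of the orthogonal complement of
what has been collected. Positivity of the form on subspaces of arbitrarily large dimension keeps
the process from stopping, and maximality at each stage yields both monotonicity and the bound `le`.
-/
theorem exists_isEigenSystem [CompleteSpace V] {A : V →L[ℂ] V} (hc : IsCompactOperator A) (hA : A.IsPositive)
    (hinf : ∀ N : ℕ, ∃ M : Submodule ℂ V, N < Module.finrank ℂ M ∧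
      ∀ v ∈ M, v ≠ 0 → 0 < (inner ℂ (A v) v).re) :
    ∃ ev e, IsEigenSystem A ev e := by
  let Good := {U : Submodule ℂ V // FiniteDimensional ℂ U ∧ ∀ u ∈ U, A u ∈ U}
  have key : ∀ U : Good, ∃ x : V × ℝ, x.1 ∈ (U.1)ᗮ ∧ ‖x.1‖ = 1 ∧ 0 < x.2 ∧
      A x.1 = (x.2 : ℂ) • x.1 ∧ ∀ v ∈ (U.1)ᗮ, (inner ℂ (A v) v).re ≤ x.2 * ‖v‖ ^ 2 := by
    rintro ⟨U, hf, hU⟩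
    obtain ⟨M, hM, hM'⟩ := hinf (Module.finrank ℂ U)
    obtain ⟨v, hv, hvU, hv0⟩ := exists_mem_orthogonal_of_finrank_lt hM
    obtain ⟨e, he, r, h⟩ := exists_max_eigenvector hc hA U hU ⟨v, hvU, hM' v hv hv0⟩
    exact ⟨(e, r), he, h⟩
  choose pick h1 h2 h3 h4 h5 using key
  let next : Good → Good := fun U => ⟨U.1 ⊔ Submodule.span ℂ {(pick U).1}, by
    have := U.2.1
    infer_instance, fun u hu => by
    obtain ⟨y, hy, z, hz, rfl⟩ := Submodule.mem_sup.1 hu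
    obtain ⟨c, rfl⟩ := Submodule.mem_span_singleton.1 hz
    rw [map_add, map_smul, h4]
    exact Submodule.add_mem_sup (U.2.2 y hy) (Submodule.smul_mem _ _ (Submodule.smul_mem _ _
      (Submodule.mem_span_singleton_self _)))⟩
  let F : ℕ → Good := fun j => Nat.rec ⟨⊥, inferInstance, by simp⟩ (fun _ => next) j
  have hF : ∀ j, F (j + 1) = next (F j) := fun j => rfl
  have hmono : Monotone fun j => (F j).1 := monotone_nat_of_le_succ fun j => by
    rw [hF]; exact le_sup_left
  have hmem : ∀ i j, i < j → (pick (F i)).1 ∈ (F j).1 := fun i j hij => by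
    refine hmono (Nat.succ_le_of_lt hij) ?_
    change _ ∈ (F (i + 1)).1
    rw [hF]
    exact Submodule.mem_sup_right (Submodule.mem_span_singleton_self _)
  have horth : ∀ i j, i < j → inner ℂ (pick (F i)).1 (pick (F j)).1 = 0 := fun i j hij =>
    h1 (F j) _ (hmem i j hij)
  refine ⟨fun j => (pick (F j)).2, fun j => (pick (F j)).1, ?_, fun j => h3 _, ⟨fun j => h2 _, ?_⟩,
    fun j => h4 _, fun j v hv => h5 _ v ?_⟩
  · refine antitone_nat_of_succ_le fun j => ?_
    have hle := h5 (F j) (pick (F (j + 1))).1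
      (Submodule.orthogonal_le (hmono (Nat.le_succ j)) (h1 (F (j + 1))))
    rw [h4, inner_smul_left, inner_self_eq_norm_sq_to_K, h2] at hle
    simpa using hle
  · intro i j hij
    rcases lt_or_gt_of_ne hij with h | h
    · exact horth i j h
    · exact inner_eq_zero_symm.1 (horth j i h)
  · suffices H : ∀ k ≤ j, v ∈ ((F k).1)ᗮ from H j le_rfl
    intro k hk
    induction k with
    | zero => simp [F]
    | succ k ih =>
      rw [hF, ← Submodule.inf_orthogonal]
      exact ⟨ih (by omega), Submodule.mem_orthogonal_singleton_iff_inner_right.2 (hv k (by omega))⟩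

namespace IsEigenSystem

variable {A : V →L[ℂ] V} {ev : ℕ → ℝ} {e : ℕ → V}

theorem mul_norm_sq_le (h : IsEigenSystem A ev e) (k : ℕ) {v : V}
    (hv : v ∈ Submodule.span ℂ (Set.range fun i : Fin (k + 1) => e i)) :
    ev k * ‖v‖ ^ 2 ≤ (inner ℂ (A v) v).re := by
  obtain ⟨c, rfl⟩ := (Submodule.mem_span_range_iff_exists_fun ℂ).1 hv
  have ho : Orthonormal ℂ fun i : Fin (k + 1) => e i := h.orthonormal.comp _ Fin.val_injective
  have h1 : A (∑ i, c i • e i) = ∑ i : Fin (k + 1), ((ev i : ℂ) * c i) • e i := by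
    simp only [map_sum, map_smul, h.apply_eq, smul_smul, mul_comm]
  have h2 : ‖∑ i, c i • e i‖ ^ 2 = ∑ i, ‖c i‖ ^ 2 := by
    have := ho.inner_sum c c Finset.univ
    rw [inner_self_eq_norm_sq_to_K] at this
    have h3 : ∀ i, conj (c i) * c i = ((‖c i‖ ^ 2 : ℝ) : ℂ) := fun i => by
      rw [Complex.conj_mul']; simp
    simp only [h3] at this
    apply Complex.ofReal_injective
    rw [Complex.ofReal_sum, ← this]
    simp
  rw [h1, ho.inner_sum, h2, Finset.mul_sum, Complex.re_sum]
  refine Finset.sum_le_sum fun i _ => ?_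
  have h3 : (conj ((ev i : ℂ) * c i) * c i).re = ev i * ‖c i‖ ^ 2 := by
    rw [map_mul, Complex.conj_ofReal, mul_assoc, Complex.conj_mul', ← Complex.ofReal_pow,
      Complex.re_ofReal_mul, Complex.ofReal_re]
  rw [h3]
  exact mul_le_mul_of_nonneg_right (h.antitone (Nat.lt_succ_iff.1 i.2)) (by positivity)

/-- One half of the minimax principle: the span of the first `k + 1` eigenvectors meets the common
kernel of `k` functionals, and on that span the form is at least `ev k`. -/
theorem le_of_functionals (h : IsEigenSystem A ev e) {k : ℕ} {ε : ℝ} (B : V →ₗ[ℂ] (Fin k → ℂ))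
    (hB : ∀ v, B v = 0 → (inner ℂ (A v) v).re ≤ ε * ‖v‖ ^ 2) : ev k ≤ ε := by
  set M := Submodule.span ℂ (Set.range fun i : Fin (k + 1) => e i)
  have hli : LinearIndependent ℂ fun i : Fin (k + 1) => e i :=
    (h.orthonormal.comp _ Fin.val_injective).linearIndependent
  have hr : Module.finrank ℂ M = k + 1 := by simpa using finrank_span_eq_card hli
  have hfin : FiniteDimensional ℂ M := Module.finite_of_finrank_pos (by omega)
  obtain ⟨v, hv, hv0⟩ := (Submodule.ne_bot_iff _).1
    ((B.comp M.subtype).ker_ne_bot_of_finrank_lt (by simp [hr]))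
  have h1 := hB v hv
  have h2 := h.mul_norm_sq_le k v.2
  have h3 : 0 < ‖(v : V)‖ := norm_pos_iff.2 (by simpa using hv0)
  exact le_of_mul_le_mul_right (h2.trans h1) (by positivity)

/-- The other half of the minimax principle: `M` contains a vector orthogonal to the first `k`
eigenvectors, where the form is at most `ev k`. -/
theorem le_of_finrank (h : IsEigenSystem A ev e) {k : ℕ} {c : ℝ} (M : Submodule ℂ V)
    (hM : k < Module.finrank ℂ M) (hc : ∀ v ∈ M, c * ‖v‖ ^ 2 ≤ (inner ℂ (A v) v).re) :
    c ≤ ev k := by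
  set U := Submodule.span ℂ (Set.range fun i : Fin k => e i)
  have hU : FiniteDimensional ℂ U := FiniteDimensional.span_of_finite ℂ (Set.finite_range _)
  have hr : Module.finrank ℂ U < Module.finrank ℂ M :=
    (finrank_range_le_card _).trans_lt (by simpa using hM)
  obtain ⟨v, hv, hvU, hv0⟩ := exists_mem_orthogonal_of_finrank_lt hr
  have h1 := h.le k v fun i hi => hvU _ (Submodule.subset_span ⟨⟨i, hi⟩, rfl⟩)
  have h3 : 0 < ‖v‖ := norm_pos_iff.2 hv0
  exact le_of_mul_le_mul_right ((hc v hv).trans h1) (by positivity)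

/-- The eigenspace of `ν ≠ 0` is spanned by the `e j` with `ev j = ν`, because the system misses
nothing but the kernel of `A`. For negative `ν` both sides are zero, which excludes negative
eigenvalues. -/
theorem encard_eq [CompleteSpace V] (h : IsEigenSystem A ev e) (hA : A.IsPositive) (h0 : Tendsto ev atTop (𝓝 0))
    {ν : ℝ} (hν : ν ≠ 0) :
    {j | ev j = ν}.encard = (Module.rank ℂ (eigenspace (A : Module.End ℂ V) (ν : ℂ))).toENat := by
  classical
  have hfin : {j | ev j = ν}.Finite := by
    rcases hν.lt_or_gt with hν' | hν'
    · convert Set.finite_empty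
      exact Set.eq_empty_of_forall_notMem fun j hj => by
        have := h.pos j
        rw [show ev j = ν from hj] at this
        linarith
    · obtain ⟨N, hN⟩ := eventually_atTop.1 (h0.eventually (gt_mem_nhds hν'))
      refine (Set.finite_Iio N).subset fun j hj => ?_
      by_contra hj'
      have := hN j (not_lt.1 hj')
      rw [show ev j = ν from hj] at this
      exact lt_irrefl _ this
  have horth : ∀ u : V, A u = (ν : ℂ) • u → ∀ i, ev i ≠ ν → inner ℂ (e i) u = 0 := fun u hu i hi => by
    have h1 := hA.isSelfAdjoint.isSymmetric.apply_clm (e i) u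
    rw [h.apply_eq, hu, inner_smul_left, inner_smul_right, Complex.conj_ofReal] at h1
    have h2 : ((ev i : ℂ) - ν) * inner ℂ (e i) u = 0 := by rw [sub_mul, h1, sub_self]
    refine (mul_eq_zero.1 h2).resolve_left ?_
    rw [← Complex.ofReal_sub]
    exact Complex.ofReal_ne_zero.2 (sub_ne_zero.2 hi)
  -- A vector orthogonal to the whole system satisfies `ν ‖u‖² ≤ ev j ‖u‖²` for every `j`, and `ev
  -- j` tends to zero.
  have hzero : ∀ u : V, A u = (ν : ℂ) • u → (∀ i, inner ℂ (e i) u = 0) → u = 0 := fun u hu hi => by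
    have h1 : (inner ℂ (A u) u).re = ν * ‖u‖ ^ 2 := by
      rw [hu, inner_smul_left, inner_self_eq_norm_sq_to_K, Complex.conj_ofReal]
      rw [Complex.re_ofReal_mul]
      simp [← Complex.ofReal_pow]
    have h2 : ν * ‖u‖ ^ 2 ≤ 0 := by
      refine ge_of_tendsto' (x := atTop) (by simpa using h0.mul_const (‖u‖ ^ 2)) fun j => ?_
      rw [← h1]
      exact h.le j u fun i _ => hi i
    have h3 : 0 ≤ ν * ‖u‖ ^ 2 := h1 ▸ hA.re_inner_nonneg_left u
    have h4 : ‖u‖ ^ 2 = 0 := (mul_eq_zero.1 (le_antisymm h2 h3)).resolve_left hν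
    simpa using h4
  have hspan : eigenspace (A : Module.End ℂ V) (ν : ℂ) =
      Submodule.span ℂ (Set.range fun j : {j | ev j = ν} => e j) := by
    refine le_antisymm (fun u hu => ?_) (Submodule.span_le.2 ?_)
    · have hu' : A u = (ν : ℂ) • u := by simpa using mem_eigenspace_iff.1 hu
      set p := ∑ j ∈ hfin.toFinset, inner ℂ (e j) u • e j with hp
      have hAp : A p = (ν : ℂ) • p := by
        rw [hp, map_sum, Finset.smul_sum]
        refine Finset.sum_congr rfl fun j hj => ?_
        rw [map_smul, h.apply_eq, smul_comm, show ev j = ν from hfin.mem_toFinset.1 hj]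
      have hpu : u - p = 0 := by
        refine hzero _ (by rw [map_sub, hu', hAp, smul_sub]) fun i => ?_
        by_cases hi : ev i = ν
        · rw [inner_sub_right, hp, h.orthonormal.inner_right_sum _ (hfin.mem_toFinset.2 hi), sub_self]
        · exact horth _ (by rw [map_sub, hu', hAp, smul_sub]) i hi
      rw [sub_eq_zero.1 hpu, hp]
      exact Submodule.sum_mem _ fun j hj => Submodule.smul_mem _ _
        (Submodule.subset_span ⟨⟨j, hfin.mem_toFinset.1 hj⟩, rfl⟩)
    · rintro _ ⟨⟨j, hj⟩, rfl⟩
      refine mem_eigenspace_iff.2 ?_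
      have := h.apply_eq j
      rwa [show ev j = ν from hj] at this
  have hli : LinearIndependent ℂ fun j : {j | ev j = ν} => e j :=
    (h.orthonormal.comp _ Subtype.val_injective).linearIndependent
  rw [hspan, rank_span hli, ← Set.image_eq_range, Set.toENat_cardinalMk,
    h.orthonormal.linearIndependent.injective.encard_image]

end IsEigenSystem

end CompactPositive

end DegenerateString

end

/-! ### A compactness criterion -/

noncomputable section

namespace DegenerateString

section

variable {V K : Type*} [NormedAddCommGroup V] [InnerProductSpace ℂ V] [CompleteSpace V]
  [NormedAddCommGroup K] [InnerProductSpace ℂ K]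

/-- An operator that is small on subspaces of finite codimension is compact. -/
theorem isCompactOperator_of_small_on_ker [CompleteSpace K] (J : V →L[ℂ] K)
    (h : ∀ ε : ℝ, 0 < ε → ∃ (k : ℕ) (B : V →L[ℂ] (Fin k → ℂ)), ∀ v, B v = 0 → ‖J v‖ ≤ ε * ‖v‖) :
    IsCompactOperator J := by
  have hcl := isClosed_setOfPred_isCompactOperator (σ₁₂ := RingHom.id ℂ) (M₁ := V) (M₂ := K)
  refine hcl.closure_subset (Metric.mem_closure_iff.2 fun ε hε => ?_)
  obtain ⟨k, B, hB⟩ := h (ε / 2) (by positivity)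
  set U : Submodule ℂ V := LinearMap.ker (B : V →ₗ[ℂ] (Fin k → ℂ)) with hU
  have hUc : IsClosed (U : Set V) := B.isClosed_ker
  have : CompleteSpace U := hUc.completeSpace_coe
  have hfin : FiniteDimensional ℂ (Uᗮ : Submodule ℂ V) := by
    refine FiniteDimensional.of_injective ((B : V →ₗ[ℂ] (Fin k → ℂ)).comp Uᗮ.subtype)
      ((injective_iff_map_eq_zero _).2 fun v hv => ?_)
    have : (v : V) ∈ U ⊓ Uᗮ := ⟨hv, v.2⟩
    rw [Submodule.inf_orthogonal_eq_bot] at this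
    simpa using this
  have hloc : LocallyCompactSpace (Uᗮ : Submodule ℂ V) := by
    have := FiniteDimensional.proper ℂ (Uᗮ : Submodule ℂ V)
    infer_instance
  -- The approximant is `J` after the projection onto the complement of the kernel of `B`. It has
  -- finite rank because `B` is injective there, and the error is `J` on the kernel.
  refine ⟨(J.comp Uᗮ.subtypeL).comp Uᗮ.orthogonalProjectionOnto, ?_, ?_⟩
  · exact (isCompactOperator_of_locallyCompactSpace_rng (J.comp Uᗮ.subtypeL)).comp_clm _
  · rw [dist_eq_norm]
    refine lt_of_le_of_lt (ContinuousLinearMap.opNorm_le_bound _ (by positivity) fun v => ?_)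
      (half_lt_self hε)
    have hv : v - (Uᗮ.orthogonalProjectionOnto v : V) = U.orthogonalProjectionOnto v := by
      rw [sub_eq_iff_eq_add]
      exact (U.starProjection_add_starProjection_orthogonal v).symm
    have : (J - (J.comp Uᗮ.subtypeL).comp Uᗮ.orthogonalProjectionOnto) v =
        J (U.orthogonalProjectionOnto v : V) := by
      rw [← hv]
      simp
    rw [this]
    refine (hB _ (U.orthogonalProjectionOnto v).2).trans ?_
    gcongr
    exact U.norm_orthogonalProjectionOnto_apply_le v

end

end DegenerateString

end

noncomputable section

namespace DegenerateString

/-! ### Exponentially decreasing sequences -/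

/-- A sequence is trapped between two geometric progressions along arithmetic progressions. -/
structure IsGeometricallyTrapped (N ℓ : ℕ) (r : ℝ) (ev : ℕ → ℝ) : Prop where
  antitone : Antitone ev
  pos : ∀ j, 0 < ev j
  le : ∃ C : ℝ, ∀ J, ev (N * J + ℓ) ≤ C * r ^ J
  ge : ∃ c : ℝ, 0 < c ∧ ∀ J, c * r ^ J ≤ ev (N * J)

namespace IsGeometricallyTrapped

variable {N ℓ : ℕ} {r : ℝ} {ev : ℕ → ℝ}

theorem tendsto (h : IsGeometricallyTrapped N ℓ r ev) (hr0 : 0 < r) (hr1 : r < 1) :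
    Tendsto ev atTop (𝓝 0) := by
  obtain ⟨C, hC⟩ := h.le
  have h1 : Tendsto (fun J : ℕ => C * r ^ J) atTop (𝓝 0) := by
    simpa using (tendsto_pow_atTop_nhds_zero_of_lt_one hr0.le hr1).const_mul C
  have h2 : Tendsto (fun J => ev (N * J + ℓ)) atTop (𝓝 0) :=
    squeeze_zero (fun J => (h.pos _).le) hC h1
  refine tendsto_order.2 ⟨fun a ha => Eventually.of_forall fun j => ha.trans (h.pos j),
    fun a ha => ?_⟩
  obtain ⟨J, hJ⟩ := (h2.eventually (gt_mem_nhds ha)).exists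
  exact eventually_atTop.2 ⟨_, fun j hj => (h.antitone hj).trans_lt hJ⟩

/-- Monotonicity extends the bounds from an arithmetic progression of step `N` to all indices at the
cost of a bounded term in the logarithm. The shift by `ℓ` costs another bounded term, and restricts
one of the bounds to `j ≥ ℓ`. -/
theorem log_bounds (h : IsGeometricallyTrapped N ℓ r ev) (hN : 0 < N) (hr0 : 0 < r) (hr1 : r < 1) :
    ∃ C : ℝ, (∀ j, Real.log (1 / ev j) ≤ Real.log (1 / r) / N * j + C) ∧
      ∀ j, ℓ ≤ j → Real.log (1 / r) / N * j - C ≤ Real.log (1 / ev j) := by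
  obtain ⟨C, hC⟩ := h.le
  obtain ⟨c, hc0, hc⟩ := h.ge
  have hC0 : 0 < C := by simpa using (h.pos _).trans_le (hC 0)
  have hN' : (0 : ℝ) < N := by exact_mod_cast hN
  have hl : 0 < Real.log (1 / r) := Real.log_pos (one_lt_one_div hr0 hr1)
  simp only [one_div, Real.log_inv] at hl ⊢
  set κ := -Real.log r with hκ
  refine ⟨max (κ - Real.log c) (κ / N * ℓ + κ + Real.log C), fun j => ?_, fun j hj => ?_⟩
  -- The index is rounded up to a multiple of `N` here; in the second bound `j - ℓ` is rounded down.
  · have h1 : j ≤ N * (j / N + 1) := (Nat.lt_mul_div_succ j hN).le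
    have h2 := Real.log_le_log (by positivity) ((hc (j / N + 1)).trans (h.antitone h1))
    rw [Real.log_mul hc0.ne' (by positivity), Real.log_pow] at h2
    have h3 : ((j / N : ℕ) : ℝ) ≤ j / N := Nat.cast_div_le
    push_cast at h2
    have h4 : κ / N * j = κ * (j / N) := by ring
    have h5 : κ * ((j / N : ℕ) : ℝ) ≤ κ * (j / N) := by gcongr
    have h6 := le_max_left (κ - Real.log c) (κ / N * ℓ + κ + Real.log C)
    have h7 : Real.log r = -κ := by simp [hκ]
    rw [h7] at h2
    linarith
  · set J := (j - ℓ) / N with hJ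
    have h1 : N * J + ℓ ≤ j := by
      have : N * J ≤ j - ℓ := Nat.mul_div_le (j - ℓ) N
      omega
    have h2 := Real.log_le_log (h.pos j) ((h.antitone h1).trans (hC J))
    rw [Real.log_mul hC0.ne' (by positivity), Real.log_pow] at h2
    have h3 : j - ℓ < N * (J + 1) := Nat.lt_mul_div_succ (j - ℓ) hN
    have h3' : (j : ℝ) - ℓ ≤ N * (J + 1) := by
      have : j ≤ N * (J + 1) + ℓ := by omega
      have : (j : ℝ) ≤ N * (J + 1) + ℓ := by exact_mod_cast this
      linarith
    have h7 : Real.log r = -κ := by simp [hκ]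
    have h4 : κ / N * (j - ℓ) ≤ κ * (J + 1) := by
      calc κ / N * (j - ℓ) ≤ κ / N * (N * (J + 1)) := by gcongr
        _ = κ * (J + 1) := by field_simp
    have h6 := le_max_right (κ - Real.log c) (κ / N * ℓ + κ + Real.log C)
    rw [h7] at h2
    linarith

theorem isEquivalent_log (h : IsGeometricallyTrapped N ℓ r ev) (hN : 0 < N) (hr0 : 0 < r)
    (hr1 : r < 1) :
    Asymptotics.IsEquivalent atTop (fun j : ℕ => Real.log (1 / ev j))
      (fun j : ℕ => (j : ℝ) * (Real.log (1 / r) / N)) := by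
  obtain ⟨C, hC1, hC2⟩ := h.log_bounds hN hr0 hr1
  have hN' : (0 : ℝ) < N := by exact_mod_cast hN
  have hκ : 0 < Real.log (1 / r) / N := div_pos (Real.log_pos (one_lt_one_div hr0 hr1)) hN'
  have h1 : (fun j : ℕ => Real.log (1 / ev j) - (j : ℝ) * (Real.log (1 / r) / N)) =O[atTop]
      fun _ => (1 : ℝ) := by
    refine Asymptotics.IsBigO.of_bound |C| (eventually_atTop.2 ⟨ℓ, fun j hj => ?_⟩)
    have := hC1 j
    have := hC2 j hj
    have := le_abs_self C
    rw [Real.norm_eq_abs, norm_one, mul_one, abs_le]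
    constructor <;> linarith
  refine h1.trans_isLittleO ?_
  rw [Asymptotics.isLittleO_const_left]
  right
  refine tendsto_norm_atTop_atTop.comp ?_
  exact tendsto_natCast_atTop_atTop.atTop_mul_const hκ

/-- The set counted lies between two initial segments of `ℕ` whose lengths differ from `ln(1/ν)/κ`
by a bounded amount, so the error is `O(1)` against a main term tending to infinity. -/
theorem countingFunction_isEquivalent (h : IsGeometricallyTrapped N ℓ r ev) (hN : 0 < N)
    (hr0 : 0 < r) (hr1 : r < 1) :
    Asymptotics.IsEquivalent (𝓝[>] 0)
      (fun ν : ℝ => (countingFunction ev ν : ℝ))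
      (fun ν : ℝ => (N : ℝ) * (Real.log (1 / ν) / Real.log (1 / r))) := by
  obtain ⟨C, hC1, hC2⟩ := h.log_bounds hN hr0 hr1
  have hN' : (0 : ℝ) < N := by exact_mod_cast hN
  have hl := Real.log_pos (one_lt_one_div hr0 hr1)
  set κ := Real.log (1 / r) / N with hκdef
  have hκ : 0 < κ := div_pos hl hN'
  have htop : Tendsto (fun ν : ℝ => Real.log (1 / ν)) (𝓝[>] 0) atTop := by
    simp only [one_div]
    exact Real.tendsto_log_atTop.comp tendsto_inv_nhdsGT_zero
  have hκ' : ∀ ν : ℝ, (N : ℝ) * (Real.log (1 / ν) / Real.log (1 / r)) = Real.log (1 / ν) / κ :=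
    fun ν => by rw [hκdef]; field_simp
  simp only [hκ']
  have h1 : (fun ν : ℝ => (countingFunction ev ν : ℝ) - Real.log (1 / ν) / κ) =O[𝓝[>] 0]
      fun _ => (1 : ℝ) := by
    refine Asymptotics.IsBigO.of_bound (|C| / κ + 1 + ℓ) ?_
    filter_upwards [self_mem_nhdsWithin, htop.eventually_ge_atTop |C|] with ν hν hX
    have hν' : (0 : ℝ) < ν := hν
    set X := Real.log (1 / ν)
    have hiff : ∀ j, ν < ev j ↔ Real.log (1 / ev j) < X := fun j => by
      rw [Real.log_lt_log_iff (by have := h.pos j; positivity) (by positivity)]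
      exact (one_div_lt_one_div (h.pos j) hν').symm
    -- Adding `ℓ` to the ceiling guarantees `j ≥ ℓ` outside the segment, which is where the lower
    -- logarithmic bound is available.
    have hsub : {j | ν < ev j} ⊆ Iio (⌈(X + C) / κ⌉₊ + ℓ) := fun j hj => by
      rw [mem_Iio]
      by_contra hj'
      have h2 := hC2 j (by omega)
      have h3 := (hiff j).1 hj
      have h4 : (X + C) / κ ≤ j := (Nat.le_ceil _).trans (by exact_mod_cast (by omega))
      rw [div_le_iff₀ hκ] at h4
      linarith
    have hsup : Iio ⌈(X - C) / κ⌉₊ ⊆ {j | ν < ev j} := fun j hj => by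
      refine (hiff j).2 ((hC1 j).trans_lt ?_)
      have h4 : (j : ℝ) < (X - C) / κ := Nat.lt_ceil.1 hj
      rw [lt_div_iff₀ hκ] at h4
      linarith
    have hc : ∀ k : ℕ, (Iio k).ncard = k := fun k => by
      rw [← Finset.coe_Iio, Set.ncard_coe_finset, Nat.card_Iio]
    have h5 := Set.ncard_le_ncard hsub (Set.finite_Iio _)
    have h6 := Set.ncard_le_ncard hsup ((Set.finite_Iio _).subset hsub)
    rw [hc] at h5 h6
    have hCn := neg_abs_le C
    have hCp := le_abs_self C
    have h7 : (countingFunction ev ν : ℝ) ≤ (X + C) / κ + 1 + ℓ := by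
      have h8 : (countingFunction ev ν : ℝ) ≤ (⌈(X + C) / κ⌉₊ : ℝ) + ℓ := by exact_mod_cast h5
      have h9 := Nat.ceil_lt_add_one (a := (X + C) / κ) (div_nonneg (by linarith) hκ.le)
      linarith
    have h10 : (X - C) / κ ≤ (countingFunction ev ν : ℝ) :=
      (Nat.le_ceil _).trans (by exact_mod_cast h6)
    rw [add_div] at h7
    rw [sub_div] at h10
    have h11 : C / κ ≤ |C| / κ := by gcongr
    have h13 : (0 : ℝ) ≤ ℓ := Nat.cast_nonneg _
    rw [Real.norm_eq_abs, norm_one, mul_one, abs_le]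
    constructor <;> linarith
  refine h1.trans_isLittleO ?_
  rw [Asymptotics.isLittleO_const_left]
  right
  exact tendsto_norm_atTop_atTop.comp (htop.atTop_div_const hκ)

end IsGeometricallyTrapped

end DegenerateString

end

noncomputable section

namespace DegenerateString

namespace SimilarityData

variable {n : ℕ} (p : SimilarityData n)

/-! ### Geometry of the similarities -/

theorem α_mem_Icc (k : Fin (n + 1)) : p.α k ∈ Icc (0 : ℝ) 1 := by
  rw [← p.α_zero, ← p.α_last]
  exact ⟨p.α_strictMono.monotone (Fin.zero_le k), p.α_strictMono.monotone (Fin.le_last k)⟩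

theorem a_lt_one (hn : 2 ≤ n) (k : Fin n) : p.a k < 1 := by
  have h1 := (p.α_mem_Icc k.succ).2
  have h2 := (p.α_mem_Icc k.castSucc).1
  unfold a
  by_cases hk : k.1 = 0
  · have : k.succ < Fin.last n := by
      rw [Fin.lt_def]; simp; omega
    have := p.α_strictMono this
    rw [p.α_last] at this
    linarith
  · have : (0 : Fin (n + 1)) < k.castSucc := by
      rw [Fin.lt_def]; simp; omega
    have := p.α_strictMono this
    rw [p.α_zero] at this
    linarith

theorem abs_S_sub (k : Fin n) (s t : ℝ) : |p.S k s - p.S k t| = p.a k * |s - t| := by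
  have h := p.a_pos k
  unfold S
  split_ifs
  · rw [show p.α k.succ - p.a k * s - (p.α k.succ - p.a k * t) = -(p.a k * (s - t)) by ring,
      abs_neg, abs_mul, abs_of_pos h]
  · rw [show p.a k * s + p.α k.castSucc - (p.a k * t + p.α k.castSucc) = p.a k * (s - t) by ring,
      abs_mul, abs_of_pos h]

theorem continuous_S (k : Fin n) : Continuous (p.S k) := by
  unfold S
  split_ifs <;> fun_prop

theorem continuous_invS (k : Fin n) : Continuous (p.invS k) := by
  unfold invS
  split_ifs <;> fun_prop

theorem S_injective (k : Fin n) : Function.Injective (p.S k) :=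
  Function.LeftInverse.injective (p.invS_S k)

theorem image_S (k : Fin n) (B : Set ℝ) : p.S k '' B = p.invS k ⁻¹' B :=
  congrFun (image_eq_preimage_of_inverse (p.invS_S k) (p.S_invS k)) B

theorem S_mem_Ioo_iff (k : Fin n) (t : ℝ) :
    p.S k t ∈ Ioo (p.α k.castSucc) (p.α k.succ) ↔ t ∈ Ioo (0 : ℝ) 1 := by
  have h := p.a_pos k
  have h' : p.α k.succ = p.α k.castSucc + p.a k := by unfold a; ring
  unfold S
  rw [h']
  split_ifs <;> simp only [mem_Ioo] <;> constructor <;> rintro ⟨h1, h2⟩ <;> constructor <;> nlinarith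

theorem Ioo_subset (k : Fin n) : Ioo (p.α k.castSucc) (p.α k.succ) ⊆ Ioo 0 1 :=
  Ioo_subset_Ioo (p.α_mem_Icc _).1 (p.α_mem_Icc _).2

theorem S_mapsTo (k : Fin n) : MapsTo (p.S k) (Ioo 0 1) (Ioo 0 1) := fun t ht =>
  p.Ioo_subset k ((p.S_mem_Ioo_iff k t).2 ht)

theorem exists_fixedPoint (hn : 2 ≤ n) (k : Fin n) : ∃ t, p.S k t = t := by
  have h := p.a_pos k
  have h' := p.a_lt_one hn k
  have h1 : 1 - p.a k ≠ 0 := by linarith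
  have h2 : 1 + p.a k ≠ 0 := by linarith
  by_cases he : p.e k
  · exact ⟨p.α k.succ / (1 + p.a k), by simp only [S, he, if_true]; field_simp; ring⟩
  · exact ⟨p.α k.castSucc / (1 - p.a k), by
      simp only [S, he, Bool.false_eq_true, if_false]; field_simp; ring⟩

theorem abs_iterate_S_sub (k : Fin n) (j : ℕ) (s t : ℝ) :
    |(p.S k)^[j] s - (p.S k)^[j] t| = p.a k ^ j * |s - t| := by
  induction j with
  | zero => simp
  | succ j ih => rw [Function.iterate_succ_apply', Function.iterate_succ_apply', abs_S_sub, ih]; ring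

theorem exists_Ico_of_mem {t : ℝ} (ht : t ∈ Ico (0 : ℝ) 1) :
    ∃ k : Fin n, p.α k.castSucc ≤ t ∧ t < p.α k.succ := by
  classical
  let s := Finset.univ.filter fun k : Fin (n + 1) => p.α k ≤ t
  have hs : s.Nonempty := ⟨0, by simp [s, p.α_zero, ht.1]⟩
  have h1 : p.α (s.max' hs) ≤ t := (Finset.mem_filter.1 (s.max'_mem hs)).2
  have h2 : s.max' hs ≠ Fin.last n := fun h => by
    rw [h, p.α_last] at h1
    exact absurd ht.2 (not_lt.2 h1)
  refine ⟨(s.max' hs).castPred h2, by simpa using h1, ?_⟩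
  by_contra h3
  have h4 := s.le_max' ((s.max' hs).castPred h2).succ (by simpa [s] using not_lt.1 h3)
  simp [Fin.le_def] at h4

/-- The `i`-th interior point of the partition. -/
def node (i : Fin (n - 1)) : ℝ := p.α ⟨i + 1, by omega⟩

theorem node_injective : Function.Injective p.node := fun i j h => by
  have := p.α_strictMono.injective h
  simp only [Fin.mk.injEq] at this
  exact Fin.ext (by omega)

theorem node_mem_Ioo (i : Fin (n - 1)) : p.node i ∈ Ioo (0 : ℝ) 1 := by
  rw [← p.α_zero, ← p.α_last]
  exact ⟨p.α_strictMono (by rw [Fin.lt_def]; simp), p.α_strictMono (by rw [Fin.lt_def]; simp; omega)⟩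

theorem node_notMem (i : Fin (n - 1)) (k : Fin n) :
    p.node i ∉ Ioo (p.α k.castSucc) (p.α k.succ) := fun h => by
  have h1 := p.α_strictMono.lt_iff_lt.1 h.1
  have h2 := p.α_strictMono.lt_iff_lt.1 h.2
  simp only [Fin.lt_def, Fin.val_castSucc, Fin.val_succ] at h1 h2
  omega

theorem mem_or_mem_of_mem_Ioo {t : ℝ} (ht : t ∈ Ioo (0 : ℝ) 1) :
    t ∈ range p.node ∨ ∃ k : Fin n, t ∈ Ioo (p.α k.castSucc) (p.α k.succ) := by
  obtain ⟨k, h1, h2⟩ := p.exists_Ico_of_mem ⟨ht.1.le, ht.2⟩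
  rcases h1.eq_or_lt with h | h
  · left
    have hk : k.1 ≠ 0 := fun h0 => by
      have : k.castSucc = 0 := Fin.ext (by simpa using h0)
      rw [this, p.α_zero] at h
      exact ht.1.ne h
    refine ⟨⟨k.1 - 1, by omega⟩, ?_⟩
    rw [← h]
    unfold node
    congr 1
    ext
    simp
    omega
  · exact Or.inr ⟨k, h, h2⟩

theorem iterate_mapsTo (k : Fin n) (j : ℕ) : MapsTo (p.S k)^[j] (Ioo 0 1) (Ioo 0 1) :=
  (p.S_mapsTo k).iterate j

/-- Every iterate of positive order maps into the open `k`-th interval, which contains no partition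
point. The same reason keeps the fixed point of `S k` away from the nodes. -/
theorem node_ne_iterate (k : Fin n) {i i' : Fin (n - 1)} {j : ℕ} (h : j = 0 → i ≠ i') :
    p.node i ≠ (p.S k)^[j] (p.node i') := by
  rcases j with _ | j
  · exact fun h' => h rfl (p.node_injective h')
  · intro h'
    rw [Function.iterate_succ_apply'] at h'
    refine p.node_notMem i k ?_
    rw [h', S_mem_Ioo_iff]
    exact p.iterate_mapsTo k j (p.node_mem_Ioo i')

theorem node_ne_fixedPoint (k : Fin n) (i : Fin (n - 1)) {t : ℝ} (ht : p.S k t = t) :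
    p.node i ≠ t := by
  rintro rfl
  refine p.node_notMem i k ?_
  rw [← ht, S_mem_Ioo_iff]
  exact p.node_mem_Ioo i

/-- The iterates of a node converge to the fixed point of `S k`, which is not a node. Hence all but
finitely many of them stay away from a given node, and each of the others differs from it.
Finiteness of the set of pairs of nodes makes `δ` uniform. -/
theorem exists_separation (hn : 2 ≤ n) (k : Fin n) : ∃ δ : ℝ, 0 < δ ∧ δ ≤ 1 ∧
    (∀ i, Metric.ball (p.node i) δ ⊆ Ioo 0 1) ∧
    ∀ i i' j, (j = 0 → i ≠ i') → 2 * δ ≤ |p.node i - (p.S k)^[j] (p.node i')| := by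
  obtain ⟨t, ht⟩ := p.exists_fixedPoint hn k
  have ha := p.a_pos k
  have ha1 := p.a_lt_one hn k
  have h1 : ∀ i, ∃ δ : ℝ, 0 < δ ∧ Metric.ball (p.node i) δ ⊆ Ioo 0 1 := fun i =>
    Metric.isOpen_iff.1 isOpen_Ioo _ (p.node_mem_Ioo i)
  have h2 : ∀ i i' : Fin (n - 1), ∃ δ : ℝ, 0 < δ ∧
      ∀ j, (j = 0 → i ≠ i') → 2 * δ ≤ |p.node i - (p.S k)^[j] (p.node i')| := fun i i' => by
    have hlim : Tendsto (fun j => |p.node i - (p.S k)^[j] (p.node i')|) atTop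
        (𝓝 |p.node i - t|) := by
      have h3 : Tendsto (fun j => (p.S k)^[j] (p.node i')) atTop (𝓝 t) := by
        rw [tendsto_iff_dist_tendsto_zero]
        have h4 : ∀ j, dist ((p.S k)^[j] (p.node i')) t = p.a k ^ j * |p.node i' - t| := fun j => by
          rw [Real.dist_eq, ← abs_iterate_S_sub, Function.iterate_fixed ht]
        simp only [h4]
        simpa using (tendsto_pow_atTop_nhds_zero_of_lt_one ha.le ha1).mul_const |p.node i' - t|
      exact (tendsto_const_nhds.sub h3).abs
    have hpos : 0 < |p.node i - t| := abs_pos.2 (sub_ne_zero.2 (p.node_ne_fixedPoint k i ht))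
    obtain ⟨N, hN⟩ := eventually_atTop.1 (hlim.eventually (lt_mem_nhds (half_lt_self hpos)))
    have h5 : ∀ j, ∃ δ : ℝ, 0 < δ ∧
        ((j = 0 → i ≠ i') → 2 * δ ≤ |p.node i - (p.S k)^[j] (p.node i')|) := fun j => by
      by_cases hj : j = 0 → i ≠ i'
      · have := abs_pos.2 (sub_ne_zero.2 (p.node_ne_iterate k hj))
        exact ⟨|p.node i - (p.S k)^[j] (p.node i')| / 2, by positivity, fun _ => by linarith⟩
      · exact ⟨1, one_pos, fun h => absurd h hj⟩
    choose δ hδ hδ' using h5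
    obtain ⟨ε, hε, hε'⟩ : ∃ ε : ℝ, 0 < ε ∧ ∀ j ∈ Finset.range N, ε ≤ δ j := by
      rcases (Finset.range N).eq_empty_or_nonempty with h | h
      · exact ⟨1, one_pos, by simp [h]⟩
      · exact ⟨(Finset.range N).inf' h δ, (Finset.lt_inf'_iff _).2 fun j _ => hδ j,
          fun j hj => Finset.inf'_le _ hj⟩
    refine ⟨min ε (|p.node i - t| / 4), by positivity, fun j hj => ?_⟩
    rcases lt_or_ge j N with h | h
    · have := hδ' j hj
      have := hε' j (Finset.mem_range.2 h)
      have := min_le_left ε (|p.node i - t| / 4)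
      linarith
    · have := hN j h
      have := min_le_right ε (|p.node i - t| / 4)
      linarith
  choose δ₁ h1 h1' using h1
  choose δ₂ h2 h2' using h2
  have : Nonempty (Fin (n - 1)) := ⟨⟨0, by omega⟩⟩
  have hne : (Finset.univ : Finset (Fin (n - 1))).Nonempty := Finset.univ_nonempty
  have hne2 : (Finset.univ : Finset (Fin (n - 1) × Fin (n - 1))).Nonempty := Finset.univ_nonempty
  set ε₁ := Finset.univ.inf' hne δ₁
  set ε₂ := Finset.univ.inf' hne2 fun x => δ₂ x.1 x.2
  have he1 : 0 < ε₁ := (Finset.lt_inf'_iff _).2 fun i _ => h1 i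
  have he2 : 0 < ε₂ := (Finset.lt_inf'_iff _).2 fun x _ => h2 x.1 x.2
  refine ⟨min 1 (min ε₁ ε₂), by positivity, min_le_left _ _, fun i => ?_, fun i i' j hj => ?_⟩
  · refine (Metric.ball_subset_ball ?_).trans (h1' i)
    exact (min_le_right _ _).trans ((min_le_left _ _).trans (Finset.inf'_le _ (Finset.mem_univ i)))
  · refine le_trans ?_ (h2' i i' j hj)
    have h3 : ε₂ ≤ δ₂ i i' := Finset.inf'_le (fun x : Fin (n - 1) × Fin (n - 1) => δ₂ x.1 x.2)
      (Finset.mem_univ (i, i'))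
    have := (min_le_right 1 (min ε₁ ε₂)).trans (min_le_right ε₁ ε₂)
    linarith

theorem iterate_ball_subset (k : Fin n) (j : ℕ) {s δ : ℝ} (h : Metric.ball s δ ⊆ Ioo 0 1) :
    Metric.ball ((p.S k)^[j] s) (δ * p.a k ^ j) ⊆ Ioo 0 1 := fun t ht => by
  have hs : Function.Surjective (p.S k)^[j] :=
    (Function.RightInverse.surjective (p.S_invS k)).iterate j
  obtain ⟨t, rfl⟩ := hs t
  have hpos : 0 < p.a k ^ j := pow_pos (p.a_pos k) j
  rw [Metric.mem_ball, Real.dist_eq, abs_iterate_S_sub, mul_comm] at ht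
  refine p.iterate_mapsTo k j (h ?_)
  rw [Metric.mem_ball, Real.dist_eq]
  exact lt_of_mul_lt_mul_right ht hpos.le

/-- Removing the common iterate of order `j ≤ j'` leaves the distance from a node to an iterate of a
node, scaled by `a^j`. The factor `2` in the separation pays for both radii, neither of which
exceeds `δ a^j`. -/
theorem disjoint_ball (hn : 2 ≤ n) (k : Fin n) {δ : ℝ} (hδ : 0 < δ)
    (h : ∀ i i' j, (j = 0 → i ≠ i') → 2 * δ ≤ |p.node i - (p.S k)^[j] (p.node i')|)
    {j j' : ℕ} {i i' : Fin (n - 1)} (hne : (j, i) ≠ (j', i')) :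
    Disjoint (Metric.ball ((p.S k)^[j] (p.node i)) (δ * p.a k ^ j))
      (Metric.ball ((p.S k)^[j'] (p.node i')) (δ * p.a k ^ j')) := by
  wlog hjj : j ≤ j' generalizing j j' i i'
  · exact (this hne.symm (by omega)).symm
  obtain ⟨m, rfl⟩ := Nat.exists_eq_add_of_le hjj
  refine Metric.ball_disjoint_ball ?_
  have h1 : p.a k ^ (j + m) ≤ p.a k ^ j :=
    pow_le_pow_of_le_one (p.a_pos k).le (p.a_lt_one hn k).le hjj
  have h2 := h i i' m (fun hm hi => hne (by simp [hm, hi]))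
  rw [Real.dist_eq, Function.iterate_add_apply, abs_iterate_S_sub]
  have h3 : 0 < p.a k ^ j := pow_pos (p.a_pos k) j
  calc δ * p.a k ^ j + δ * p.a k ^ (j + m) ≤ δ * p.a k ^ j + δ * p.a k ^ j := by gcongr
    _ = p.a k ^ j * (2 * δ) := by ring
    _ ≤ _ := by gcongr

end SimilarityData

end DegenerateString

end

noncomputable section

namespace DegenerateString

/-! ### Self-similarity of the measure -/

/-- `x j i` are atoms of weight at least `w d ^ j`, separated at the scale `a ^ j`; outside the atoms
of levels below `J` the measure lives on a set within distance `a ^ J` of the point `t J`, and the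
mass of this set is at most `d ^ J`. -/
structure AtomicTower (N : ℕ) (a d : ℝ) (μ : Measure ℝ) (x : ℕ → Fin N → ℝ) (t : ℕ → ℝ) : Prop where
  weight : ∃ w : ℝ, 0 < w ∧ ∀ j i, w * d ^ j ≤ μ.real {x j i}
  separated : ∃ δ : ℝ, 0 < δ ∧ δ ≤ 1 ∧ (∀ j i, Metric.ball (x j i) (δ * a ^ j) ⊆ Ioo 0 1) ∧
    ∀ j i j' i', (j, i) ≠ (j', i') →
      Disjoint (Metric.ball (x j i) (δ * a ^ j)) (Metric.ball (x j' i') (δ * a ^ j'))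
  tail : ∀ J, ∃ I : Set ℝ, MeasurableSet I ∧ I ⊆ Ioo 0 1 ∧ (∀ s ∈ I, |s - t J| ≤ a ^ J) ∧
    μ.real I ≤ d ^ J ∧ μ (I ∪ ⋃ j ∈ Finset.range J, range (x j))ᶜ = 0

namespace SimilarityData

variable {n : ℕ} (p : SimilarityData n)

theorem similarityOperator_apply (f : ℝ → ℝ) {k : Fin n} {t : ℝ}
    (ht : t ∈ Ioo (p.α k.castSucc) (p.α k.succ)) :
    p.similarityOperator f t = p.d k * f (p.invS k t) + p.β k := by
  unfold similarityOperator
  rw [Finset.sum_eq_single k, indicator_of_mem ht]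
  · intro j _ hj
    refine indicator_of_notMem (fun hj' => hj ?_) _
    have h1 := p.α_strictMono.lt_iff_lt.1 (ht.1.trans hj'.2)
    have h2 := p.α_strictMono.lt_iff_lt.1 (hj'.1.trans ht.2)
    simp only [Fin.lt_def, Fin.val_castSucc, Fin.val_succ] at h1 h2
    exact Fin.ext (by omega)
  · simp

/-- A reversing similarity exchanges the closed and open ends. The outer interval is chosen so that
the preimage is always closed on the left, since these are the intervals whose mass is a plain
difference of values of `f`. -/
theorem preimage_S_Ico_eq (k : Fin n) (u v : ℝ) : p.S k ⁻¹' (if p.e k then Ioc u v else Ico u v) =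
    if p.e k then Ico (p.invS k v) (p.invS k u) else Ico (p.invS k u) (p.invS k v) := by
  have h := p.a_pos k
  ext x
  unfold S invS
  split_ifs
  · simp only [mem_preimage, mem_Ioc, mem_Ico, div_le_iff₀ h, lt_div_iff₀ h]
    constructor <;> rintro ⟨h1, h2⟩ <;> constructor <;> linarith
  · simp only [mem_preimage, mem_Ico, div_le_iff₀ h, lt_div_iff₀ h]
    constructor <;> rintro ⟨h1, h2⟩ <;> constructor <;> linarith

theorem iUnion_Ico_eq {c d : ℝ} {u v : ℕ → ℝ} (hu : ∀ i, c < u i) (hv : ∀ i, v i < d)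
    (hu' : Tendsto u atTop (𝓝 c)) (hv' : Tendsto v atTop (𝓝 d)) (b : Bool) :
    ⋃ i, (if b then Ioc (u i) (v i) else Ico (u i) (v i)) = Ioo c d := by
  ext x
  simp only [mem_iUnion]
  constructor
  · rintro ⟨i, hi⟩
    have h1 := hu i
    have h2 := hv i
    split_ifs at hi <;> exact ⟨by linarith [hi.1], by linarith [hi.2]⟩
  · rintro ⟨h1, h2⟩
    obtain ⟨i, hi1, hi2⟩ :=
      ((hu'.eventually (gt_mem_nhds h1)).and (hv'.eventually (lt_mem_nhds h2))).exists
    refine ⟨i, ?_⟩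
    split_ifs
    exacts [⟨hi1, hi2.le⟩, ⟨hi1.le, hi2⟩]

variable {p}

theorem IsDegenerateSelfSimilarMeasure.measure_node_ne_zero {μ : Measure ℝ} (h : p.IsDegenerateSelfSimilarMeasure μ) (i : Fin (n - 1)) :
    μ {p.node i} ≠ 0 := fun h0 => by
  obtain ⟨-, f, -, -, -, -, -, hjump, hval⟩ := h
  have hm := p.node_mem_Ioo i
  have := hval _ _ hm.1.le le_rfl hm.2.le
  rw [Icc_self, measureReal_def, h0, ENNReal.toReal_zero] at this
  refine hjump ⟨i + 1, by omega⟩ ?_ ?_ (sub_eq_zero.1 this.symm)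
  · intro h; simpa using congrArg Fin.val h
  · intro h; have := congrArg Fin.val h; simp at this; omega

variable {μ : Measure ℝ} [IsFiniteMeasure μ]

namespace IsDegenerateSelfSimilarMeasure

/-- The functional equation holds only almost everywhere, hence on a dense set. It is used at
end-points `u i ↓ c` and `v i ↑ d` from that set, and continuity of `μ` from below gives the open
interval. Mass is nonnegative, so the sign of `d k` and the orientation both disappear into `|d k|`.
-/
theorem measure_Ioo_eq (h : p.IsDegenerateSelfSimilarMeasure μ) (k : Fin n) {c d : ℝ} (hcd : c < d)
    (hc : p.α k.castSucc ≤ c) (hd : d ≤ p.α k.succ) :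
    μ (Ioo c d) = ENNReal.ofReal |p.d k| * μ (p.S k ⁻¹' Ioo c d) := by
  obtain ⟨-, f, ⟨-, hfix⟩, -, -, -, -, -, hval⟩ := h
  -- Removing the atom at `b` cancels the right limit.
  have hIco : ∀ a b : ℝ, 0 ≤ a → a ≤ b → b ≤ 1 → μ.real (Ico a b) = f b - f a := fun a b h0 hab h1 => by
    have e1 := hval a b h0 hab h1
    have e2 := hval b b (h0.trans hab) le_rfl h1
    rw [← Ico_union_right hab, measureReal_union (by simp) (measurableSet_singleton b)] at e1
    rw [Icc_self] at e2
    linarith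
  have hd0 : Dense {t : ℝ | t ∈ Ioo (0 : ℝ) 1 → p.similarityOperator f t = f t} :=
    Measure.dense_of_ae ((ae_restrict_iff' measurableSet_Ioo).1 hfix)
  set G := {t : ℝ | t ∈ Ioo (0 : ℝ) 1 → p.similarityOperator f t = f t}
  obtain ⟨u, hu, hu', hu''⟩ := hd0.exists_seq_strictAnti_tendsto_of_lt
    (show c < (c + d) / 2 by linarith)
  obtain ⟨v, hv, hv', hv''⟩ := hd0.exists_seq_strictMono_tendsto_of_lt
    (show (c + d) / 2 < d by linarith)
  have hinv : ∀ t ∈ Ioo c d, p.invS k t ∈ Ioo (0 : ℝ) 1 := fun t ht => by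
    rw [← p.S_mem_Ioo_iff k, S_invS]
    exact ⟨hc.trans_lt ht.1, ht.2.trans_le hd⟩
  have hfG : ∀ t ∈ Ioo c d, t ∈ G → f t = p.d k * f (p.invS k t) + p.β k := fun t ht hG => by
    have ht' : t ∈ Ioo (p.α k.castSucc) (p.α k.succ) := ⟨hc.trans_lt ht.1, ht.2.trans_le hd⟩
    rw [← hG (p.Ioo_subset k ht'), p.similarityOperator_apply f ht']
  have hucd : ∀ i, u i ∈ Ioo c d := fun i =>
    ⟨(hu' i).1.1, (hu' i).1.2.trans (by linarith)⟩
  have hvcd : ∀ i, v i ∈ Ioo c d := fun i =>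
    ⟨lt_trans (by linarith) (hv' i).1.1, (hv' i).1.2⟩
  have huv : ∀ i, u i ≤ v i := fun i => ((hu' i).1.2.trans (hv' i).1.1).le
  have hα := p.α_mem_Icc
  have key : ∀ i, μ (Ico (u i) (v i)) = ENNReal.ofReal |p.d k| *
      μ (p.S k ⁻¹' (if p.e k then Ioc (u i) (v i) else Ico (u i) (v i))) := fun i => by
    have e1 : μ.real (Ico (u i) (v i)) = p.d k * (f (p.invS k (v i)) - f (p.invS k (u i))) := by
      rw [hIco _ _ ((hα _).1.trans (hc.trans (hucd i).1.le)) (huv i)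
        ((hvcd i).2.le.trans (hd.trans (hα _).2)), hfG _ (hucd i) (hu' i).2, hfG _ (hvcd i) (hv' i).2]
      ring
    have e2 : |f (p.invS k (v i)) - f (p.invS k (u i))| =
        μ.real (p.S k ⁻¹' (if p.e k then Ioc (u i) (v i) else Ico (u i) (v i))) := by
      rw [preimage_S_Ico_eq]
      have hvi := hinv _ (hvcd i)
      have hui := hinv _ (hucd i)
      have ha := p.a_pos k
      split_ifs with he
      · have hle : p.invS k (v i) ≤ p.invS k (u i) := by
          simp only [invS, he, if_true]
          have := huv i
          gcongr
        rw [hIco _ _ hvi.1.le hle hui.2.le, abs_sub_comm, abs_of_nonneg]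
        rw [← hIco _ _ hvi.1.le hle hui.2.le]
        positivity
      · have hle : p.invS k (u i) ≤ p.invS k (v i) := by
          simp only [invS, he]
          have := huv i
          simp only [Bool.false_eq_true, if_false]
          gcongr
        rw [hIco _ _ hui.1.le hle hvi.2.le, abs_of_nonneg]
        rw [← hIco _ _ hui.1.le hle hvi.2.le]
        positivity
    rw [← ofReal_measureReal (μ := μ) (s := Ico (u i) (v i)),
      ← ofReal_measureReal (μ := μ) (s := p.S k ⁻¹' _), ← ENNReal.ofReal_mul (abs_nonneg _), ← e2,
      ← abs_mul, ← e1, abs_of_nonneg measureReal_nonneg]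
  have hmono1 : Monotone fun i => Ico (u i) (v i) := fun i j hij =>
    Ico_subset_Ico (hu.antitone hij) (hv.monotone hij)
  have hmono2 : Monotone fun i => p.S k ⁻¹' (if p.e k then Ioc (u i) (v i) else Ico (u i) (v i)) :=
    fun i j hij => preimage_mono (by
      split_ifs
      exacts [Ioc_subset_Ioc (hu.antitone hij) (hv.monotone hij), hmono1 hij])
  have hU1 : ⋃ i, Ico (u i) (v i) = Ioo c d := by
    simpa using iUnion_Ico_eq (fun i => (hucd i).1) (fun i => (hvcd i).2) hu'' hv'' false
  have hU2 := iUnion_Ico_eq (fun i => (hucd i).1) (fun i => (hvcd i).2) hu'' hv'' (p.e k)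
  have h1 := tendsto_measure_iUnion_atTop (μ := μ) hmono1
  have h2 := tendsto_measure_iUnion_atTop (μ := μ) hmono2
  rw [hU1] at h1
  rw [← preimage_iUnion, hU2] at h2
  refine tendsto_nhds_unique h1 ?_
  simp only [Function.comp_def, key]
  exact ENNReal.Tendsto.const_mul h2 (Or.inr ENNReal.ofReal_ne_top)

theorem restrict_eq (h : p.IsDegenerateSelfSimilarMeasure μ) (k : Fin n) :
    μ.restrict (Ioo (p.α k.castSucc) (p.α k.succ)) =
      ENNReal.ofReal |p.d k| • (μ.restrict (Ioo 0 1)).map (p.S k) := by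
  refine Real.measure_ext_Ioo_rat fun a b => ?_
  have hm := (p.continuous_S k).measurable
  have h1 : p.S k ⁻¹' Ioo a b ∩ Ioo 0 1 =
      p.S k ⁻¹' (Ioo a b ∩ Ioo (p.α k.castSucc) (p.α k.succ)) := by
    ext x
    simp only [mem_inter_iff, mem_preimage, S_mem_Ioo_iff]
  rw [Measure.restrict_apply measurableSet_Ioo, Measure.smul_apply,
    Measure.map_apply hm measurableSet_Ioo,
    Measure.restrict_apply (hm measurableSet_Ioo), h1, Ioo_inter_Ioo]
  rcases lt_or_ge (max (a : ℝ) (p.α k.castSucc)) (min (b : ℝ) (p.α k.succ)) with hlt | hle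
  · exact h.measure_Ioo_eq k hlt (le_max_right _ _) (min_le_right _ _)
  · have h2 : Ioo (max (a : ℝ) (p.α k.castSucc)) (min (b : ℝ) (p.α k.succ)) = ∅ :=
      Ioo_eq_empty (not_lt.2 hle)
    simp only [h2]
    simp

theorem measure_image_S (h : p.IsDegenerateSelfSimilarMeasure μ) (k : Fin n) {B : Set ℝ}
    (hB : MeasurableSet B) (hB' : B ⊆ Ioo 0 1) :
    μ (p.S k '' B) = ENNReal.ofReal |p.d k| * μ B := by
  have hm : MeasurableSet (p.S k '' B) := by
    rw [image_S]
    exact (p.continuous_invS k).measurable hB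
  have h1 := congrArg (fun ν : Measure ℝ => ν (p.S k '' B)) (h.restrict_eq k)
  simp only [Measure.smul_apply, Measure.map_apply (p.continuous_S k).measurable hm,
    Measure.restrict_apply hm, smul_eq_mul, preimage_image_eq _ (p.S_injective k),
    Measure.restrict_apply hB, inter_eq_left.2 hB'] at h1
  rwa [inter_eq_left.2] at h1
  rintro _ ⟨x, hx, rfl⟩
  exact (p.S_mem_Ioo_iff k x).2 (hB' hx)

theorem measurableSet_image_iterate (k : Fin n) (j : ℕ) {B : Set ℝ} (hB : MeasurableSet B) :
    MeasurableSet ((p.S k)^[j] '' B) := by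
  induction j with
  | zero => simpa using hB
  | succ j ih =>
    rw [Function.iterate_succ', image_comp, image_S]
    exact (p.continuous_invS k).measurable ih

theorem measure_image_iterate (h : p.IsDegenerateSelfSimilarMeasure μ) (k : Fin n) (j : ℕ) {B : Set ℝ}
    (hB : MeasurableSet B) (hB' : B ⊆ Ioo 0 1) :
    μ ((p.S k)^[j] '' B) = ENNReal.ofReal |p.d k| ^ j * μ B := by
  induction j with
  | zero => simp
  | succ j ih =>
    rw [Function.iterate_succ', image_comp, h.measure_image_S k (measurableSet_image_iterate k j hB)
      (((p.iterate_mapsTo k j).mono_left hB').image_subset), ih, pow_succ', mul_assoc]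

/-- Right continuity at `0` and constancy beyond `1` make `f` agree with its right limit at the
end-points, so neither is an atom. -/
theorem measure_compl_Ioo (h : p.IsDegenerateSelfSimilarMeasure μ) : μ (Ioo 0 1)ᶜ = 0 := by
  obtain ⟨hsupp, f, -, -, hright, -, hf1, -, hval⟩ := h
  have h0 : μ {(0 : ℝ)} = 0 := by
    have := hval 0 0 le_rfl le_rfl zero_le_one
    rw [hright.rightLim_eq, sub_self, Icc_self] at this
    exact (measureReal_eq_zero_iff).1 this
  have h1 : μ {(1 : ℝ)} = 0 := by
    have := hval 1 1 zero_le_one le_rfl le_rfl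
    have hc : ContinuousWithinAt f (Ici 1) 1 :=
      continuousWithinAt_const.congr (fun t ht => hf1 t ht) rfl
    rw [hc.rightLim_eq, sub_self, Icc_self] at this
    exact (measureReal_eq_zero_iff).1 this
  refine measure_mono_null (t := (Icc 0 1)ᶜ ∪ {0} ∪ {1}) (fun t ht => ?_)
    (measure_union_null (measure_union_null hsupp h0) h1)
  by_contra h'
  simp only [mem_union, mem_compl_iff, mem_Icc, mem_singleton_iff, not_or, not_not] at h'
  exact ht ⟨h'.1.1.1.lt_of_ne' h'.1.2, h'.1.1.2.lt_of_ne h'.2⟩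

/-- This is where degeneracy enters: an interval with `d k = 0` carries no mass, so only the
partition points and the `m`-th interval are charged. -/
theorem measure_diff (h : p.IsDegenerateSelfSimilarMeasure μ) :
    μ (Ioo 0 1 \ (range p.node ∪ p.S p.m '' Ioo 0 1)) = 0 := by
  refine measure_mono_null (t := ⋃ k : {k : Fin n // k ≠ p.m}, p.S k '' Ioo 0 1)
    (fun t ht => ?_) (measure_iUnion_null fun k => ?_)
  · have him : ∀ k : Fin n, t ∈ Ioo (p.α k.castSucc) (p.α k.succ) → t ∈ p.S k '' Ioo 0 1 :=
      fun k hk => ⟨p.invS k t, by rw [← p.S_mem_Ioo_iff k, S_invS]; exact hk, p.S_invS k t⟩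
    rcases p.mem_or_mem_of_mem_Ioo ht.1 with h' | ⟨k, hk⟩
    · exact absurd (Or.inl h') ht.2
    · refine mem_iUnion.2 ⟨⟨k, ?_⟩, him k hk⟩
      rintro rfl
      exact ht.2 (Or.inr (him _ hk))
  · rw [h.measure_image_S _ measurableSet_Ioo le_rfl, p.d_eq_zero _ k.2]
    simp

/-- Transporting the null set of `measure_diff` by the `J`-th iterate splits the tail into the atoms
of level `J` and the next tail. -/
theorem measure_tail (h : p.IsDegenerateSelfSimilarMeasure μ) (J : ℕ) :
    μ ((p.S p.m)^[J] '' Ioo 0 1 ∪ ⋃ j ∈ Finset.range J, range fun i => (p.S p.m)^[j] (p.node i))ᶜ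
      = 0 := by
  induction J with
  | zero => simpa using h.measure_compl_Ioo
  | succ J ih =>
    have hm : MeasurableSet (Ioo 0 1 \ (range p.node ∪ p.S p.m '' Ioo 0 1)) :=
      measurableSet_Ioo.diff ((finite_range _).measurableSet.union
        (measurableSet_image_iterate p.m 1 measurableSet_Ioo))
    have h1 := h.measure_image_iterate p.m J hm sdiff_subset
    rw [h.measure_diff, mul_zero] at h1
    refine measure_mono_null (fun t ht => ?_) (measure_union_null ih h1)
    by_contra h'
    rw [mem_union, not_or, notMem_compl_iff] at h'
    obtain ⟨h2, h3⟩ := h'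
    refine ht ?_
    rcases h2 with ⟨s, hs, rfl⟩ | h2
    · have hs' : s ∈ range p.node ∪ p.S p.m '' Ioo 0 1 := by
        by_contra h4
        exact h3 ⟨s, ⟨hs, h4⟩, rfl⟩
      rcases hs' with ⟨i, rfl⟩ | ⟨r, hr, rfl⟩
      · exact Or.inr (mem_iUnion₂.2 ⟨J, by simp, i, rfl⟩)
      · exact Or.inl ⟨r, hr, Function.iterate_succ_apply _ _ _⟩
    · obtain ⟨j, hj, hj'⟩ := mem_iUnion₂.1 h2
      refine Or.inr (mem_iUnion₂.2 ⟨j, ?_, hj'⟩)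
      simp only [Finset.mem_range] at hj ⊢
      omega

end IsDegenerateSelfSimilarMeasure

/-- The iterates of `S m` scale length by `a m` and mass by `|d m|`, so all bounds are transported
from level zero. The weight is the least mass of a partition point, and any point of `(0,1)` could
serve as centre instead of `1/2`. -/
theorem IsDegenerateSelfSimilarMeasure.atomicTower {μ : Measure ℝ} [IsProbabilityMeasure μ]
    (hn : 2 ≤ n) (h : p.IsDegenerateSelfSimilarMeasure μ) :
    AtomicTower (n - 1) (p.a p.m) |p.d p.m| μ (fun j i => (p.S p.m)^[j] (p.node i))
      (fun j => (p.S p.m)^[j] (1 / 2)) := by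
  have hhalf : (1 / 2 : ℝ) ∈ Ioo (0 : ℝ) 1 := by constructor <;> norm_num
  refine ⟨?_, ?_, fun J => ⟨(p.S p.m)^[J] '' Ioo 0 1,
    IsDegenerateSelfSimilarMeasure.measurableSet_image_iterate _ _ measurableSet_Ioo,
    (p.iterate_mapsTo _ J).image_subset, ?_, ?_, h.measure_tail J⟩⟩
  · have : Nonempty (Fin (n - 1)) := ⟨⟨0, by omega⟩⟩
    refine ⟨Finset.univ.inf' Finset.univ_nonempty fun i => μ.real {p.node i},
      (Finset.lt_inf'_iff _).2 fun i _ => ?_, fun j i => ?_⟩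
    · exact measureReal_nonneg.lt_of_ne' fun h0 =>
        h.measure_node_ne_zero i ((measureReal_eq_zero_iff).1 h0)
    · have h1 := h.measure_image_iterate p.m j (measurableSet_singleton (p.node i))
        (singleton_subset_iff.2 (p.node_mem_Ioo i))
      rw [image_singleton] at h1
      rw [measureReal_def, h1, ENNReal.toReal_mul, ENNReal.toReal_pow,
        ENNReal.toReal_ofReal (abs_nonneg _), mul_comm]
      gcongr
      exact Finset.inf'_le (fun i => μ.real {p.node i}) (Finset.mem_univ i)
  · obtain ⟨δ, h0, h1, h2, h3⟩ := p.exists_separation hn p.m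
    exact ⟨δ, h0, h1, fun j i => p.iterate_ball_subset _ j (h2 i), fun j i j' i' hne =>
      p.disjoint_ball hn p.m h0 h3 hne⟩
  · rintro _ ⟨s, hs, rfl⟩
    rw [abs_iterate_S_sub]
    have : |s - 1 / 2| ≤ 1 := by rw [abs_le]; constructor <;> linarith [hs.1, hs.2]
    have := pow_pos (p.a_pos p.m) J
    nlinarith
  · rw [measureReal_def, h.measure_image_iterate p.m J measurableSet_Ioo le_rfl, ENNReal.toReal_mul,
      ENNReal.toReal_pow, ENNReal.toReal_ofReal (abs_nonneg _)]
    exact mul_le_of_le_one_right (by positivity) (measureReal_le_one)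

end SimilarityData

end DegenerateString

end

noncomputable section

namespace DegenerateString

/-! ### Sobolev functions on the unit interval as indefinite integrals -/

/-- Lebesgue measure on the open unit interval. -/
abbrev unitMeasure : Measure ℝ := volume.restrict (Ioo 0 1)

theorem unitMeasure_real_Ioc_le (s t : ℝ) (h : s ≤ t) : unitMeasure.real (Ioc s t) ≤ t - s := by
  rw [measureReal_restrict_apply measurableSet_Ioc]
  refine (measureReal_mono inter_subset_left (by simp)).trans ?_
  rw [Real.volume_real_Ioc_of_le h]

theorem unitMeasure_real_univ_le : unitMeasure.real univ ≤ 1 := by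
  simp

theorem norm_intervalIntegral_le {f : ℝ → ℂ} {C s t : ℝ} (hC : 0 ≤ C)
    (h : ∀ x ∈ uIoc s t, ‖f x‖ ≤ C) : ‖∫ x in s..t, f x ∂unitMeasure‖ ≤ C * |t - s| := by
  rw [intervalIntegral.norm_integral_eq_norm_integral_uIoc]
  refine (norm_setIntegral_le_of_norm_le_const (measure_lt_top _ _) h).trans ?_
  gcongr
  rw [uIoc, ← max_sub_min_eq_abs]
  exact unitMeasure_real_Ioc_le _ _ min_le_max

/-- Cauchy–Schwarz against an indicator function. The square root of the length is the reason for
the exponent `2ℓ - 1` in `q`, instead of `2ℓ`. -/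
theorem norm_intervalIntegral_L2_le (g : H) (s t : ℝ) :
    ‖∫ x in s..t, g x ∂unitMeasure‖ ≤ √|t - s| * ‖g‖ := by
  rw [intervalIntegral.norm_integral_eq_norm_integral_uIoc, uIoc,
    ← L2.inner_indicatorConstLp_one measurableSet_Ioc (measure_ne_top _ _)]
  refine (norm_inner_le_norm _ _).trans ?_
  gcongr
  refine norm_indicatorConstLp_le.trans ?_
  rw [norm_one, one_mul, ENNReal.toReal_ofNat, ← Real.sqrt_eq_rpow, ← max_sub_min_eq_abs]
  exact Real.sqrt_le_sqrt (unitMeasure_real_Ioc_le _ _ min_le_max)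

/-- Primitives are taken against the restricted measure, which makes them continuous and bounded on
the whole line; on `[0,1]` this changes nothing. -/
theorem intervalIntegral_unitMeasure_eq {f : ℝ → ℂ} {s t : ℝ} (hs : s ∈ Icc (0 : ℝ) 1)
    (ht : t ∈ Icc (0 : ℝ) 1) : ∫ x in s..t, f x ∂unitMeasure = ∫ x in s..t, f x := by
  have h : ∀ s ∈ Icc (0 : ℝ) 1, ∀ t ∈ Icc (0 : ℝ) 1, ∫ x in Ioc s t, f x ∂unitMeasure =
      ∫ x in Ioc s t, f x := fun s hs t ht => by
    rw [unitMeasure, restrict_Ioo_eq_restrict_Ioc, Measure.restrict_restrict measurableSet_Ioc,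
      inter_eq_left.2 (Ioc_subset_Ioc hs.1 ht.2)]
  rw [intervalIntegral, intervalIntegral, h s hs t ht, h t ht s hs]

/-- Initial data of order `ℓ` at zero together with a derivative of order `ℓ`; the first component
lists the initial values from the highest order down. -/
abbrev JetSpace (ℓ : ℕ) : Type := (Fin ℓ → ℂ) × H

namespace JetSpace

variable {ℓ : ℕ}

/-- The initial values, extended by zero. -/
def coef (w : JetSpace ℓ) (k : ℕ) : ℂ := if h : k < ℓ then w.1 ⟨k, h⟩ else 0

/-- The successive indefinite integrals of the top derivative, with the given initial values. -/
def chain (w : JetSpace ℓ) : ℕ → ℝ → ℂ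
  | 0 => w.2
  | k + 1 => fun t => coef w k + ∫ s in (0 : ℝ)..t, chain w k s ∂unitMeasure

theorem coef_add (v w : JetSpace ℓ) (k : ℕ) : coef (v + w) k = coef v k + coef w k := by
  unfold coef
  split_ifs <;> simp

theorem coef_smul (c : ℂ) (w : JetSpace ℓ) (k : ℕ) : coef (c • w) k = c * coef w k := by
  unfold coef
  split_ifs <;> simp

theorem norm_coef_le (w : JetSpace ℓ) (k : ℕ) : ‖coef w k‖ ≤ ‖w‖ := by
  unfold coef
  split_ifs with h
  · exact (norm_le_pi_norm w.1 ⟨k, h⟩).trans (norm_fst_le w)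
  · simp

theorem integrable_chain_and_continuous (w : JetSpace ℓ) (k : ℕ) :
    Integrable (chain w k) unitMeasure ∧ Continuous (chain w (k + 1)) := by
  induction k with
  | zero =>
    have h : Integrable (chain w 0) unitMeasure := (Lp.memLp w.2).integrable (by norm_num)
    exact ⟨h, continuous_const.add
      (intervalIntegral.continuous_primitive (fun a b => h.intervalIntegrable) 0)⟩
  | succ k ih =>
    have h : Integrable (chain w (k + 1)) unitMeasure := by
      have := (ih.2.continuousOn (s := Icc (0 : ℝ) 1)).integrableOn_compact isCompact_Icc (μ := volume)
      exact this.mono_set Ioo_subset_Icc_self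
    exact ⟨h, continuous_const.add
      (intervalIntegral.continuous_primitive (fun a b => h.intervalIntegrable) 0)⟩

theorem integrable_chain (w : JetSpace ℓ) (k : ℕ) : Integrable (chain w k) unitMeasure :=
  (integrable_chain_and_continuous w k).1

theorem continuous_chain (w : JetSpace ℓ) (k : ℕ) : Continuous (chain w (k + 1)) :=
  (integrable_chain_and_continuous w k).2

theorem intervalIntegrable_chain (w : JetSpace ℓ) (k : ℕ) (s t : ℝ) :
    IntervalIntegrable (chain w k) unitMeasure s t :=
  (integrable_chain w k).intervalIntegrable

theorem chain_zero_right (w : JetSpace ℓ) (k : ℕ) : chain w (k + 1) 0 = coef w k := by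
  simp [chain]

theorem chain_sub (w : JetSpace ℓ) (k : ℕ) (s t : ℝ) :
    chain w (k + 1) t - chain w (k + 1) s = ∫ x in s..t, chain w k x ∂unitMeasure := by
  simp only [chain, add_sub_add_left_eq_sub]
  exact intervalIntegral.integral_interval_sub_left (intervalIntegrable_chain w k _ _)
    (intervalIntegrable_chain w k _ _)

theorem intervalIntegral_congr_ae {f g : ℝ → ℂ} (h : f =ᵐ[unitMeasure] g) (s t : ℝ) :
    ∫ x in s..t, f x ∂unitMeasure = ∫ x in s..t, g x ∂unitMeasure :=
  intervalIntegral.integral_congr_ae (h.mono fun _ hx _ => hx)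

theorem chain_add_ae (v w : JetSpace ℓ) (k : ℕ) :
    chain (v + w) k =ᵐ[unitMeasure] fun t => chain v k t + chain w k t := by
  induction k with
  | zero => exact Lp.coeFn_add v.2 w.2
  | succ k ih =>
    refine Eventually.of_forall fun t => ?_
    simp only [chain]
    rw [intervalIntegral_congr_ae ih, intervalIntegral.integral_add
      (intervalIntegrable_chain v k _ _) (intervalIntegrable_chain w k _ _), coef_add]
    ring

theorem chain_add (v w : JetSpace ℓ) (k : ℕ) (t : ℝ) :
    chain (v + w) (k + 1) t = chain v (k + 1) t + chain w (k + 1) t := by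
  simp only [chain]
  rw [intervalIntegral_congr_ae (chain_add_ae v w k), intervalIntegral.integral_add
    (intervalIntegrable_chain v k _ _) (intervalIntegrable_chain w k _ _), coef_add]
  ring

theorem chain_smul_ae (c : ℂ) (w : JetSpace ℓ) (k : ℕ) :
    chain (c • w) k =ᵐ[unitMeasure] fun t => c * chain w k t := by
  induction k with
  | zero => exact Lp.coeFn_smul c w.2
  | succ k ih =>
    refine Eventually.of_forall fun t => ?_
    simp only [chain]
    rw [intervalIntegral_congr_ae ih, intervalIntegral.integral_const_mul, coef_smul, mul_add]

theorem chain_smul (c : ℂ) (w : JetSpace ℓ) (k : ℕ) (t : ℝ) :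
    chain (c • w) (k + 1) t = c * chain w (k + 1) t := by
  simp only [chain]
  rw [intervalIntegral_congr_ae (chain_smul_ae c w k), intervalIntegral.integral_const_mul, coef_smul,
    mul_add]

theorem norm_chain_le (w : JetSpace ℓ) (k : ℕ) (t : ℝ) : ‖chain w (k + 1) t‖ ≤ (k + 2) * ‖w‖ := by
  induction k generalizing t with
  | zero =>
    refine (norm_add_le _ _).trans ?_
    have h1 := norm_coef_le w 0
    have h2 : ‖∫ s in (0 : ℝ)..t, chain w 0 s ∂unitMeasure‖ ≤ ‖w‖ := by
      rw [intervalIntegral.norm_integral_eq_norm_integral_uIoc, uIoc]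
      change ‖∫ s in Ioc _ _, w.2 s ∂unitMeasure‖ ≤ ‖w‖
      rw [← L2.inner_indicatorConstLp_one measurableSet_Ioc (measure_ne_top _ _)]
      refine (norm_inner_le_norm _ _).trans ?_
      refine (mul_le_of_le_one_left (norm_nonneg _) ?_).trans (norm_snd_le w)
      refine norm_indicatorConstLp_le.trans ?_
      rw [norm_one, one_mul, ENNReal.toReal_ofNat, ← Real.sqrt_eq_rpow]
      refine Real.sqrt_le_one.2 ((measureReal_mono (subset_univ _)).trans unitMeasure_real_univ_le)
    push_cast
    linarith
  | succ k ih =>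
    refine (norm_add_le _ _).trans ?_
    have h1 := norm_coef_le w (k + 1)
    have h2 : ‖∫ s in (0 : ℝ)..t, chain w (k + 1) s ∂unitMeasure‖ ≤ (k + 2) * ‖w‖ := by
      rw [intervalIntegral.norm_integral_eq_norm_integral_uIoc]
      refine (norm_setIntegral_le_of_norm_le_const (measure_lt_top _ _) fun x _ => ih x).trans ?_
      exact mul_le_of_le_one_right (by positivity)
        ((measureReal_mono (subset_univ _)).trans unitMeasure_real_univ_le)
    push_cast
    linarith

/-- The value at `t` of the derivative of order `ℓ - 1 - k`, as a functional. -/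
def eval (k : ℕ) (t : ℝ) : JetSpace ℓ →L[ℂ] ℂ :=
  LinearMap.mkContinuous
    { toFun := fun w => chain w (k + 1) t
      map_add' := fun v w => chain_add v w k t
      map_smul' := fun c w => chain_smul c w k t } (k + 2) fun w => norm_chain_le w k t

theorem eval_apply (k : ℕ) (t : ℝ) (w : JetSpace ℓ) : eval k t w = chain w (k + 1) t := rfl

theorem memLp_chain (w : JetSpace ℓ) (k : ℕ) : MemLp (chain w k) 2 unitMeasure := by
  cases k with
  | zero => exact Lp.memLp w.2
  | succ k =>
    exact MemLp.of_bound (continuous_chain w k).aestronglyMeasurable _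
      (Eventually.of_forall (norm_chain_le w k))

/-- The function itself, as an element of `L_2(0, 1)`. -/
def toL2 : JetSpace ℓ →L[ℂ] H :=
  LinearMap.mkContinuous
    { toFun := fun w => (memLp_chain w ℓ).toLp _
      map_add' := fun v w => by
        rw [← MemLp.toLp_add]
        exact MemLp.toLp_congr _ _ (chain_add_ae v w ℓ)
      map_smul' := fun c w => by
        rw [RingHom.id_apply, ← MemLp.toLp_const_smul]
        exact MemLp.toLp_congr _ _ (chain_smul_ae c w ℓ) } (ℓ + 2) fun w => by
    rcases ℓ with _ | k
    · have h : (memLp_chain w 0).toLp _ = w.2 := Lp.toLp_coeFn _ _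
      change ‖(memLp_chain w 0).toLp _‖ ≤ _
      rw [h]
      have := norm_snd_le w
      have := norm_nonneg w
      push_cast
      linarith
    · have h0 : 0 ≤ ((k : ℝ) + 2) * ‖w‖ := by positivity
      refine (Lp.norm_le_of_ae_bound (C := (k + 2) * ‖w‖) h0 ?_).trans ?_
      · filter_upwards [(memLp_chain w (k + 1)).coeFn_toLp] with t ht
        change ‖((memLp_chain w (k + 1)).toLp _ : ℝ → ℂ) t‖ ≤ _
        rw [ht]
        exact norm_chain_le w k t
      · have h1 : (measureUnivNNReal unitMeasure : ℝ) ≤ 1 := unitMeasure_real_univ_le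
        refine (mul_le_of_le_one_left h0 ?_).trans ?_
        · exact Real.rpow_le_one (NNReal.coe_nonneg _) h1 (by positivity)
        · push_cast
          gcongr
          linarith

theorem coeFn_toL2 (w : JetSpace ℓ) : toL2 w =ᵐ[unitMeasure] chain w ℓ :=
  (memLp_chain w ℓ).coeFn_toLp

theorem ae_eq_zero_of_forall_intervalIntegral_eq_zero {f : ℝ → ℂ} (hf : Integrable f unitMeasure)
    (h : ∀ t ∈ Icc (0 : ℝ) 1, ∫ s in (0 : ℝ)..t, f s = 0) : f =ᵐ[unitMeasure] 0 := by
  have hf' : IntervalIntegrable f volume 0 1 := by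
    rw [intervalIntegrable_iff_integrableOn_Ioo_of_le zero_le_one]
    exact hf
  refine (ae_restrict_iff' measurableSet_Ioo).2 ?_
  filter_upwards [hf'.ae_hasDerivAt_integral] with x hx hx'
  rw [uIcc_of_le zero_le_one] at hx
  have h1 := hx (Ioo_subset_Icc_self hx') 0 ⟨le_rfl, zero_le_one⟩
  refine h1.unique ((hasDerivAt_const x (0 : ℂ)).congr_of_eventuallyEq ?_)
  filter_upwards [Ioo_mem_nhds hx'.1 hx'.2] with t ht
  exact h t (Ioo_subset_Icc_self ht)

theorem eqOn_Icc_of_ae_eq {f g : ℝ → ℂ} (h : f =ᵐ[unitMeasure] g) (hf : ContinuousOn f (Icc 0 1))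
    (hg : ContinuousOn g (Icc 0 1)) : EqOn f g (Icc 0 1) :=
  Measure.eqOn_Icc_of_ae_eq (μ := volume) zero_ne_one
    (by rwa [← restrict_Ioo_eq_restrict_Icc]) hf hg

/-- Vanishing is passed down one integration at a time: the value at zero gives the initial datum,
and Lebesgue differentiation gives the integrand. -/
theorem eq_zero_of_chain_eq_zero (w : JetSpace ℓ) (k : ℕ) (h : chain w k =ᵐ[unitMeasure] 0) :
    w.2 = 0 ∧ ∀ j < k, coef w j = 0 := by
  induction k with
  | zero => exact ⟨(Lp.eq_zero_iff_ae_eq_zero).2 h, by simp⟩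
  | succ k ih =>
    have h1 : EqOn (chain w (k + 1)) 0 (Icc 0 1) :=
      eqOn_Icc_of_ae_eq h (continuous_chain w k).continuousOn continuousOn_const
    have h0 : coef w k = 0 := by
      rw [← chain_zero_right]
      exact h1 ⟨le_rfl, zero_le_one⟩
    have h2 : chain w k =ᵐ[unitMeasure] 0 := by
      refine ae_eq_zero_of_forall_intervalIntegral_eq_zero (integrable_chain w k) fun t ht => ?_
      have : chain w (k + 1) t = 0 := h1 ht
      simpa only [chain, h0, zero_add, intervalIntegral_unitMeasure_eq
        (show (0 : ℝ) ∈ Icc (0 : ℝ) 1 from ⟨le_rfl, zero_le_one⟩) ht] using this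
    obtain ⟨h3, h4⟩ := ih h2
    refine ⟨h3, fun j hj => ?_⟩
    rcases Nat.lt_succ_iff_lt_or_eq.1 hj with h5 | rfl
    exacts [h4 j h5, h0]

/-- Uniqueness of the jet of a given function; it makes jets obtained by choice automatically
linear. -/
theorem toL2_injective : Function.Injective (toL2 : JetSpace ℓ → H) := by
  refine (injective_iff_map_eq_zero (toL2 : JetSpace ℓ →L[ℂ] H)).2 fun w hw => ?_
  have h : chain w ℓ =ᵐ[unitMeasure] 0 := by
    refine (coeFn_toL2 w).symm.trans ?_
    rw [hw]
    exact Lp.coeFn_zero _ _ _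
  obtain ⟨h1, h2⟩ := eq_zero_of_chain_eq_zero w ℓ h
  refine Prod.ext (funext fun k => ?_) h1
  have := h2 k k.2
  simpa [coef] using this

/-- Near a point where the first integrals vanish, the integrals are small. -/
theorem norm_chain_le_of_eq_zero (w : JetSpace ℓ) {K : ℕ} {t₀ r : ℝ} (hr : 0 ≤ r)
    (h0 : ∀ k < K, chain w (k + 1) t₀ = 0) :
    ∀ k < K, ∀ t, |t - t₀| ≤ r → ‖chain w (k + 1) t‖ ≤ r ^ k * (√r * ‖w.2‖) := by
  intro k hk
  induction k with
  | zero =>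
    intro t ht
    have := chain_sub w 0 t₀ t
    rw [h0 0 hk, sub_zero] at this
    rw [this, pow_zero, one_mul]
    refine (norm_intervalIntegral_L2_le w.2 _ _).trans ?_
    gcongr
  | succ k ih =>
    intro t ht
    have := chain_sub w (k + 1) t₀ t
    rw [h0 _ hk, sub_zero] at this
    rw [this]
    have hC : 0 ≤ r ^ k * (√r * ‖w.2‖) := by positivity
    refine (norm_intervalIntegral_le hC fun x hx => ih (by omega) x ?_).trans ?_
    · have := abs_sub_left_of_mem_uIcc (uIoc_subset_uIcc hx)
      exact this.trans ht
    · calc r ^ k * (√r * ‖w.2‖) * |t - t₀| ≤ r ^ k * (√r * ‖w.2‖) * r := by gcongr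
        _ = _ := by ring

/-- The jet of a function of Sobolev class. -/
theorem exists_of_isSobolevChain {D : ℕ → ℝ → ℂ} (h : IsSobolevChain ℓ D) :
    ∃ w : JetSpace ℓ, chain w 0 =ᵐ[unitMeasure] D ℓ ∧
      ∀ k < ℓ, ∀ t ∈ Icc (0 : ℝ) 1, chain w (k + 1) t = D (ℓ - 1 - k) t := by
  refine ⟨(fun k => D (ℓ - 1 - k) 0, h.memLp.toLp _), h.memLp.coeFn_toLp, fun k => ?_⟩
  set w : JetSpace ℓ := (fun k => D (ℓ - 1 - k) 0, h.memLp.toLp _) with hw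
  have h00 : (0 : ℝ) ∈ Icc (0 : ℝ) 1 := ⟨le_rfl, zero_le_one⟩
  -- The index `k` counts integrations from the top, so step `k + 1` of the chain is the derivative
  -- of order `ℓ - 1 - k`.
  have hstep : ∀ k < ℓ, chain w k =ᵐ[unitMeasure] D (ℓ - k) → ∀ t ∈ Icc (0 : ℝ) 1,
      chain w (k + 1) t = D (ℓ - 1 - k) t := fun k hk hae t ht => by
    have h1 := h.eq_integral (ℓ - 1 - k) (by omega) t ht
    rw [show ℓ - 1 - k + 1 = ℓ - k by omega] at h1
    simp only [chain]
    rw [h1, intervalIntegral_congr_ae hae, intervalIntegral_unitMeasure_eq h00 ht]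
    simp [coef, hk, hw]
  induction k with
  | zero =>
    intro hk
    exact hstep 0 hk h.memLp.coeFn_toLp
  | succ k ih =>
    intro hk
    refine hstep (k + 1) hk ?_
    refine (ae_restrict_iff' measurableSet_Ioo).2 (Eventually.of_forall fun t ht => ?_)
    rw [ih (by omega) t (Ioo_subset_Icc_self ht), show ℓ - 1 - k = ℓ - (k + 1) by omega]

end JetSpace

end DegenerateString

end

noncomputable section

namespace DegenerateString

/-! ### Test functions and the lemma of du Bois-Reymond -/

/-- Integration by parts for indefinite integrals. -/
theorem integral_mul_primitive_add {F g : ℝ → ℂ} (hF : Integrable F unitMeasure)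
    (hg : Integrable g unitMeasure) :
    ∫ t, F t * (∫ s in (0 : ℝ)..t, g s ∂unitMeasure) ∂unitMeasure +
      ∫ t, (∫ s in (0 : ℝ)..t, F s ∂unitMeasure) * g t ∂unitMeasure =
      (∫ t, F t ∂unitMeasure) * ∫ t, g t ∂unitMeasure := by
  -- The two terms are the integrals of `F ⊗ g` over the two triangles into which the diagonal, a
  -- null set, cuts the unit square.
  set A : Set (ℝ × ℝ) := {z | z.2 ≤ z.1} with hAdef
  have hA : MeasurableSet A := measurableSet_le measurable_snd measurable_fst
  have hint : Integrable (fun z : ℝ × ℝ => F z.1 * g z.2) (unitMeasure.prod unitMeasure) :=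
    hF.mul_prod hg
  have hprim : ∀ (f : ℝ → ℂ), ∀ t ∈ Ioo (0 : ℝ) 1,
      ∫ s in (0 : ℝ)..t, f s ∂unitMeasure = ∫ s, (Iic t).indicator f s ∂unitMeasure := by
    intro f t ht
    rw [intervalIntegral.integral_of_le ht.1.le, integral_indicator measurableSet_Iic,
      unitMeasure, Measure.restrict_restrict measurableSet_Ioc, Measure.restrict_restrict measurableSet_Iic]
    congr 2
    ext s
    simp only [mem_inter_iff, mem_Ioc, mem_Ioo, mem_Iic]
    tauto
  have hae : ∀ᵐ t ∂unitMeasure, t ∈ Ioo (0 : ℝ) 1 := ae_restrict_mem measurableSet_Ioo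
  have h1 : ∫ t, F t * (∫ s in (0 : ℝ)..t, g s ∂unitMeasure) ∂unitMeasure =
      ∫ z in A, F z.1 * g z.2 ∂(unitMeasure.prod unitMeasure) := by
    rw [← integral_indicator hA, integral_prod _ (hint.indicator hA)]
    refine integral_congr_ae ?_
    filter_upwards [hae] with t ht
    rw [hprim g t ht, ← integral_const_mul]
    congr 1
    ext s
    by_cases hs : s ≤ t
    · simp [hs, hAdef]
    · simp [hs, hAdef]
  have h2 : ∫ t, (∫ s in (0 : ℝ)..t, F s ∂unitMeasure) * g t ∂unitMeasure =
      ∫ z in Aᶜ, F z.1 * g z.2 ∂(unitMeasure.prod unitMeasure) := by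
    rw [← integral_indicator hA.compl, integral_prod_symm _ (hint.indicator hA.compl)]
    refine integral_congr_ae ?_
    filter_upwards [hae] with t ht
    rw [hprim F t ht, ← integral_mul_const]
    refine integral_congr_ae ?_
    have hne : ∀ᵐ s ∂unitMeasure, s ≠ t := by
      rw [ae_iff]
      simp
    filter_upwards [hne] with s hs
    rcases lt_or_gt_of_ne hs with h | h
    · simp [h.le, h, hAdef]
    · simp [h.le, h, hAdef]
  rw [h1, h2, integral_add_compl hA hint, integral_prod_mul F g]

namespace IsTestFunction

variable {φ ψ : ℝ → ℝ}

theorem deriv (h : IsTestFunction φ) : IsTestFunction (deriv φ) :=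
  ⟨(contDiff_infty_iff_deriv.1 h.contDiff).2, h.hasCompactSupport.deriv,
    tsupport_deriv_subset.trans h.tsupport_subset⟩

theorem eq_zero_of_notMem (h : IsTestFunction φ) {t : ℝ} (ht : t ∉ Ioo (0 : ℝ) 1) : φ t = 0 :=
  image_eq_zero_of_notMem_tsupport fun ht' => ht (h.tsupport_subset ht')

theorem integrable (h : IsTestFunction φ) : Integrable φ unitMeasure :=
  (h.contDiff.continuous.integrable_of_hasCompactSupport h.hasCompactSupport).restrict

theorem integrable_ofReal (h : IsTestFunction φ) :
    Integrable (fun t => ((φ t : ℝ) : ℂ)) unitMeasure :=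
  h.integrable.ofReal

theorem sub_const_mul (h : IsTestFunction φ) (hψ : IsTestFunction ψ) (c : ℝ) :
    IsTestFunction (φ - fun t => c * ψ t) :=
  ⟨h.contDiff.sub (contDiff_const.mul hψ.contDiff),
    h.hasCompactSupport.sub hψ.hasCompactSupport.mul_left,
    (tsupport_sub _ _).trans (union_subset h.tsupport_subset
      ((tsupport_mul_subset_right).trans hψ.tsupport_subset))⟩

theorem iteratedDeriv_sub_const_mul (h : IsTestFunction φ) (hψ : IsTestFunction ψ) (c : ℝ) (i : ℕ)
    (t : ℝ) : iteratedDeriv i (φ - fun t => c * ψ t) t =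
      iteratedDeriv i φ t - c * iteratedDeriv i ψ t := by
  have h1 : ContDiff ℝ i φ := h.contDiff.of_le (by exact_mod_cast le_top)
  have h2 : ContDiff ℝ i ψ := hψ.contDiff.of_le (by exact_mod_cast le_top)
  rw [iteratedDeriv_sub h1.contDiffAt (contDiff_const.mul h2).contDiffAt,
    iteratedDeriv_const_mul_field]

/-- A test function with vanishing integral is the derivative of a test function. -/
theorem exists_deriv_eq (h : IsTestFunction φ) (h0 : ∫ t in (0 : ℝ)..1, φ t = 0) :
    ∃ Φ, IsTestFunction Φ ∧ _root_.deriv Φ = φ := by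
  have hc := h.contDiff.continuous
  have hd : ∀ t, HasDerivAt (fun t => ∫ s in (0 : ℝ)..t, φ s) (φ t) t := fun t =>
    intervalIntegral.integral_hasDerivAt_right (hc.intervalIntegrable _ _)
      hc.aestronglyMeasurable.stronglyMeasurableAtFilter hc.continuousAt
  have hderiv : _root_.deriv (fun t => ∫ s in (0 : ℝ)..t, φ s) = φ := funext fun t => (hd t).deriv
  have hsmooth : ContDiff ℝ ∞ (_root_.deriv (fun t => ∫ s in (0 : ℝ)..t, φ s)) := by
    rw [hderiv]
    exact h.contDiff
  -- The primitive vanishes to the left of the support and, because the total integral is zero, also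
  -- to its right.
  obtain ⟨a, b, ha, hb, hab⟩ : ∃ a b : ℝ, 0 < a ∧ b < 1 ∧ tsupport φ ⊆ Icc a b := by
    rcases (tsupport φ).eq_empty_or_nonempty with he | hne
    · exact ⟨1 / 2, 1 / 2, by norm_num, by norm_num, by simp [he]⟩
    · have hK : IsCompact (tsupport φ) := h.hasCompactSupport
      obtain ⟨a, ha⟩ := hK.exists_isLeast hne
      obtain ⟨b, hb⟩ := hK.exists_isGreatest hne
      exact ⟨a, b, (h.tsupport_subset ha.1).1, (h.tsupport_subset hb.1).2,
        fun x hx => ⟨ha.2 hx, hb.2 hx⟩⟩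
  have hz : ∀ t, t ∉ Icc a b → φ t = 0 := fun t ht =>
    image_eq_zero_of_notMem_tsupport fun h' => ht (hab h')
  have hsupp : Function.support (fun t => ∫ s in (0 : ℝ)..t, φ s) ⊆ Icc a b := by
    intro t ht
    by_contra h'
    refine ht ?_
    rw [mem_Icc, not_and_or, not_le, not_le] at h'
    rcases h' with h' | h'
    · refine intervalIntegral.integral_zero_ae (Eventually.of_forall fun s hs => hz s fun hs' => ?_)
      have h1 : s ≤ max 0 t := hs.2
      have h2 : max 0 t < a := max_lt ha h'
      linarith [hs'.1]
    · have h1 := intervalIntegral.integral_add_adjacent_intervals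
        (hc.intervalIntegrable 0 t) (hc.intervalIntegrable t 1) (μ := volume)
      have h2 : ∫ s in t..1, φ s = 0 :=
        intervalIntegral.integral_zero_ae (Eventually.of_forall fun s hs => hz s fun hs' => by
          have h1 : min t 1 < s := hs.1
          have h2 : b < min t 1 := lt_min h' hb
          linarith [hs'.2])
      change ∫ s in (0 : ℝ)..t, φ s = 0
      rw [h2, h0] at h1
      simpa using h1
  have hts : tsupport (fun t => ∫ s in (0 : ℝ)..t, φ s) ⊆ Icc a b :=
    closure_minimal hsupp isClosed_Icc
  refine ⟨fun t => ∫ s in (0 : ℝ)..t, φ s, ⟨?_, ?_, hts.trans fun x hx => ⟨?_, ?_⟩⟩, hderiv⟩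
  · exact contDiff_infty_iff_deriv.2 ⟨fun t => (hd t).differentiableAt, hsmooth⟩
  · exact isCompact_Icc.of_isClosed_subset (isClosed_tsupport _) hts
  · exact ha.trans_le hx.1
  · exact hx.2.trans_lt hb

theorem exists_integral_eq_one : ∃ χ, IsTestFunction χ ∧ ∫ t in (0 : ℝ)..1, χ t = 1 := by
  let b : ContDiffBump (1 / 2 : ℝ) := ⟨1 / 8, 1 / 4, by norm_num, by norm_num⟩
  have hsub : tsupport (b.normed volume) ⊆ Ioo 0 1 := by
    rw [b.tsupport_normed_eq, Real.closedBall_eq_Icc]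
    intro x hx
    simp only [b, mem_Icc] at hx
    constructor <;> linarith [hx.1, hx.2]
  refine ⟨b.normed volume, ⟨b.contDiff_normed, b.hasCompactSupport_normed, hsub⟩, ?_⟩
  rw [intervalIntegral.integral_of_le zero_le_one, setIntegral_eq_integral_of_forall_compl_eq_zero,
    b.integral_normed]
  intro t ht
  exact image_eq_zero_of_notMem_tsupport fun h => ht (Ioo_subset_Ioc_self (hsub h))

end IsTestFunction

/-- The functions `v i`, `i ≤ ℓ`, are successive derivatives and those with `i < ℓ` vanish at both
ends of the unit interval. -/
structure IsZeroChain (ℓ : ℕ) (v : ℕ → ℝ → ℂ) : Prop where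
  integrable : ∀ i < ℓ, Integrable (v (i + 1)) unitMeasure
  eq_integral : ∀ i < ℓ, ∀ t ∈ Icc (0 : ℝ) 1, v i t = ∫ s in (0 : ℝ)..t, v (i + 1) s ∂unitMeasure
  apply_one : ∀ i < ℓ, v i 1 = 0

theorem intervalIntegral_zero_one_eq (f : ℝ → ℂ) :
    ∫ s in (0 : ℝ)..1, f s ∂unitMeasure = ∫ s, f s ∂unitMeasure := by
  rw [intervalIntegral_unitMeasure_eq ⟨le_rfl, zero_le_one⟩ ⟨zero_le_one, le_rfl⟩,
    intervalIntegral.integral_of_le zero_le_one, unitMeasure, restrict_Ioo_eq_restrict_Ioc]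

theorem integral_mul_eq_neg_integral_primitive_mul {F u v : ℝ → ℂ} (hF : Integrable F unitMeasure)
    (hv : Integrable v unitMeasure)
    (hu : ∀ t ∈ Icc (0 : ℝ) 1, u t = ∫ s in (0 : ℝ)..t, v s ∂unitMeasure) (h1 : u 1 = 0) :
    ∫ t, F t * u t ∂unitMeasure =
      -∫ t, (∫ s in (0 : ℝ)..t, F s ∂unitMeasure) * v t ∂unitMeasure := by
  have h := integral_mul_primitive_add hF hv
  have hv0 : ∫ t, v t ∂unitMeasure = 0 := by
    rw [← intervalIntegral_zero_one_eq, ← hu 1 ⟨zero_le_one, le_rfl⟩, h1]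
  rw [hv0, mul_zero] at h
  have h2 : ∫ t, F t * u t ∂unitMeasure =
      ∫ t, F t * (∫ s in (0 : ℝ)..t, v s ∂unitMeasure) ∂unitMeasure := by
    refine setIntegral_congr_fun measurableSet_Ioo fun t ht => ?_
    simp only [hu t (Ioo_subset_Icc_self ht)]
  rw [h2]
  exact eq_neg_of_add_eq_zero_left h

theorem IsTestFunction.isZeroChain {φ : ℝ → ℝ} (h : IsTestFunction φ) (ℓ : ℕ) :
    IsZeroChain ℓ fun i t => ((iteratedDeriv i φ t : ℝ) : ℂ) := by
  have hi : ∀ i, IsTestFunction (iteratedDeriv i φ) := fun i => by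
    induction i with
    | zero => simpa using h
    | succ i ih =>
      rw [iteratedDeriv_succ]
      exact ih.deriv
  refine ⟨fun i _ => (hi (i + 1)).integrable_ofReal, fun i _ t ht => ?_, fun i _ => ?_⟩
  · rw [intervalIntegral_unitMeasure_eq ⟨le_rfl, zero_le_one⟩ ht, intervalIntegral.integral_ofReal]
    congr 1
    rw [iteratedDeriv_succ, intervalIntegral.integral_deriv_eq_sub
      (fun x _ => ((hi i).contDiff.differentiable (by simp)).differentiableAt)
      ((hi i).deriv.contDiff.continuous.intervalIntegrable _ _),
      (hi i).eq_zero_of_notMem (t := 0) (by simp), sub_zero]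
  · simp [(hi i).eq_zero_of_notMem (t := 1) (by simp)]

/-- A distribution of order `ℓ` with integrable coefficients that annihilates the test functions
annihilates all functions that vanish at the end-points together with their derivatives. -/
theorem sum_integral_mul_eq_zero (ℓ : ℕ) (F v : ℕ → ℝ → ℂ)
    (hF : ∀ i ≤ ℓ, Integrable (F i) unitMeasure) (hv : IsZeroChain ℓ v)
    (hFv : ∀ i ≤ ℓ, Integrable (fun t => F i t * v i t) unitMeasure)
    (htest : ∀ φ, IsTestFunction φ →
      ∑ i ∈ Finset.range (ℓ + 1), ∫ t, F i t * ((iteratedDeriv i φ t : ℝ) : ℂ) ∂unitMeasure = 0) :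
    ∑ i ∈ Finset.range (ℓ + 1), ∫ t, F i t * v i t ∂unitMeasure = 0 := by
  induction ℓ generalizing F v with
  | zero =>
    have h0 : ∀ᵐ x, x ∈ Ioo (0 : ℝ) 1 → F 0 x = 0 := by
      refine isOpen_Ioo.ae_eq_zero_of_integral_contDiff_smul_eq_zero
        (IntegrableOn.locallyIntegrableOn (hF 0 le_rfl)) fun φ h1 h2 h3 => ?_
      have := htest φ ⟨h1, h2, h3⟩
      simp only [zero_add, Finset.range_one, Finset.sum_singleton, iteratedDeriv_zero] at this
      rw [← setIntegral_eq_integral_of_forall_compl_eq_zero (s := Ioo (0 : ℝ) 1)]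
      · simpa only [Complex.real_smul, mul_comm] using this
      · intro t ht
        rw [image_eq_zero_of_notMem_tsupport fun h => ht (h3 h), zero_smul]
    simp only [zero_add, Finset.range_one, Finset.sum_singleton]
    refine integral_eq_zero_of_ae ?_
    filter_upwards [(ae_restrict_iff' measurableSet_Ioo).2 h0] with t ht
    simp [ht]
  | succ ℓ ih =>
    -- Integration by parts moves the coefficient of order zero to order one. What remains acts on
    -- the first derivative and has order lower by one.
    set G : ℝ → ℂ := fun t => ∫ s in (0 : ℝ)..t, F 0 s ∂unitMeasure with hG
    have hGc : Continuous G :=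
      intervalIntegral.continuous_primitive (fun a b => (hF 0 (by omega)).intervalIntegrable) 0
    have hGb : ∀ t, ‖G t‖ ≤ ∫ s, ‖F 0 s‖ ∂unitMeasure := fun t => by
      rw [hG, intervalIntegral.norm_integral_eq_norm_integral_uIoc]
      exact (norm_integral_le_integral_norm _).trans
        (setIntegral_le_integral (hF 0 (by omega)).norm (Eventually.of_forall fun _ => norm_nonneg _))
    have hGi : ∀ u : ℝ → ℂ, Integrable u unitMeasure → Integrable (fun t => G t * u t) unitMeasure :=
      fun u hu => hu.bdd_mul hGc.aestronglyMeasurable (Eventually.of_forall hGb)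
    have hGI : Integrable G unitMeasure := by simpa using hGi (fun _ => 1) (integrable_const 1)
    obtain ⟨χ, hχ, hχ1⟩ := IsTestFunction.exists_integral_eq_one
    have hbd : ∀ (i : ℕ) (f : ℝ → ℂ), Integrable f unitMeasure → ∀ φ, IsTestFunction φ →
        Integrable (fun t => f t * ((iteratedDeriv i φ t : ℝ) : ℂ)) unitMeasure :=
      fun i f hf φ hφ => by
        have h1 : ContDiff ℝ i φ := hφ.contDiff.of_le (by exact_mod_cast le_top)
        have h2 := h1.continuous_iteratedDeriv i le_rfl
        obtain ⟨C, hC⟩ := (isCompact_Icc (a := (0 : ℝ)) (b := 1)).exists_bound_of_continuousOn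
          h2.continuousOn
        refine hf.mul_bdd (c := C) (Complex.continuous_ofReal.comp h2).aestronglyMeasurable ?_
        filter_upwards [ae_restrict_mem measurableSet_Ioo] with t ht
        simpa using hC t (Ioo_subset_Icc_self ht)
    set F' : ℕ → ℝ → ℂ := fun i => if i = 0 then fun t => F 1 t - G t else F (i + 1) with hF'
    have hF'i : ∀ i ≤ ℓ, Integrable (F' i) unitMeasure := fun i hi => by
      simp only [hF']
      split_ifs
      exacts [(hF 1 (by omega)).sub hGI, hF _ (by omega)]
    have hstep : ∀ u : ℕ → ℝ → ℂ, IsZeroChain (ℓ + 1) u →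
        (∀ i ≤ ℓ, Integrable (fun t => F (i + 1) t * u (i + 1) t) unitMeasure) →
        ∑ i ∈ Finset.range (ℓ + 1 + 1), ∫ t, F i t * u i t ∂unitMeasure =
          ∑ i ∈ Finset.range (ℓ + 1), ∫ t, F' i t * u (i + 1) t ∂unitMeasure := by
      intro u hu hui
      have h1 := integral_mul_eq_neg_integral_primitive_mul (hF 0 (by omega)) (hu.integrable 0 (by omega))
        (hu.eq_integral 0 (by omega)) (hu.apply_one 0 (by omega))
      rw [Finset.sum_range_succ', Finset.sum_range_succ', Finset.sum_range_succ' _ ℓ, h1]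
      have h2 : ∫ t, F' 0 t * u (0 + 1) t ∂unitMeasure =
          ∫ t, F (0 + 1) t * u (0 + 1) t ∂unitMeasure - ∫ t, G t * u (0 + 1) t ∂unitMeasure := by
        rw [← integral_sub (hui 0 (by omega)) (hGi _ (hu.integrable 0 (by omega)))]
        simp only [hF', if_true, sub_mul, zero_add]
      rw [h2]
      have h3 : ∀ i, F' (i + 1) = F (i + 1 + 1) := fun i => by simp [hF']
      simp only [h3]
      ring
    -- The lowered functional is known to vanish only on derivatives of test functions, that is, on
    -- test functions of mean zero. Subtracting the constant `C`, its value at `χ`, makes it vanish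
    -- on all test functions. This constant is not seen by `v 1`, whose integral is zero.
    set C : ℂ := ∑ i ∈ Finset.range (ℓ + 1),
      ∫ t, F' i t * ((iteratedDeriv i χ t : ℝ) : ℂ) ∂unitMeasure with hC
    set F'' : ℕ → ℝ → ℂ := fun i => if i = 0 then fun t => F' 0 t - C else F' i with hF''
    have hsum : ∀ u : ℕ → ℝ → ℂ, Integrable (u 0) unitMeasure →
        (∀ i ≤ ℓ, Integrable (fun t => F' i t * u i t) unitMeasure) →
        ∑ i ∈ Finset.range (ℓ + 1), ∫ t, F'' i t * u i t ∂unitMeasure =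
          ∑ i ∈ Finset.range (ℓ + 1), ∫ t, F' i t * u i t ∂unitMeasure -
            C * ∫ t, u 0 t ∂unitMeasure := by
      intro u hu0 hu
      rw [Finset.sum_range_succ', Finset.sum_range_succ']
      have h2 : ∫ t, F'' 0 t * u 0 t ∂unitMeasure =
          ∫ t, F' 0 t * u 0 t ∂unitMeasure - C * ∫ t, u 0 t ∂unitMeasure := by
        rw [← integral_const_mul, ← integral_sub (hu 0 (by omega)) (hu0.const_mul C)]
        simp only [hF'', if_true, sub_mul]
      rw [h2]
      have h3 : ∀ i, F'' (i + 1) = F' (i + 1) := fun i => by simp [hF'']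
      simp only [h3]
      ring
    have hF'v : ∀ i ≤ ℓ, Integrable (fun t => F' i t * v (i + 1) t) unitMeasure := fun i hi => by
      by_cases h0 : i = 0
      · subst h0
        simp only [hF', if_true, sub_mul]
        exact (hFv 1 (by omega)).sub (hGi _ (hv.integrable 0 (by omega)))
      · simp only [hF', h0, if_false]
        exact hFv (i + 1) (by omega)
    have key := ih F'' (fun i => v (i + 1)) (fun i hi => ?_) ⟨fun i hi => hv.integrable (i + 1) (by omega),
      fun i hi => hv.eq_integral (i + 1) (by omega), fun i hi => hv.apply_one (i + 1) (by omega)⟩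
      (fun i hi => ?_) fun ψ hψ => ?_
    · rw [hsum (fun i => v (i + 1)) (hv.integrable 0 (by omega)) hF'v] at key
      have hv0 : ∫ t, v (0 + 1) t ∂unitMeasure = 0 := by
        rw [← intervalIntegral_zero_one_eq, ← hv.eq_integral 0 (by omega) 1 ⟨zero_le_one, le_rfl⟩,
          hv.apply_one 0 (by omega)]
      rw [hv0, mul_zero, sub_zero] at key
      rw [hstep v hv fun i hi => hFv (i + 1) (by omega)]
      exact key
    · simp only [hF'']
      split_ifs
      exacts [(hF'i 0 (by omega)).sub (integrable_const C), hF'i i hi]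
    · by_cases h0 : i = 0
      · subst h0
        simp only [hF'', if_true, sub_mul]
        exact (hF'v 0 (by omega)).sub ((hv.integrable 0 (by omega)).const_mul C)
      · simp only [hF'', h0, if_false]
        exact hF'v i hi
    · have hI : ∀ φ, IsTestFunction φ → ∫ t, ((φ t : ℝ) : ℂ) ∂unitMeasure =
          ((∫ t in (0 : ℝ)..1, φ t : ℝ) : ℂ) := fun φ _ => by
        rw [integral_complex_ofReal, intervalIntegral.integral_of_le zero_le_one, unitMeasure,
          restrict_Ioo_eq_restrict_Ioc]
      rw [hsum (fun i t => ((iteratedDeriv i ψ t : ℝ) : ℂ)) (by simpa using hψ.integrable_ofReal)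
        fun i hi => hbd i _ (hF'i i hi) ψ hψ]
      simp only [iteratedDeriv_zero]
      rw [hI ψ hψ]
      set c : ℝ := ∫ t in (0 : ℝ)..1, ψ t with hc
      have hη := hψ.sub_const_mul hχ c
      obtain ⟨Φ, hΦ, hΦ'⟩ := hη.exists_deriv_eq (by
        simp only [Pi.sub_apply]
        rw [intervalIntegral.integral_sub (hψ.contDiff.continuous.intervalIntegrable _ _)
          ((hχ.contDiff.continuous.intervalIntegrable _ _).const_mul c),
          intervalIntegral.integral_const_mul, hχ1, mul_one, sub_self])
      have h1 := htest Φ hΦ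
      rw [hstep (fun i t => ((iteratedDeriv i Φ t : ℝ) : ℂ)) (hΦ.isZeroChain _)
        fun i hi => hbd (i + 1) _ (hF _ (by omega)) Φ hΦ] at h1
      rw [← h1, hC, Finset.sum_mul, ← Finset.sum_sub_distrib]
      refine Finset.sum_congr rfl fun i hi => ?_
      have hi' : i ≤ ℓ := by simpa [Nat.lt_succ_iff] using hi
      rw [mul_comm, ← integral_const_mul, ← integral_sub (hbd i _ (hF'i i hi') ψ hψ)
        ((hbd i _ (hF'i i hi') χ hχ).const_mul _)]
      congr 1
      ext t
      rw [iteratedDeriv_succ', hΦ', hψ.iteratedDeriv_sub_const_mul hχ]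
      push_cast
      ring

end DegenerateString

end

/-! ### Boundedness deduced on a subspace of finite codimension -/

noncomputable section

namespace DegenerateString

/-- A linear map that is bounded on the kernel of finitely many functionals is bounded, provided its
values are determined continuously by a weaker norm. -/
theorem exists_bound_of_bound_on_ker {E W K κ : Type*} [Fintype κ]
    [NormedAddCommGroup E] [NormedSpace ℂ E] [NormedAddCommGroup W] [NormedSpace ℂ W] [CompleteSpace W]
    [NormedAddCommGroup K] [NormedSpace ℂ K] (T : E →ₗ[ℂ] W) (ι : W →L[ℂ] K)
    (hι : Function.Injective ι) (incl : E →L[ℂ] K) (hT : ∀ x, ι (T x) = incl x)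
    (B : W →L[ℂ] (κ → ℂ)) {C : ℝ} (hC0 : 0 ≤ C) (hC : ∀ x, B (T x) = 0 → ‖T x‖ ≤ C * ‖x‖) :
    ∃ C', 0 ≤ C' ∧ ∀ x, ‖T x‖ ≤ C' * ‖x‖ := by
  set f : E →ₗ[ℂ] (κ → ℂ) := (B : W →ₗ[ℂ] (κ → ℂ)).comp T with hf
  set D : Submodule ℂ E := LinearMap.ker f with hD
  have hDmem : ∀ x, x ∈ D ↔ B (T x) = 0 := fun x => by simp [hD, hf]
  have hfin : FiniteDimensional ℂ (E ⧸ D) :=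
    LinearEquiv.finiteDimensional f.quotKerEquivRange.symm
  -- For a convergent sequence in `D` the images under `T` are Cauchy by the bound. Their limit is
  -- `T x`, since the weaker topology identifies it, and therefore `B (T x) = 0`.
  have hclosed : IsClosed (D : Set E) := by
    refine isClosed_of_closure_subset fun x hx => ?_
    obtain ⟨u, hu, hux⟩ := mem_closure_iff_seq_limit.1 hx
    have hcau : CauchySeq fun k => T (u k) := by
      rw [Metric.cauchySeq_iff]
      intro ε hε
      obtain ⟨N, hN⟩ := Metric.cauchySeq_iff.1 hux.cauchySeq (ε / (C + 1)) (by positivity)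
      refine ⟨N, fun m hm k hk => ?_⟩
      have h1 := hC _ ((hDmem _).1 (D.sub_mem (hu m) (hu k)))
      have h2 := hN m hm k hk
      rw [dist_eq_norm, lt_div_iff₀ (by positivity)] at h2
      rw [dist_eq_norm, ← map_sub]
      nlinarith [norm_nonneg (u m - u k)]
    obtain ⟨w, hw⟩ := cauchySeq_tendsto_of_complete hcau
    have h1 : ι w = incl x := tendsto_nhds_unique ((ι.continuous.tendsto w).comp hw) (by
      simpa only [Function.comp_def, hT] using (incl.continuous.tendsto x).comp hux)
    have h2 : w = T x := hι (by rw [h1, hT])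
    refine (hDmem x).2 ?_
    rw [← h2]
    refine tendsto_nhds_unique ((B.continuous.tendsto w).comp hw) ?_
    simp only [Function.comp_def, (hDmem _).1 (hu _)]
    exact tendsto_const_nhds
  have : IsClosed (D : Set E) := hclosed
  -- The quotient by the closed subspace `D` is a normed space of finite dimension, so every linear
  -- section is continuous, and so is `T` after it.
  obtain ⟨s, hs⟩ := D.mkQ.exists_rightInverse_of_surjective D.range_mkQ
  let s' : E ⧸ D →L[ℂ] E := LinearMap.toContinuousLinearMap s
  let t' : E ⧸ D →L[ℂ] W := LinearMap.toContinuousLinearMap (T.comp s)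
  have hmk : ∀ x : E, ‖D.mkQ x‖ ≤ ‖x‖ := fun x => Submodule.Quotient.norm_mk_le D x
  refine ⟨C * (1 + ‖s'‖) + ‖t'‖, by positivity, fun x => ?_⟩
  have h1 : x - s (D.mkQ x) ∈ D := by
    refine (Submodule.Quotient.mk_eq_zero D).1 ?_
    change D.mkQ (x - s (D.mkQ x)) = 0
    rw [map_sub]
    have := LinearMap.congr_fun hs (D.mkQ x)
    simp only [LinearMap.comp_apply, LinearMap.id_apply] at this
    rw [this, sub_self]
  have h2 := hC _ ((hDmem _).1 h1)
  have h3 : ‖s (D.mkQ x)‖ ≤ ‖s'‖ * ‖x‖ := (s'.le_opNorm _).trans (by gcongr; exact hmk x)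
  have h4 : ‖T (s (D.mkQ x))‖ ≤ ‖t'‖ * ‖x‖ := (t'.le_opNorm _).trans (by gcongr; exact hmk x)
  calc ‖T x‖ = ‖T (x - s (D.mkQ x)) + T (s (D.mkQ x))‖ := by rw [← map_add, sub_add_cancel]
    _ ≤ ‖T (x - s (D.mkQ x))‖ + ‖T (s (D.mkQ x))‖ := norm_add_le _ _
    _ ≤ C * ‖x - s (D.mkQ x)‖ + ‖t'‖ * ‖x‖ := by gcongr
    _ ≤ C * (‖x‖ + ‖s'‖ * ‖x‖) + ‖t'‖ * ‖x‖ := by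
      gcongr
      exact (norm_sub_le _ _).trans (by gcongr)
    _ = _ := by ring

namespace SelfAdjointRealization

variable {ℓ : ℕ} {P : Fin ℓ → ℝ → ℝ} (L : SelfAdjointRealization ℓ P)

/-! ### The energy norm -/

theorem dense_domain : Dense (L.toLinearPMap.domain : Set H) := L.isSelfAdjoint.dense_domain

theorem isFormalAdjoint (x y : L.toLinearPMap.domain) :
    inner ℂ (L.toLinearPMap x) (y : H) = inner ℂ (x : H) (L.toLinearPMap y) := by
  have h := LinearPMap.adjoint_isFormalAdjoint L.dense_domain
  rw [LinearPMap.isSelfAdjoint_def.1 L.isSelfAdjoint] at h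
  exact h x y

/-- A vector orthogonal to the range lies in the domain of the adjoint with value zero. By
self-adjointness it is in the kernel of `L`, which is trivial. -/
theorem eq_zero_of_inner_eq_zero {h : H} (hh : ∀ u : L.toLinearPMap.domain,
    inner ℂ h (L.toLinearPMap u) = 0) : h = 0 := by
  have h1 : h ∈ (L.toLinearPMap.adjoint).domain :=
    LinearPMap.mem_adjoint_domain_of_exists h ⟨0, fun x => by rw [hh x, inner_zero_left]⟩
  have h2 : L.toLinearPMap.adjoint ⟨h, h1⟩ = 0 :=
    LinearPMap.adjoint_apply_eq L.dense_domain _ fun x => by simp [hh x]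
  have h3 : ∃ x : L.toLinearPMap.domain, (x : H) = h ∧ L.toLinearPMap x = 0 := by
    have h4 : (h, (0 : H)) ∈ L.toLinearPMap.adjoint.graph :=
      (LinearPMap.mem_graph_iff _).2 ⟨⟨h, h1⟩, rfl, h2⟩
    rw [LinearPMap.isSelfAdjoint_def.1 L.isSelfAdjoint] at h4
    simpa using (LinearPMap.mem_graph_iff _).1 h4
  obtain ⟨x, rfl, hx⟩ := h3
  obtain ⟨c, hc, hpos⟩ := L.posDef
  have h5 := hpos x
  rw [hx, inner_zero_left, Complex.zero_re] at h5
  have h6 : ‖(x : H)‖ ^ 2 ≤ 0 := by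
    by_contra h7
    have := mul_pos hc (not_le.1 h7)
    linarith
  simpa using le_antisymm h6 (sq_nonneg _)

/-- The domain of `L`, to be equipped with the energy norm. -/
def EnergySpace : Type := L.toLinearPMap.domain

namespace EnergySpace

instance : AddCommGroup L.EnergySpace := inferInstanceAs (AddCommGroup L.toLinearPMap.domain)

instance : Module ℂ L.EnergySpace := inferInstanceAs (Module ℂ L.toLinearPMap.domain)

variable {L}

/-- The element of the domain of `L`. -/
def toDomain : L.EnergySpace ≃ₗ[ℂ] L.toLinearPMap.domain := LinearEquiv.refl ℂ _

/-- The operator on the energy space. -/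
def op : L.EnergySpace →ₗ[ℂ] H := L.toLinearPMap.toFun.comp (toDomain (L := L)).toLinearMap

/-- The inclusion into `L_2(0, 1)`. -/
def val : L.EnergySpace →ₗ[ℂ] H := L.toLinearPMap.domain.subtype.comp (toDomain (L := L)).toLinearMap

theorem inner_op_val (x y : L.EnergySpace) : inner ℂ (op x) (val y) = inner ℂ (val x) (op y) :=
  L.isFormalAdjoint _ _

/-- The energy inner product. -/
@[reducible]
def core (L : SelfAdjointRealization ℓ P) : InnerProductSpace.Core ℂ L.EnergySpace where
  inner x y := inner ℂ (op x) (val y)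
  conj_inner_symm x y := by
    rw [inner_conj_symm, inner_op_val]
  re_inner_nonneg x := L.form_nonneg _
  add_left x y z := by rw [map_add, inner_add_left]
  smul_left x y r := by rw [map_smul, inner_smul_left]
  definite x hx := by
    obtain ⟨c, hc, hpos⟩ := L.posDef
    have h1 := hpos (toDomain x)
    have h2 : (inner ℂ (L.toLinearPMap (toDomain x)) ((toDomain x : L.toLinearPMap.domain) : H)).re = 0 := by
      have : inner ℂ (L.toLinearPMap (toDomain x)) ((toDomain x : L.toLinearPMap.domain) : H) = 0 := hx
      rw [this, Complex.zero_re]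
    rw [h2] at h1
    have h3 : ‖((toDomain x : L.toLinearPMap.domain) : H)‖ ^ 2 ≤ 0 := by
      by_contra h7
      have := mul_pos hc (not_le.1 h7)
      linarith
    have h4 := le_antisymm h3 (sq_nonneg _)
    have h5 : (toDomain x : L.toLinearPMap.domain) = 0 := by simpa using h4
    exact (LinearEquiv.map_eq_zero_iff _).1 h5

instance : NormedAddCommGroup L.EnergySpace := (core L).toNormedAddCommGroup

instance : InnerProductSpace ℂ L.EnergySpace := InnerProductSpace.ofCore (core L).toCore

theorem inner_def (x y : L.EnergySpace) : inner ℂ x y = inner ℂ (op x) (val y) := rfl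

theorem norm_sq (x : L.EnergySpace) : ‖x‖ ^ 2 = L.form (toDomain x) := by
  rw [← inner_self_eq_norm_sq (𝕜 := ℂ)]
  rfl

theorem exists_norm_val_le : ∃ C, 0 ≤ C ∧ ∀ x : L.EnergySpace, ‖val x‖ ≤ C * ‖x‖ := by
  obtain ⟨c, hc, hpos⟩ := L.posDef
  refine ⟨√(1 / c), Real.sqrt_nonneg _, fun x => ?_⟩
  have h1 := hpos (toDomain x)
  refine le_of_sq_le_sq ?_ (by positivity)
  rw [mul_pow, Real.sq_sqrt (by positivity), norm_sq]
  have h2 : c * ‖val x‖ ^ 2 ≤ L.form (toDomain x) := h1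
  rw [one_div, inv_mul_eq_div, le_div_iff₀ hc]
  linarith

/-- The inclusion into `L_2(0, 1)` as a bounded operator. -/
def inclusion : L.EnergySpace →L[ℂ] H :=
  val.mkContinuousOfExistsBound (exists_norm_val_le.imp fun _ h => h.2)

end EnergySpace

end SelfAdjointRealization

end DegenerateString

end

/-! ### The weak equation and the a priori estimate -/

noncomputable section

namespace DegenerateString

theorem integrable_mul_of_continuous {f b : ℝ → ℂ} (hf : Integrable f unitMeasure) (hb : Continuous b) :
    Integrable (fun t => f t * b t) unitMeasure := by
  obtain ⟨C, hC⟩ := (isCompact_Icc (a := (0 : ℝ)) (b := 1)).exists_bound_of_continuousOn hb.continuousOn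
  refine hf.mul_bdd (c := C) hb.aestronglyMeasurable ?_
  filter_upwards [ae_restrict_mem measurableSet_Ioo] with t ht
  exact hC t (Ioo_subset_Icc_self ht)

theorem inner_eq_integral (f g : H) : inner ℂ f g = ∫ t, g t * conj (f t) ∂unitMeasure := by
  rw [L2.inner_def]
  rfl

theorem norm_sq_eq_integral {ν : Measure ℝ} (f : Lp ℂ 2 ν) : ‖f‖ ^ 2 = ∫ t, ‖f t‖ ^ 2 ∂ν := by
  have h : inner ℂ f f = ∫ t, ((‖f t‖ ^ 2 : ℝ) : ℂ) ∂ν := by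
    rw [L2.inner_def]
    simp
  rw [← inner_self_eq_norm_sq (𝕜 := ℂ), h, integral_complex_ofReal]
  rfl

namespace JetSpace

variable {ℓ : ℕ}

/-- The derivative of order `i ≤ ℓ`. -/
def der (w : JetSpace ℓ) (i : ℕ) : ℝ → ℂ := chain w (ℓ - i)

theorem der_self (w : JetSpace ℓ) : der w ℓ = w.2 := by
  unfold der
  rw [Nat.sub_self]
  rfl

theorem der_eq_chain (w : JetSpace ℓ) {i : ℕ} (hi : i < ℓ) : der w i = chain w (ℓ - 1 - i + 1) := by
  unfold der
  rw [show ℓ - i = ℓ - 1 - i + 1 by omega]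

theorem continuous_der (w : JetSpace ℓ) {i : ℕ} (hi : i < ℓ) : Continuous (der w i) := by
  rw [der_eq_chain w hi]
  exact continuous_chain w _

theorem memLp_der (w : JetSpace ℓ) (i : ℕ) : MemLp (der w i) 2 unitMeasure := memLp_chain w _

theorem isZeroChain_conj_der (w : JetSpace ℓ) (h0 : ∀ k < ℓ, chain w (k + 1) 0 = 0)
    (h1 : ∀ k < ℓ, chain w (k + 1) 1 = 0) : IsZeroChain ℓ fun i t => conj (der w i t) := by
  refine ⟨fun i hi => ?_, fun i hi t _ => ?_, fun i hi => ?_⟩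
  · exact (LinearIsometryEquiv.integrable_comp_iff (Complex.conjLIE : ℂ ≃ₗᵢ[ℝ] ℂ)).2
      (integrable_chain w (ℓ - (i + 1)))
  · have h2 := chain_sub w (ℓ - 1 - i) 0 t
    rw [h0 _ (by omega), sub_zero] at h2
    rw [der_eq_chain w hi, h2]
    simp only [der]
    rw [show ℓ - (i + 1) = ℓ - 1 - i by omega]
    simp only [intervalIntegral, map_sub, integral_conj]
  · simp only [der_eq_chain w hi]
    rw [h1 _ (by omega), map_zero]

/-- The Dirichlet form of the differential expression, as a sum over orders. -/
theorem sum_integral_coefficient_mul (P : Fin ℓ → ℝ → ℝ) (w : JetSpace ℓ) (g : H) (u : ℕ → ℝ → ℂ)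
    (h1 : Integrable (fun t => der w ℓ t * u ℓ t) unitMeasure)
    (h2 : ∀ i : Fin ℓ, Integrable (fun t => (-1) ^ (i : ℕ) * (P i t : ℂ) * der w i t * u i t) unitMeasure)
    (h3 : Integrable (fun t => g t * u 0 t) unitMeasure) :
    let F : ℕ → ℝ → ℂ := fun i t => (if i = ℓ then der w ℓ t else 0) +
      (if h : i < ℓ then (-1) ^ i * (P ⟨i, h⟩ t : ℂ) * der w i t else 0) - (if i = 0 then g t else 0)
    (∀ i ≤ ℓ, Integrable (fun t => F i t * u i t) unitMeasure) ∧
    ∑ i ∈ Finset.range (ℓ + 1), ∫ t, F i t * u i t ∂unitMeasure =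
      ∫ t, (der w ℓ t * u ℓ t + ∑ i : Fin ℓ, (-1) ^ (i : ℕ) * (P i t : ℂ) * der w i t * u i t)
        ∂unitMeasure - ∫ t, g t * u 0 t ∂unitMeasure := by
  intro F
  have hint : ∀ i ≤ ℓ, Integrable (fun t => F i t * u i t) unitMeasure := fun i _ => by
    have e : (fun t => F i t * u i t) = fun t => (if i = ℓ then der w ℓ t * u ℓ t else 0) +
        (if h : i < ℓ then (-1) ^ i * (P ⟨i, h⟩ t : ℂ) * der w i t * u i t else 0) -
        (if i = 0 then g t * u 0 t else 0) := by
      ext t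
      simp only [F, sub_mul, add_mul]
      congr 1
      · congr 1
        · by_cases h : i = ℓ
          · subst h; simp
          · simp [h]
        · split_ifs <;> simp
      · by_cases h : i = 0
        · subst h; simp
        · simp [h]
    rw [e]
    refine (Integrable.add ?_ ?_).sub ?_
    · split_ifs
      exacts [h1, integrable_zero _ _ _]
    · split_ifs with h
      exacts [h2 ⟨i, h⟩, integrable_zero _ _ _]
    · split_ifs
      exacts [h3, integrable_zero _ _ _]
  refine ⟨hint, ?_⟩
  have h12 : Integrable (fun t => der w ℓ t * u ℓ t +
      ∑ i : Fin ℓ, (-1) ^ (i : ℕ) * (P i t : ℂ) * der w i t * u i t) unitMeasure :=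
    h1.add (integrable_finsetSum _ fun i _ => h2 i)
  rw [← integral_finsetSum _ fun i hi => hint i (by simpa [Nat.lt_succ_iff] using hi),
    ← integral_sub h12 h3]
  congr 1
  ext t
  simp only [F, sub_mul, add_mul, Finset.sum_sub_distrib, Finset.sum_add_distrib, ite_mul, zero_mul,
    Finset.sum_ite_eq', Finset.mem_range, Nat.lt_succ_self, if_true, Nat.succ_pos]
  congr 2
  rw [Finset.sum_range_succ, dif_neg (lt_irrefl ℓ), zero_mul, add_zero, Finset.sum_range]
  exact Finset.sum_congr rfl fun i _ => by rw [dif_pos i.2]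

/-- The differential equation `L w = g` in the sense of distributions. -/
def WeakEq (P : Fin ℓ → ℝ → ℝ) (w : JetSpace ℓ) (g : H) : Prop :=
  ∀ φ : ℝ → ℝ, IsTestFunction φ →
    ∫ t, (der w ℓ t * ((iteratedDeriv ℓ φ t : ℝ) : ℂ) + ∑ i : Fin ℓ, (-1) ^ (i : ℕ) * (P i t : ℂ) *
      der w i t * ((iteratedDeriv i φ t : ℝ) : ℂ)) ∂unitMeasure = ∫ t, g t * (φ t : ℂ) ∂unitMeasure

theorem integrable_coefficient_mul {P : Fin ℓ → ℝ → ℝ} (hP : ∀ i, IntegrableOn (P i) (Ioo 0 1))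
    (w : JetSpace ℓ) (i : Fin ℓ) {b : ℝ → ℂ} (hb : Continuous b) :
    Integrable (fun t => (-1) ^ (i : ℕ) * (P i t : ℂ) * der w i t * b t) unitMeasure := by
  have h : Integrable (fun t => (-1) ^ (i : ℕ) * (P i t : ℂ)) unitMeasure :=
    (Integrable.ofReal (hP i)).const_mul _
  exact integrable_mul_of_continuous (integrable_mul_of_continuous h (continuous_der w i.2)) hb

/-- The weak equation can be tested with all functions of Sobolev class that vanish at the end-points
together with their derivatives of order less than `ℓ`. -/
theorem WeakEq.integral_eq {P : Fin ℓ → ℝ → ℝ} (hP : ∀ i, IntegrableOn (P i) (Ioo 0 1))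
    {w v : JetSpace ℓ} {g : H} (hw : WeakEq P w g) (h0 : ∀ k < ℓ, chain v (k + 1) 0 = 0)
    (h1 : ∀ k < ℓ, chain v (k + 1) 1 = 0) :
    ∫ t, (der w ℓ t * conj (der v ℓ t) + ∑ i : Fin ℓ, (-1) ^ (i : ℕ) * (P i t : ℂ) *
      der w i t * conj (der v i t)) ∂unitMeasure = ∫ t, g t * conj (der v 0 t) ∂unitMeasure := by
  have hconj : ∀ i, MemLp (fun t => conj (der v i t)) 2 unitMeasure := fun i => (memLp_der v i).star
  have hg : MemLp g 2 unitMeasure := Lp.memLp g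
  obtain ⟨hint, hsum⟩ := sum_integral_coefficient_mul P w g (fun i t => conj (der v i t))
    ((memLp_der w ℓ).integrable_mul (hconj ℓ))
    (fun i => integrable_coefficient_mul hP w i (Complex.continuous_conj.comp (continuous_der v i.2)))
    (hg.integrable_mul (hconj 0))
  rw [← sub_eq_zero, ← hsum]
  -- Sorted by the order of the derivative falling on the test function, the equation says that a
  -- distribution with integrable coefficients vanishes on test functions.
  refine sum_integral_mul_eq_zero ℓ _ _ (fun i _ => ?_) (isZeroChain_conj_der v h0 h1) hint
    fun φ hφ => ?_
  · refine (Integrable.add ?_ ?_).sub ?_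
    · split_ifs
      exacts [(memLp_der w ℓ).integrable (by norm_num), integrable_zero _ _ _]
    · split_ifs with h
      · simpa using integrable_coefficient_mul hP w ⟨i, h⟩ (b := fun _ => 1) continuous_const
      · exact integrable_zero _ _ _
    · split_ifs
      exacts [hg.integrable (by norm_num), integrable_zero _ _ _]
  · have hφi : ∀ i, Continuous fun t => ((iteratedDeriv i φ t : ℝ) : ℂ) := fun i =>
      Complex.continuous_ofReal.comp ((hφ.contDiff.of_le (by exact_mod_cast le_top) :
        ContDiff ℝ i φ).continuous_iteratedDeriv i le_rfl)
    obtain ⟨-, hsum'⟩ := sum_integral_coefficient_mul P w g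
      (fun i t => ((iteratedDeriv i φ t : ℝ) : ℂ))
      (integrable_mul_of_continuous ((memLp_der w ℓ).integrable (by norm_num)) (hφi ℓ))
      (fun i => integrable_coefficient_mul hP w i (hφi i))
      (integrable_mul_of_continuous (hg.integrable (by norm_num)) (hφi 0))
    rw [hsum', sub_eq_zero]
    simpa only [iteratedDeriv_zero] using hw φ hφ

end JetSpace

namespace SelfAdjointRealization

open JetSpace

variable {ℓ : ℕ} {P : Fin ℓ → ℝ → ℝ} {L : SelfAdjointRealization ℓ P}

namespace EnergySpace

theorem exists_jet (u : L.EnergySpace) : ∃ w : JetSpace ℓ, toL2 w = val u ∧ WeakEq P w (op u) := by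
  obtain ⟨D, hD, hD0, hφ⟩ := L.satisfiesODE (toDomain u)
  obtain ⟨w, hw1, hw2⟩ := exists_of_isSobolevChain hD
  have hder : ∀ i ≤ ℓ, der w i =ᵐ[unitMeasure] D i := fun i hi => by
    rcases hi.eq_or_lt with rfl | hi
    · rw [der_self]
      exact hw1
    · rw [der_eq_chain w hi]
      refine (ae_restrict_iff' measurableSet_Ioo).2 (Eventually.of_forall fun t ht => ?_)
      rw [hw2 _ (by omega) t (Ioo_subset_Icc_self ht), show ℓ - 1 - (ℓ - 1 - i) = i by omega]
  refine ⟨w, Lp.ext ((coeFn_toL2 w).trans ((hder 0 (Nat.zero_le _)).trans hD0)), fun φ hφ' => ?_⟩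
  refine Eq.trans (integral_congr_ae ?_) (hφ φ hφ')
  filter_upwards [hder ℓ le_rfl, ae_all_iff.2 fun i : Fin ℓ => hder i i.2.le] with t h1 h2
  simp only [h1, h2]

variable (L) in
/-- The jet of an element of the domain of `L`. -/
def toJet : L.EnergySpace →ₗ[ℂ] JetSpace ℓ where
  toFun u := (exists_jet u).choose
  -- The jets are chosen independently of each other; uniqueness makes the choice additive and
  -- homogeneous.
  map_add' u v := toL2_injective <| (exists_jet (u + v)).choose_spec.1.trans <|
    (map_add val u v).trans <| (congrArg₂ (· + ·) (exists_jet u).choose_spec.1.symm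
      (exists_jet v).choose_spec.1.symm).trans (map_add toL2 _ _).symm
  map_smul' c u := toL2_injective <| (exists_jet (c • u)).choose_spec.1.trans <|
    (map_smul val c u).trans <| (congrArg (c • ·) (exists_jet u).choose_spec.1.symm).trans
      (map_smul toL2 c _).symm

theorem toL2_toJet (u : L.EnergySpace) : toL2 (toJet L u) = val u := (exists_jet u).choose_spec.1

theorem weakEq_toJet (u : L.EnergySpace) : WeakEq P (toJet L u) (op u) :=
  (exists_jet u).choose_spec.2

/-- Vanishing at both ends lets `u` test its own equation. The energy is then `‖u^(ℓ)‖²` plus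
lower-order terms, each at most the `L_1` norm of a coefficient times the sup bound `M`. The
boundary conditions of `L` play no part. -/
theorem re_inner_op_ge (hP : ∀ i, IntegrableOn (P i) (Ioo 0 1)) (u : L.EnergySpace) {M : ℝ}
    (h0 : ∀ k < ℓ, chain (toJet L u) (k + 1) 0 = 0) (h1 : ∀ k < ℓ, chain (toJet L u) (k + 1) 1 = 0)
    (hM : ∀ k < ℓ, ∀ t ∈ Ioo (0 : ℝ) 1, ‖chain (toJet L u) (k + 1) t‖ ^ 2 ≤ M) :
    ‖(toJet L u).2‖ ^ 2 - (∑ i, ∫ t, |P i t| ∂unitMeasure) * M ≤ ‖u‖ ^ 2 := by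
  set w := toJet L u with hw
  have h := (weakEq_toJet u).integral_eq hP h0 h1
  rw [← hw] at h
  have hint : ∀ i : Fin ℓ, Integrable (fun t => (-1) ^ (i : ℕ) * (P i t : ℂ) *
      der w i t * conj (der w i t)) unitMeasure := fun i =>
    integrable_coefficient_mul hP w i (Complex.continuous_conj.comp (continuous_der w i.2))
  have e1 : ∫ t, op u t * conj (der w 0 t) ∂unitMeasure = inner ℂ (val u) (op u) := by
    rw [inner_eq_integral]
    refine integral_congr_ae ?_
    have h2 := coeFn_toL2 w
    rw [hw, toL2_toJet] at h2
    filter_upwards [h2] with t ht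
    rw [ht]
    rfl
  have e2 : ∫ t, der w ℓ t * conj (der w ℓ t) ∂unitMeasure = ((‖w.2‖ ^ 2 : ℝ) : ℂ) := by
    rw [der_self, ← inner_eq_integral, inner_self_eq_norm_sq_to_K]
    simp
  have hI : Integrable (fun t => der w ℓ t * conj (der w ℓ t)) unitMeasure :=
    (memLp_der w ℓ).integrable_mul (memLp_der w ℓ).star
  rw [integral_add hI (integrable_finsetSum _ fun i _ => hint i),
    integral_finsetSum _ fun i _ => hint i] at h
  have h' : ((‖w.2‖ ^ 2 : ℝ) : ℂ) + ∑ i : Fin ℓ, ∫ t, (-1) ^ (i : ℕ) * (P i t : ℂ) *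
      der w i t * conj (der w i t) ∂unitMeasure = inner ℂ (val u) (op u) := by
    rw [← e1, ← e2]
    exact h
  have h3 : ‖u‖ ^ 2 = (inner ℂ (val u) (op u)).re := by
    rw [← inner_self_eq_norm_sq (𝕜 := ℂ), inner_def, inner_op_val]
    rfl
  have h4 : ∀ i : Fin ℓ, ‖∫ t, (-1) ^ (i : ℕ) * (P i t : ℂ) * der w i t * conj (der w i t) ∂unitMeasure‖
      ≤ (∫ t, |P i t| ∂unitMeasure) * M := fun i => by
    rw [← integral_mul_const]
    refine norm_integral_le_of_norm_le ((hP i).abs.mul_const M) ?_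
    filter_upwards [ae_restrict_mem measurableSet_Ioo] with t ht
    have h5 := hM (ℓ - 1 - i) (by omega) t ht
    rw [← der_eq_chain w i.2] at h5
    rw [norm_mul, norm_mul, norm_mul, norm_pow, norm_neg, norm_one, one_pow, one_mul,
      Complex.norm_real, Real.norm_eq_abs, RCLike.norm_conj, mul_assoc, ← sq]
    gcongr
  have h6 := congrArg Complex.re h'
  rw [Complex.add_re, Complex.ofReal_re, ← h3] at h6
  have h7 : -((∑ i, ∫ t, |P i t| ∂unitMeasure) * M) ≤ (∑ i : Fin ℓ, ∫ t, (-1) ^ (i : ℕ) *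
      (P i t : ℂ) * der w i t * conj (der w i t) ∂unitMeasure).re := by
    refine (neg_le_neg ?_).trans (neg_le_of_abs_le (Complex.abs_re_le_norm _))
    rw [Finset.sum_mul]
    exact (norm_sum_le _ _).trans (Finset.sum_le_sum fun i _ => h4 i)
  linarith

/-- On a grid of step `r` where all derivatives of order below `ℓ` vanish, they are at most `√r
‖u^(ℓ)‖` everywhere. With `S r ≤ 1/2` the lower-order terms take at most half of `‖u^(ℓ)‖²`, whence
the constant `√2`. The grid conditions are finitely many continuous functionals of the jet, so the
bound extends to the whole domain. -/
theorem exists_norm_toJet_le (hP : ∀ i, IntegrableOn (P i) (Ioo 0 1)) :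
    ∃ C, 0 ≤ C ∧ ∀ u, ‖toJet L u‖ ≤ C * ‖u‖ := by
  set S := ∑ i, ∫ t, |P i t| ∂unitMeasure with hS
  have hS0 : 0 ≤ S := Finset.sum_nonneg fun i _ => integral_nonneg fun t => abs_nonneg _
  obtain ⟨N, hN⟩ := exists_nat_ge (2 * S)
  -- The step is the reciprocal of an integer so that the `N + 2` grid points include both `0` and
  -- `1`.
  set r : ℝ := 1 / (N + 1) with hr
  have hr0 : 0 < r := by positivity
  have hr1 : r ≤ 1 := by rw [hr, div_le_one (by positivity)]; linarith [N.cast_nonneg (α := ℝ)]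
  have hSr : S * r ≤ 1 / 2 := by
    rw [hr, mul_one_div, div_le_iff₀ (by positivity)]
    linarith
  let B : JetSpace ℓ →L[ℂ] (Fin ℓ × Fin (N + 2) → ℂ) :=
    ContinuousLinearMap.pi fun x => eval x.1 ((x.2 : ℕ) * r)
  refine exists_bound_of_bound_on_ker (toJet L) toL2 toL2_injective inclusion
    (fun u => toL2_toJet u) B (C := √2) (by positivity) fun u hu => ?_
  set w := toJet L u with hw
  have hB : ∀ k < ℓ, ∀ j < N + 2, chain w (k + 1) (j * r) = 0 := fun k hk j hj =>
    congrFun hu (⟨k, hk⟩, ⟨j, hj⟩)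
  have h0 : ∀ k < ℓ, chain w (k + 1) 0 = 0 := fun k hk => by simpa using hB k hk 0 (by omega)
  have h1 : ∀ k < ℓ, chain w (k + 1) 1 = 0 := fun k hk => by
    have h2 := hB k hk (N + 1) (by omega)
    have h3 : ((N + 1 : ℕ) : ℝ) * r = 1 := by rw [hr]; push_cast; field_simp
    rwa [h3] at h2
  have hM : ∀ k < ℓ, ∀ t ∈ Ioo (0 : ℝ) 1, ‖chain w (k + 1) t‖ ^ 2 ≤ r * ‖w.2‖ ^ 2 := by
    intro k hk t ht
    have h3 : ⌊t / r⌋₊ < N + 2 := by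
      have h4 : (⌊t / r⌋₊ : ℝ) ≤ t / r := Nat.floor_le (div_nonneg ht.1.le hr0.le)
      have h5 : t / r < N + 2 := by
        rw [hr, div_div_eq_mul_div, div_one]
        nlinarith [ht.2, N.cast_nonneg (α := ℝ)]
      exact_mod_cast h4.trans_lt h5
    have h6 : |t - ⌊t / r⌋₊ * r| ≤ r := by
      have h4 : (⌊t / r⌋₊ : ℝ) * r ≤ t :=
        (le_div_iff₀ hr0).1 (Nat.floor_le (div_nonneg ht.1.le hr0.le))
      have h5 : t < (⌊t / r⌋₊ + 1) * r := (div_lt_iff₀ hr0).1 (Nat.lt_floor_add_one _)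
      rw [abs_of_nonneg (by linarith)]
      linarith
    have h7 := norm_chain_le_of_eq_zero w (K := ℓ) hr0.le (fun k hk => hB k hk _ h3) k hk t h6
    have h8 : ‖chain w (k + 1) t‖ ≤ √r * ‖w.2‖ :=
      h7.trans (mul_le_of_le_one_left (by positivity) (pow_le_one₀ hr0.le hr1))
    calc ‖chain w (k + 1) t‖ ^ 2 ≤ (√r * ‖w.2‖) ^ 2 := by gcongr
      _ = r * ‖w.2‖ ^ 2 := by rw [mul_pow, Real.sq_sqrt hr0.le]
  have h9 := re_inner_op_ge hP u h0 h1 hM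
  rw [← hw, ← hS] at h9
  have h10 : ‖w‖ = ‖w.2‖ := by
    have : w.1 = 0 := funext fun k => by
      have := h0 k k.2
      rw [chain_zero_right] at this
      simpa [coef] using this
    rw [Prod.norm_def, this, norm_zero]
    exact max_eq_right (norm_nonneg _)
  rw [h10]
  refine le_of_sq_le_sq ?_ (by positivity)
  rw [mul_pow, Real.sq_sqrt (by norm_num)]
  have h11 : S * (r * ‖w.2‖ ^ 2) ≤ 1 / 2 * ‖w.2‖ ^ 2 := by
    rw [← mul_assoc]
    gcongr
  linarith

end EnergySpace

end SelfAdjointRealization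

end DegenerateString

end

/-! ### The completed energy space as a space of functions -/

noncomputable section

namespace DegenerateString

namespace SelfAdjointRealization

variable {ℓ : ℕ} {P : Fin ℓ → ℝ → ℝ}

/-- The energy space, completed. -/
abbrev EnergyCompletion (L : SelfAdjointRealization ℓ P) : Type :=
  UniformSpace.Completion L.EnergySpace

namespace EnergyCompletion

open JetSpace EnergySpace UniformSpace

variable {L : SelfAdjointRealization ℓ P}

variable (L) in
/-- The jet of an element of the completed energy space. -/
def jet : L.EnergyCompletion →L[ℂ] JetSpace ℓ :=
  (toJet L).extendOfNorm (Completion.toComplL (𝕜 := ℂ) (E := L.EnergySpace)).toLinearMap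

theorem jet_coe (hP : ∀ i, IntegrableOn (P i) (Ioo 0 1)) (u : L.EnergySpace) :
    jet L (u : L.EnergyCompletion) = toJet L u := by
  obtain ⟨C, -, hC⟩ := exists_norm_toJet_le (L := L) hP
  refine LinearMap.extendOfNorm_eq (f := toJet L)
    (e := (Completion.toComplL (𝕜 := ℂ) (E := L.EnergySpace)).toLinearMap)
    Completion.denseRange_coe ⟨C, fun x => ?_⟩ u
  exact (hC x).trans_eq (congrArg (C * ·) (Completion.norm_coe x).symm)

theorem toL2_jet_coe (hP : ∀ i, IntegrableOn (P i) (Ioo 0 1)) (u : L.EnergySpace) :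
    toL2 (jet L (u : L.EnergyCompletion)) = val u := by
  rw [jet_coe hP, toL2_toJet]

theorem inner_coe_left (hP : ∀ i, IntegrableOn (P i) (Ioo 0 1)) (u : L.EnergySpace)
    (v : L.EnergyCompletion) :
    inner ℂ (u : L.EnergyCompletion) v = inner ℂ (op u) (toL2 (jet L v)) := by
  induction v using Completion.induction_on with
  | hp => exact isClosed_eq (by fun_prop) (by fun_prop)
  | ih v => rw [Completion.inner_coe, toL2_jet_coe hP, inner_def]

theorem eq_zero_of_inner_coe {v : L.EnergyCompletion}
    (h : ∀ u : L.EnergySpace, inner ℂ (u : L.EnergyCompletion) v = 0) : v = 0 := by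
  have h1 : ∀ w : L.EnergyCompletion, inner ℂ w v = 0 := fun w => by
    induction w using Completion.induction_on with
    | hp => exact isClosed_eq (by fun_prop) (by fun_prop)
    | ih u => exact h u
  exact inner_self_eq_zero.1 (h1 v)

/-- Closability of the form: an element of the completion with zero function is orthogonal to the
dense image of the domain, by `inner_coe_left`. -/
theorem toL2_jet_injective (hP : ∀ i, IntegrableOn (P i) (Ioo 0 1)) :
    Function.Injective fun v : L.EnergyCompletion => toL2 (jet L v) := by
  refine (injective_iff_map_eq_zero (toL2.comp (jet L))).2 fun v hv => ?_
  refine eq_zero_of_inner_coe fun u => ?_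
  have : toL2 (jet L v) = 0 := hv
  rw [inner_coe_left hP, this, inner_zero_right]

/-- Cauchy for the form means Cauchy in the energy norm. Together with `exists_toL2_jet_eq` this
identifies the completion with the form domain. -/
theorem toL2_jet_mem_formDomain (hP : ∀ i, IntegrableOn (P i) (Ioo 0 1)) (v : L.EnergyCompletion) :
    toL2 (jet L v) ∈ L.formDomain := by
  obtain ⟨s, hs, hsv⟩ := mem_closure_iff_seq_limit.1 (Completion.denseRange_coe v)
  choose u hu using hs
  refine ⟨fun k => toDomain (u k), ?_, fun ε hε => ?_⟩
  · have h1 := ((toL2.comp (jet L)).continuous.tendsto v).comp hsv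
    refine h1.congr fun k => ?_
    change toL2 (jet L (s k)) = _
    rw [← hu, toL2_jet_coe hP]
    rfl
  · obtain ⟨N, hN⟩ := Metric.cauchySeq_iff.1 hsv.cauchySeq (√ε) (Real.sqrt_pos.2 hε)
    refine ⟨N, fun j hj k hk => ?_⟩
    have h2 := hN j hj k hk
    rw [← hu, ← hu, Completion.dist_eq, dist_eq_norm] at h2
    rw [← map_sub, ← norm_sq]
    exact (Real.lt_sqrt (norm_nonneg _)).1 h2

theorem exists_toL2_jet_eq (hP : ∀ i, IntegrableOn (P i) (Ioo 0 1)) {h : H} (hh : h ∈ L.formDomain) :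
    ∃ v, toL2 (jet L v) = h := by
  obtain ⟨s, hs, hs'⟩ := hh
  have hc : CauchySeq fun k => ((toDomain.symm (s k) : L.EnergySpace) : L.EnergyCompletion) := by
    rw [Metric.cauchySeq_iff]
    intro ε hε
    obtain ⟨N, hN⟩ := hs' (ε ^ 2) (by positivity)
    refine ⟨N, fun j hj k hk => ?_⟩
    rw [Completion.dist_eq, dist_eq_norm]
    refine lt_of_pow_lt_pow_left₀ 2 hε.le ?_
    rw [norm_sq, map_sub, LinearEquiv.apply_symm_apply, LinearEquiv.apply_symm_apply]
    exact hN j hj k hk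
  obtain ⟨v, hv⟩ := cauchySeq_tendsto_of_complete hc
  refine ⟨v, tendsto_nhds_unique (((toL2.comp (jet L)).continuous.tendsto v).comp hv) ?_⟩
  refine hs.congr fun k => ?_
  change _ = toL2 (jet L _)
  rw [toL2_jet_coe hP]
  rfl

end EnergyCompletion

end SelfAdjointRealization

end DegenerateString

end

/-! ### The operator of the eigenvalue problem -/

noncomputable section

namespace DegenerateString

namespace JetSpace

variable {ℓ : ℕ}

theorem memLp_chain_succ (w : JetSpace ℓ) (k : ℕ) (ν : Measure ℝ) [IsFiniteMeasure ν] :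
    MemLp (chain w (k + 1)) 2 ν :=
  MemLp.of_bound (continuous_chain w k).aestronglyMeasurable _ (Eventually.of_forall (norm_chain_le w k))

/-- The derivative of order `ℓ - 1 - k`, as an element of `L_2(ν)`. -/
def toLp (k : ℕ) (ν : Measure ℝ) [IsFiniteMeasure ν] : JetSpace ℓ →L[ℂ] Lp ℂ 2 ν :=
  LinearMap.mkContinuous
    { toFun := fun w => (memLp_chain_succ w k ν).toLp _
      map_add' := fun v w => by
        rw [← MemLp.toLp_add]
        exact MemLp.toLp_congr _ _ (Eventually.of_forall (chain_add v w k))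
      map_smul' := fun c w => by
        rw [RingHom.id_apply, ← MemLp.toLp_const_smul]
        exact MemLp.toLp_congr _ _ (Eventually.of_forall (chain_smul c w k)) }
    (measureUnivNNReal ν ^ (ENNReal.toReal 2)⁻¹ * (k + 2)) fun w => by
    rw [mul_assoc]
    refine Lp.norm_le_of_ae_bound (by positivity) ?_
    filter_upwards [(memLp_chain_succ w k ν).coeFn_toLp] with t ht
    change ‖((memLp_chain_succ w k ν).toLp _ : ℝ → ℂ) t‖ ≤ _
    rw [ht]
    exact norm_chain_le w k t

theorem coeFn_toLp (k : ℕ) (ν : Measure ℝ) [IsFiniteMeasure ν] (w : JetSpace ℓ) :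
    toLp k ν w =ᵐ[ν] chain w (k + 1) := (memLp_chain_succ w k ν).coeFn_toLp

theorem inner_toLp (k : ℕ) (ν : Measure ℝ) [IsFiniteMeasure ν] (v w : JetSpace ℓ) :
    inner ℂ (toLp k ν v) (toLp k ν w) = ∫ t, chain w (k + 1) t * conj (chain v (k + 1) t) ∂ν := by
  rw [L2.inner_def]
  refine integral_congr_ae ?_
  filter_upwards [coeFn_toLp k ν v, coeFn_toLp k ν w] with t h1 h2
  rw [h1, h2]
  rfl

theorem norm_sq_toLp (k : ℕ) (ν : Measure ℝ) [IsFiniteMeasure ν] (w : JetSpace ℓ) :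
    ‖toLp k ν w‖ ^ 2 = ∫ t, ‖chain w (k + 1) t‖ ^ 2 ∂ν := by
  rw [norm_sq_eq_integral]
  refine integral_congr_ae ?_
  filter_upwards [coeFn_toLp k ν w] with t ht
  rw [ht]

end JetSpace

namespace SelfAdjointRealization

namespace EnergyCompletion

open JetSpace EnergySpace UniformSpace

variable {k : ℕ} {P : Fin (k + 1) → ℝ → ℝ} {L : SelfAdjointRealization (k + 1) P}

variable (L) in
/-- The embedding of the energy space into `L_2(μ)`. -/
def embedding (μ : Measure ℝ) [IsFiniteMeasure μ] :
    L.EnergyCompletion →L[ℂ] Lp ℂ 2 (μ.restrict (Icc 0 1)) :=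
  (toLp k (μ.restrict (Icc 0 1))).comp (jet L)

variable (L) in
/-- The operator of the eigenvalue problem on the energy space. -/
def stringOperator (μ : Measure ℝ) [IsFiniteMeasure μ] : L.EnergyCompletion →L[ℂ] L.EnergyCompletion :=
  (ContinuousLinearMap.adjoint (embedding L μ)).comp (embedding L μ)

variable (μ : Measure ℝ) [IsFiniteMeasure μ]

theorem inner_stringOperator_right (u v : L.EnergyCompletion) : inner ℂ u (stringOperator L μ v) =
    ∫ t in Icc 0 1, chain (jet L v) (k + 1) t * conj (chain (jet L u) (k + 1) t) ∂μ := by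
  rw [stringOperator, ContinuousLinearMap.comp_apply, ContinuousLinearMap.adjoint_inner_right]
  exact inner_toLp k _ _ _

theorem isPositive_stringOperator : (stringOperator L μ).IsPositive :=
  ContinuousLinearMap.isPositive_adjoint_comp_self _

theorem re_inner_stringOperator_self (v : L.EnergyCompletion) :
    (inner ℂ (stringOperator L μ v) v).re = ∫ t in Icc 0 1, ‖chain (jet L v) (k + 1) t‖ ^ 2 ∂μ := by
  rw [stringOperator, ContinuousLinearMap.comp_apply, ContinuousLinearMap.adjoint_inner_left,
    ← norm_sq_toLp]
  exact inner_self_eq_norm_sq (𝕜 := ℂ) _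

theorem isCompactOperator_stringOperator (h : IsCompactOperator (embedding L μ)) :
    IsCompactOperator (stringOperator L μ) :=
  h.clm_comp (ContinuousLinearMap.adjoint (embedding L μ))

/-- Both sides are the same identity tested on the dense domain of `L`. Order `k + 1 ≥ 1` provides
the continuous representatives, and these are unique on all of `[0,1]`, which matters because `μ` is
carried by atoms. -/
theorem toL2_jet_mem_eigenspace_iff (hP : ∀ i, IntegrableOn (P i) (Ioo 0 1)) (ν : ℝ)
    (u : L.EnergyCompletion) :
    toL2 (jet L u) ∈ L.eigenspace μ ν ↔ stringOperator L μ u = (ν : ℂ) • u := by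
  have hv : ∀ v : L.EnergySpace, inner ℂ (v : L.EnergyCompletion) (stringOperator L μ u) =
      ∫ t in Icc 0 1, chain (jet L u) (k + 1) t * conj (chain (toJet L v) (k + 1) t) ∂μ := fun v => by
    rw [inner_stringOperator_right, jet_coe hP]
  constructor
  · rintro ⟨-, y, hyc, hy, h⟩
    have hyu : EqOn y (chain (jet L u) (k + 1)) (Icc 0 1) :=
      eqOn_Icc_of_ae_eq (hy.trans (coeFn_toL2 _)) hyc (continuous_chain _ k).continuousOn
    rw [← sub_eq_zero]
    refine eq_zero_of_inner_coe fun v => ?_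
    have h1 := h (toDomain v) (chain (toJet L v) (k + 1)) (continuous_chain _ k).continuousOn (by
      have := coeFn_toL2 (toJet L v)
      rw [toL2_toJet] at this
      exact this.symm)
    rw [inner_sub_right, inner_smul_right, hv, inner_coe_left hP, sub_eq_zero]
    refine Eq.trans ?_ h1.symm
    exact setIntegral_congr_fun measurableSet_Icc fun t ht => by simp only [hyu ht]
  · intro hu
    refine ⟨toL2_jet_mem_formDomain hP u, chain (jet L u) (k + 1), (continuous_chain _ k).continuousOn,
      (coeFn_toL2 _).symm, fun v z hzc hz => ?_⟩
    set v' : L.EnergySpace := toDomain.symm v with hv'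
    have h2 := coeFn_toL2 (toJet L v')
    rw [toL2_toJet] at h2
    have hzv : EqOn (chain (toJet L v') (k + 1)) z (Icc 0 1) :=
      eqOn_Icc_of_ae_eq (h2.symm.trans hz.symm) (continuous_chain _ k).continuousOn hzc
    have h1 := hv v'
    rw [hu, inner_smul_right, inner_coe_left hP] at h1
    refine Eq.trans h1 ?_
    exact setIntegral_congr_fun measurableSet_Icc fun t ht => by simp only [hzv ht]

theorem rank_eigenspace (hP : ∀ i, IntegrableOn (P i) (Ioo 0 1)) (ν : ℝ) :
    Module.rank ℂ (Module.End.eigenspace (stringOperator L μ : Module.End ℂ L.EnergyCompletion) (ν : ℂ)) =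
      Module.rank ℂ (L.eigenspace μ ν) := by
  set S := Module.End.eigenspace (stringOperator L μ : Module.End ℂ L.EnergyCompletion) (ν : ℂ)
  have hS : S.map (toL2.comp (jet L)).toLinearMap = L.eigenspace μ ν := by
    ext h
    constructor
    · rintro ⟨u, hu, rfl⟩
      exact (toL2_jet_mem_eigenspace_iff μ hP ν u).2 (Module.End.mem_eigenspace_iff.1 hu)
    · intro hh
      obtain ⟨u, rfl⟩ := exists_toL2_jet_eq hP hh.1
      exact ⟨u, Module.End.mem_eigenspace_iff.2 ((toL2_jet_mem_eigenspace_iff μ hP ν u).1 hh), rfl⟩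
  rw [← hS]
  exact (Submodule.equivMapOfInjective (toL2.comp (jet L)).toLinearMap
    (toL2_jet_injective hP) S).rank_eq

end EnergyCompletion

end SelfAdjointRealization

end DegenerateString

end

/-! ### Upper bounds for the eigenvalues -/

noncomputable section

namespace DegenerateString

namespace SelfAdjointRealization

namespace EnergyCompletion

open JetSpace EnergySpace UniformSpace

variable {k : ℕ} {P : Fin (k + 1) → ℝ → ℝ} (L : SelfAdjointRealization (k + 1) P)
  {N : ℕ} {a d : ℝ} {μ : Measure ℝ} [IsFiniteMeasure μ] {x : ℕ → Fin N → ℝ} {t : ℕ → ℝ}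

/-- The values at the first atoms of the tower together with the jet at the centre of the tail. -/
def towerFunctional (x : ℕ → Fin N → ℝ) (t : ℕ → ℝ) (J : ℕ) :
    L.EnergyCompletion →L[ℂ] (Fin (N * J + (k + 1)) → ℂ) :=
  ContinuousLinearMap.pi fun m => (Sum.elim
    (fun s : Fin (N * J) => eval k (x (finProdFinEquiv.symm s).2 (finProdFinEquiv.symm s).1))
    (fun i : Fin (k + 1) => eval i (t J)) (finSumFinEquiv.symm m)).comp (jet L)

variable {L}

theorem chain_eq_zero_of_towerFunctional {J : ℕ} {v : L.EnergyCompletion}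
    (hv : towerFunctional L x t J v = 0) :
    (∀ j < J, ∀ i, chain (jet L v) (k + 1) (x j i) = 0) ∧
      ∀ i < k + 1, chain (jet L v) (i + 1) (t J) = 0 := by
  constructor
  · intro j hj i
    have h := congrFun hv (finSumFinEquiv (Sum.inl (finProdFinEquiv (i, ⟨j, hj⟩))))
    change (Sum.elim _ _ (finSumFinEquiv.symm (finSumFinEquiv _)) : JetSpace (k + 1) →L[ℂ] ℂ) (jet L v) = 0 at h
    rw [Equiv.symm_apply_apply, Sum.elim_inl, Equiv.symm_apply_apply] at h
    exact h
  · intro i hi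
    have h := congrFun hv (finSumFinEquiv (Sum.inr ⟨i, hi⟩))
    change (Sum.elim _ _ (finSumFinEquiv.symm (finSumFinEquiv _)) : JetSpace (k + 1) →L[ℂ] ℂ) (jet L v) = 0 at h
    rw [Equiv.symm_apply_apply, Sum.elim_inr] at h
    exact h

/-- The atoms below level `J` contribute nothing. On the tail, of mass at most `d^J`, the vanishing
jet at `t J` gives `|v|² ≤ (a^J)^(2k+1) ‖v^(k+1)‖²`, and the energy controls the last factor. -/
theorem norm_sq_embedding_le (ha : 0 ≤ a) (h : AtomicTower N a d μ x t) {J : ℕ} {v : L.EnergyCompletion}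
    (hv : towerFunctional L x t J v = 0) :
    ‖embedding L μ v‖ ^ 2 ≤ ‖jet L‖ ^ 2 * (d * a ^ (2 * k + 1)) ^ J * ‖v‖ ^ 2 := by
  obtain ⟨h0, h1⟩ := chain_eq_zero_of_towerFunctional hv
  obtain ⟨I, hI, hI1, hI2, hI3, hI4⟩ := h.tail J
  set w := jet L v with hw
  have hr : 0 ≤ a ^ J := pow_nonneg ha J
  set C := (a ^ J) ^ (2 * k + 1) * ‖w.2‖ ^ 2 with hC
  have hC0 : 0 ≤ C := by positivity
  have hb : ∀ s ∈ I, ‖chain w (k + 1) s‖ ^ 2 ≤ C := fun s hs => by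
    have h2 := norm_chain_le_of_eq_zero w hr h1 k (Nat.lt_succ_self k) s (hI2 s hs)
    calc ‖chain w (k + 1) s‖ ^ 2 ≤ ((a ^ J) ^ k * (√(a ^ J) * ‖w.2‖)) ^ 2 := by gcongr
      _ = (a ^ J) ^ (2 * k) * (√(a ^ J) ^ 2 * ‖w.2‖ ^ 2) := by ring
      _ = C := by rw [Real.sq_sqrt hr, hC]; ring
  have hae : ∀ᵐ s ∂μ.restrict (Icc 0 1), ‖chain w (k + 1) s‖ ^ 2 ≤ I.indicator (fun _ => C) s := by
    refine ae_restrict_of_ae ?_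
    refine (measure_eq_zero_iff_ae_notMem.1 hI4).mono fun s hs => ?_
    rw [notMem_compl_iff] at hs
    by_cases hsI : s ∈ I
    · rw [indicator_of_mem hsI]
      exact hb s hsI
    · obtain ⟨j, hj, i, rfl⟩ : ∃ j < J, ∃ i, x j i = s := by
        simpa [hsI] using hs
      rw [indicator_of_notMem hsI, h0 j hj i]
      simp
  have h3 : ‖embedding L μ v‖ ^ 2 ≤ C * d ^ J := by
    calc ‖embedding L μ v‖ ^ 2 = ∫ s in Icc 0 1, ‖chain w (k + 1) s‖ ^ 2 ∂μ := norm_sq_toLp k _ w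
      _ ≤ ∫ s in Icc 0 1, I.indicator (fun _ => C) s ∂μ :=
        integral_mono_of_nonneg (Eventually.of_forall fun s => sq_nonneg _)
          ((integrable_const C).indicator hI) hae
      _ = (μ.restrict (Icc 0 1)).real I * C := by rw [integral_indicator_const _ hI, smul_eq_mul]
      _ ≤ d ^ J * C := by
        gcongr
        refine le_trans ?_ hI3
        exact ENNReal.toReal_mono (measure_ne_top _ _) (Measure.restrict_apply_le _ _)
      _ = C * d ^ J := mul_comm _ _
  have hdJ : 0 ≤ d ^ J := measureReal_nonneg.trans hI3
  have h4 : ‖w.2‖ ^ 2 ≤ (‖jet L‖ * ‖v‖) ^ 2 := by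
    gcongr
    exact (norm_snd_le w).trans ((jet L).le_opNorm v)
  calc ‖embedding L μ v‖ ^ 2 ≤ C * d ^ J := h3
    _ ≤ (a ^ J) ^ (2 * k + 1) * (‖jet L‖ * ‖v‖) ^ 2 * d ^ J := by
      rw [hC]
      gcongr
    _ = _ := by
      rw [mul_pow d, ← pow_mul, ← pow_mul, mul_comm J]
      ring

theorem isCompactOperator_embedding (ha : 0 ≤ a) (hd : 0 ≤ d) (hr : d * a ^ (2 * k + 1) < 1)
    (h : AtomicTower N a d μ x t) : IsCompactOperator (embedding L μ) := by
  refine isCompactOperator_of_small_on_ker _ fun ε hε => ?_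
  have h1 : Tendsto (fun J => ‖jet L‖ ^ 2 * (d * a ^ (2 * k + 1)) ^ J) atTop (𝓝 (‖jet L‖ ^ 2 * 0)) :=
    (tendsto_pow_atTop_nhds_zero_of_lt_one (by positivity) hr).const_mul _
  rw [mul_zero] at h1
  obtain ⟨J, hJ⟩ := (h1.eventually (gt_mem_nhds (show (0 : ℝ) < ε ^ 2 by positivity))).exists
  refine ⟨_, towerFunctional L x t J, fun v hv => ?_⟩
  refine le_of_sq_le_sq ?_ (by positivity)
  refine (norm_sq_embedding_le ha h hv).trans ?_
  rw [mul_pow ε]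
  gcongr

theorem le_of_isEigenSystem (ha : 0 ≤ a) (h : AtomicTower N a d μ x t) {ev : ℕ → ℝ}
    {e : ℕ → L.EnergyCompletion} (he : IsEigenSystem (stringOperator L μ) ev e) (J : ℕ) :
    ev (N * J + (k + 1)) ≤ ‖jet L‖ ^ 2 * (d * a ^ (2 * k + 1)) ^ J := by
  refine he.le_of_functionals (towerFunctional L x t J).toLinearMap fun v hv => ?_
  rw [re_inner_stringOperator_self, ← norm_sq_toLp]
  exact norm_sq_embedding_le ha h hv

end EnergyCompletion

end SelfAdjointRealization

end DegenerateString

end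

/-! ### Bump functions and local bounds for the Dirichlet form -/

noncomputable section

namespace DegenerateString

/-- A test function concentrated in the interval of radius `h` around `x`. -/
structure IsBumpFunction (ℓ : ℕ) (C x h : ℝ) (φ : ℝ → ℝ) : Prop extends IsTestFunction φ where
  apply_self : φ x = 1
  eq_zero : ∀ i : ℕ, ∀ t ∉ Metric.ball x h, iteratedDeriv i φ t = 0
  abs_le : ∀ i ≤ ℓ, ∀ t, |iteratedDeriv i φ t| ≤ C / h ^ i

theorem exists_isBumpFunction (ℓ : ℕ) : ∃ C : ℝ, 0 < C ∧ ∀ x h : ℝ, 0 < h →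
    Metric.ball x h ⊆ Ioo 0 1 → ∃ φ, IsBumpFunction ℓ C x h φ := by
  -- All bumps are rescalings of this one, each derivative costing a factor `1/h`. Outer radius
  -- `1/2` keeps the closed support inside the open ball of radius `h`.
  let b : ContDiffBump (0 : ℝ) := ⟨1 / 4, 1 / 2, by norm_num, by norm_num⟩
  have hb : ∀ i : ℕ, ContDiff ℝ i b := fun i => b.contDiff
  have hb0 : ∀ i : ℕ, ∀ s : ℝ, 1 ≤ |s| → iteratedDeriv i b s = 0 := fun i s hs => by
    have h1 : s ∉ tsupport b := by
      rw [b.tsupport_eq, Metric.mem_closedBall, Real.dist_eq, sub_zero, not_le]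
      change 1 / 2 < |s|
      linarith
    rw [((notMem_tsupport_iff_eventuallyEq.1 h1).iteratedDeriv_eq i)]
    simp
  have hbd : ∀ i : ℕ, ∃ K : ℝ, ∀ s, |iteratedDeriv i b s| ≤ K := fun i => by
    obtain ⟨K, hK⟩ := (isCompact_Icc (a := (-1 : ℝ)) (b := 1)).exists_bound_of_continuousOn
      ((hb i).continuous_iteratedDeriv i le_rfl).continuousOn
    refine ⟨max K 0, fun s => ?_⟩
    by_cases hs : 1 ≤ |s|
    · rw [hb0 i s hs, abs_zero]
      exact le_max_right _ _
    · exact (hK s (abs_le.1 (not_le.1 hs).le)).trans (le_max_left _ _)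
  choose K hK using hbd
  have hK0 : ∀ i, 0 ≤ K i := fun i => (abs_nonneg _).trans (hK i 0)
  refine ⟨1 + ∑ i ∈ Finset.range (ℓ + 1), K i,
    add_pos_of_pos_of_nonneg one_pos (Finset.sum_nonneg fun i _ => hK0 i), fun x h hh hx => ?_⟩
  set φ : ℝ → ℝ := fun t => b (h⁻¹ * (t - x)) with hφ
  have hder : ∀ i t, iteratedDeriv i φ t = h⁻¹ ^ i * iteratedDeriv i b (h⁻¹ * (t - x)) := fun i t => by
    have h1 := iteratedDeriv_comp_sub_const i (fun y => b (h⁻¹ * y)) x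
    rw [hφ, h1, iteratedDeriv_comp_const_mul (hb i)]
  have hts : tsupport φ ⊆ Metric.closedBall x (h / 2) := by
    refine closure_minimal (fun t ht => ?_) Metric.isClosed_closedBall
    have h1 : h⁻¹ * (t - x) ∈ Function.support b := ht
    rw [b.support_eq, Metric.mem_ball, Real.dist_eq, sub_zero, abs_mul, abs_inv, abs_of_pos hh,
      inv_mul_lt_iff₀ hh] at h1
    have h2 : |t - x| < h * (1 / 2) := h1
    rw [Metric.mem_closedBall, Real.dist_eq]
    linarith
  refine ⟨φ, ⟨b.contDiff.comp (contDiff_const.mul (contDiff_id.sub contDiff_const)),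
    HasCompactSupport.of_support_subset_isCompact (isCompact_closedBall x (h / 2))
      ((subset_tsupport φ).trans hts),
    (hts.trans (Metric.closedBall_subset_ball (by linarith))).trans hx⟩, ?_, fun i t ht => ?_,
    fun i hi t => ?_⟩
  · simp only [hφ, sub_self, mul_zero]
    exact b.one_of_mem_closedBall (Metric.mem_closedBall_self (by norm_num))
  · rw [hder, hb0, mul_zero]
    rw [Metric.mem_ball, Real.dist_eq, not_lt] at ht
    rwa [abs_mul, abs_inv, abs_of_pos hh, ← div_eq_inv_mul, one_le_div hh]
  · rw [hder, abs_mul, abs_pow, abs_inv, abs_of_pos hh, inv_pow, ← div_eq_inv_mul]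
    gcongr
    refine (hK i _).trans ?_
    have := Finset.single_le_sum (fun i _ => hK0 i) (Finset.mem_range.2 (Nat.lt_succ_of_le hi))
    linarith

/-- Cauchy–Schwarz, obtained by expanding the square of `f - X / m`. -/
theorem sq_setIntegral_le {f : ℝ → ℝ} {B : Set ℝ} {m : ℝ} (hm : 0 < m)
    (hB : unitMeasure.real B ≤ m) (hf : IntegrableOn f B unitMeasure)
    (hf2 : IntegrableOn (fun t => f t ^ 2) B unitMeasure) :
    (∫ t in B, f t ∂unitMeasure) ^ 2 ≤ m * ∫ t in B, f t ^ 2 ∂unitMeasure := by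
  set X := ∫ t in B, f t ∂unitMeasure with hX
  have h1 : 0 ≤ ∫ t in B, (f t - X / m) ^ 2 ∂unitMeasure := integral_nonneg fun t => sq_nonneg _
  have h2 : ∫ t in B, (f t - X / m) ^ 2 ∂unitMeasure =
      ∫ t in B, f t ^ 2 ∂unitMeasure - 2 * (X / m) * X + unitMeasure.real B * (X / m) ^ 2 := by
    have e : ∀ t, (f t - X / m) ^ 2 = f t ^ 2 - 2 * (X / m) * f t + (X / m) ^ 2 := fun t => by ring
    have h3 : IntegrableOn (fun t => f t ^ 2 - 2 * (X / m) * f t) B unitMeasure :=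
      hf2.sub (hf.const_mul _)
    simp only [e]
    rw [integral_add h3 (integrable_const _), integral_sub hf2 (hf.const_mul _),
      integral_const_mul, setIntegral_const, smul_eq_mul]
  rw [h2] at h1
  have h3 : unitMeasure.real B * (X / m) ^ 2 ≤ m * (X / m) ^ 2 := by gcongr
  have h4 : m * (X / m) ^ 2 = X ^ 2 / m := by field_simp
  have h5 : 2 * (X / m) * X = 2 * (X ^ 2 / m) := by ring
  have h6 : X ^ 2 / m ≤ ∫ t in B, f t ^ 2 ∂unitMeasure := by linarith
  rwa [div_le_iff₀' hm] at h6

namespace JetSpace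

variable {ℓ : ℕ}

theorem norm_der_le (w : JetSpace ℓ) {i : ℕ} (hi : i < ℓ) (t : ℝ) : ‖der w i t‖ ≤ (ℓ + 1) * ‖w‖ := by
  rw [der_eq_chain w hi]
  refine (norm_chain_le w _ t).trans ?_
  refine mul_le_mul_of_nonneg_right ?_ (norm_nonneg _)
  have h : ((ℓ - 1 - i : ℕ) : ℝ) + 1 ≤ ℓ := by exact_mod_cast (by omega : ℓ - 1 - i + 1 ≤ ℓ)
  linarith

/-- The density controlling the Dirichlet form locally. -/
def density (P : Fin ℓ → ℝ → ℝ) (w : JetSpace ℓ) (t : ℝ) : ℝ := ‖w.2 t‖ ^ 2 + ‖w‖ ^ 2 * ∑ i, |P i t|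

theorem integrable_norm_sq (w : JetSpace ℓ) : Integrable (fun t => ‖w.2 t‖ ^ 2) unitMeasure :=
  (memLp_two_iff_integrable_sq_norm (Lp.aestronglyMeasurable w.2)).1 (Lp.memLp w.2)

theorem integrable_density {P : Fin ℓ → ℝ → ℝ} (hP : ∀ i, IntegrableOn (P i) (Ioo 0 1))
    (w : JetSpace ℓ) : Integrable (density P w) unitMeasure :=
  (integrable_norm_sq w).add ((integrable_finsetSum _ fun i _ => (hP i).abs).const_mul _)

theorem density_nonneg (P : Fin ℓ → ℝ → ℝ) (w : JetSpace ℓ) (t : ℝ) : 0 ≤ density P w t :=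
  add_nonneg (sq_nonneg _) (mul_nonneg (sq_nonneg _) (Finset.sum_nonneg fun _ _ => abs_nonneg _))

theorem integral_density_le {P : Fin ℓ → ℝ → ℝ} (hP : ∀ i, IntegrableOn (P i) (Ioo 0 1))
    (w : JetSpace ℓ) : ∫ t, density P w t ∂unitMeasure ≤
      (1 + ∫ t, ∑ i, |P i t| ∂unitMeasure) * ‖w‖ ^ 2 := by
  have h4 : ∫ t, density P w t ∂unitMeasure =
      ‖w.2‖ ^ 2 + ‖w‖ ^ 2 * ∫ t, ∑ i, |P i t| ∂unitMeasure := by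
    rw [norm_sq_eq_integral, ← integral_const_mul]
    exact integral_add (integrable_norm_sq w)
      ((integrable_finsetSum _ fun i _ => (hP i).abs).const_mul _)
  have h5 : ‖w.2‖ ^ 2 ≤ ‖w‖ ^ 2 := by
    gcongr
    exact norm_snd_le w
  rw [h4]
  linarith

/-- The Dirichlet form of the differential expression against a test function. -/
def dirichlet (P : Fin ℓ → ℝ → ℝ) (w : JetSpace ℓ) (φ : ℝ → ℝ) : ℂ :=
  ∫ t, (der w ℓ t * ((iteratedDeriv ℓ φ t : ℝ) : ℂ) + ∑ i : Fin ℓ, (-1) ^ (i : ℕ) * (P i t : ℂ) *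
    der w i t * ((iteratedDeriv i φ t : ℝ) : ℂ)) ∂unitMeasure

/-- The Dirichlet form against a bump function is controlled by the density near the bump. -/
theorem norm_dirichlet_sq_le {k : ℕ} {P : Fin (k + 1) → ℝ → ℝ} (hP : ∀ i, IntegrableOn (P i) (Ioo 0 1))
    (w : JetSpace (k + 1)) {C x h : ℝ} {φ : ℝ → ℝ} (hφ : IsBumpFunction (k + 1) C x h φ) (hC : 0 ≤ C)
    (h0 : 0 < h) (h1 : h ≤ 1) :
    ‖dirichlet P w φ‖ ^ 2 ≤
      C ^ 2 * (4 + 2 * ((k + 2) ^ 2 * ∫ t, ∑ i, |P i t| ∂unitMeasure)) / h ^ (2 * k + 1) *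
        ∫ t in Metric.ball x h, density P w t ∂unitMeasure := by
  set B := Metric.ball x h with hB
  have hBm : MeasurableSet B := Metric.isOpen_ball.measurableSet
  set S := ∫ t, ∑ i, |P i t| ∂unitMeasure with hS
  have hPi : Integrable (fun t => ∑ i, |P i t|) unitMeasure :=
    integrable_finsetSum _ fun i _ => (hP i).abs
  have hP0 : ∀ t, 0 ≤ ∑ i, |P i t| := fun t => Finset.sum_nonneg fun _ _ => abs_nonneg _
  have hwi : Integrable (fun t => ‖w.2 t‖) unitMeasure := ((Lp.memLp w.2).integrable (by norm_num)).norm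
  set X := ∫ t in B, ‖w.2 t‖ ∂unitMeasure with hX
  set X2 := ∫ t in B, ‖w.2 t‖ ^ 2 ∂unitMeasure with hX2
  set Y := ∫ t in B, ∑ i, |P i t| ∂unitMeasure with hY
  have hX0 : 0 ≤ X := integral_nonneg fun t => norm_nonneg _
  have hX20 : 0 ≤ X2 := integral_nonneg fun t => sq_nonneg _
  have hY0 : 0 ≤ Y := integral_nonneg hP0
  have hYS : Y ≤ S := setIntegral_le_integral hPi (Eventually.of_forall hP0)
  have hdens : ∫ t in B, density P w t ∂unitMeasure = X2 + ‖w‖ ^ 2 * Y := by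
    rw [hX2, hY, ← integral_const_mul]
    exact integral_add (integrable_norm_sq w).integrableOn (hPi.const_mul _).integrableOn
  have hXX : X ^ 2 ≤ 2 * h * X2 := by
    refine sq_setIntegral_le (by positivity) ?_ hwi.integrableOn (integrable_norm_sq w).integrableOn
    rw [measureReal_restrict_apply hBm]
    refine (measureReal_mono inter_subset_left measure_ball_lt_top.ne).trans ?_
    rw [Real.volume_real_ball h0.le]
  -- The leading term gains a factor `h` from Cauchy–Schwarz and ends up with `h^(-(2k+1))`. The
  -- lower-order terms have only `h^(-2k)`, which is no worse as `h ≤ 1`. Replacing one factor `Y`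
  -- by its global bound `S` keeps the estimate linear in the local density, so that it can be
  -- summed over disjoint balls.
  set α := C / h ^ (k + 1) with hα
  set β := C / h ^ k * ((k + 2) * ‖w‖) with hβ
  have hα0 : 0 ≤ α := by positivity
  have hβ0 : 0 ≤ β := by positivity
  have hbound : ‖dirichlet P w φ‖ ≤ α * X + β * Y := by
    have hi : IntegrableOn (fun t => α * ‖w.2 t‖ + β * ∑ i, |P i t|) B unitMeasure :=
      ((hwi.const_mul α).add (hPi.const_mul β)).integrableOn
    calc ‖dirichlet P w φ‖ ≤ ∫ t, B.indicator (fun t => α * ‖w.2 t‖ + β * ∑ i, |P i t|) t ∂unitMeasure := by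
          refine norm_integral_le_of_norm_le ((integrable_indicator_iff hBm).2 hi)
            (Eventually.of_forall fun t => ?_)
          by_cases ht : t ∈ B
          · rw [indicator_of_mem ht, Finset.mul_sum]
            refine (norm_add_le _ _).trans (add_le_add ?_ ((norm_sum_le _ _).trans
              (Finset.sum_le_sum fun i _ => ?_)))
            · rw [norm_mul, der_self, Complex.norm_real, Real.norm_eq_abs, mul_comm]
              gcongr
              exact hφ.abs_le _ le_rfl t
            · have e1 : |iteratedDeriv i φ t| ≤ C / h ^ k := (hφ.abs_le i i.2.le t).trans 
                (div_le_div_of_nonneg_left hC (by positivity) (pow_le_pow_of_le_one h0.le h1 (by omega)))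
              have e2 := norm_der_le w i.2 t
              rw [norm_mul, norm_mul, norm_mul, norm_pow, norm_neg, norm_one, one_pow, one_mul,
                Complex.norm_real, Complex.norm_real, Real.norm_eq_abs, Real.norm_eq_abs]
              calc |P i t| * ‖der w i t‖ * |iteratedDeriv i φ t|
                  ≤ |P i t| * (((k + 1 : ℕ) + 1) * ‖w‖) * (C / h ^ k) := by gcongr
                _ = β * |P i t| := by rw [hβ]; push_cast; ring
          · rw [indicator_of_notMem ht, hφ.eq_zero _ t ht]
            simp only [hφ.eq_zero _ t ht]
            simp
      _ = ∫ t in B, (α * ‖w.2 t‖ + β * ∑ i, |P i t|) ∂unitMeasure := integral_indicator hBm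
      _ = α * X + β * Y := by
        rw [integral_add (hwi.const_mul α).integrableOn (hPi.const_mul β).integrableOn,
          integral_const_mul, integral_const_mul]
  have hh : h ^ (2 * k + 1) ≤ h ^ (2 * k) := pow_le_pow_of_le_one h0.le h1 (by omega)
  have hα2 : α ^ 2 * (2 * h * X2) = C ^ 2 * 2 / h ^ (2 * k + 1) * X2 := by
    rw [hα]
    field_simp
    ring
  have hβ2 : β ^ 2 * (S * Y) ≤ C ^ 2 * ((k + 2) ^ 2 * S) / h ^ (2 * k + 1) * (‖w‖ ^ 2 * Y) := by
    have : β ^ 2 * (S * Y) = C ^ 2 * ((k + 2) ^ 2 * S) / h ^ (2 * k) * (‖w‖ ^ 2 * Y) := by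
      rw [hβ]
      field_simp
      ring
    rw [this]
    have hS0 : 0 ≤ S := hY0.trans hYS
    gcongr
  rw [hdens]
  have hS0 : 0 ≤ S := hY0.trans hYS
  calc ‖dirichlet P w φ‖ ^ 2 ≤ (α * X + β * Y) ^ 2 := by gcongr
    _ ≤ 2 * (α ^ 2 * X ^ 2) + 2 * (β ^ 2 * (Y * Y)) := by nlinarith [sq_nonneg (α * X - β * Y)]
    _ ≤ 2 * (α ^ 2 * (2 * h * X2)) + 2 * (β ^ 2 * (S * Y)) := by gcongr
    _ ≤ 2 * (C ^ 2 * 2 / h ^ (2 * k + 1) * X2) +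
        2 * (C ^ 2 * ((k + 2) ^ 2 * S) / h ^ (2 * k + 1) * (‖w‖ ^ 2 * Y)) := by
      rw [hα2]
      gcongr
    _ = C ^ 2 * 4 / h ^ (2 * k + 1) * X2 +
        C ^ 2 * (2 * ((k + 2) ^ 2 * S)) / h ^ (2 * k + 1) * (‖w‖ ^ 2 * Y) := by ring
    _ ≤ C ^ 2 * (4 + 2 * ((k + 2) ^ 2 * S)) / h ^ (2 * k + 1) * X2 +
        C ^ 2 * (4 + 2 * ((k + 2) ^ 2 * S)) / h ^ (2 * k + 1) * (‖w‖ ^ 2 * Y) := by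
      gcongr
      · have : 0 ≤ 2 * (((k : ℝ) + 2) ^ 2 * S) := by positivity
        linarith
      · linarith
    _ = _ := by ring

end JetSpace

end DegenerateString

end

/-! ### Bump functions as elements of the energy space -/

noncomputable section

namespace DegenerateString

theorem sum_setIntegral_le {ι : Type*} [Fintype ι] {B : ι → Set ℝ} (hB : ∀ s, MeasurableSet (B s))
    (hd : Pairwise (Function.onFun Disjoint B)) {f : ℝ → ℝ} {ν : Measure ℝ} (hf : Integrable f ν) (h0 : ∀ t, 0 ≤ f t) :
    ∑ s, ∫ t in B s, f t ∂ν ≤ ∫ t, f t ∂ν := by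
  rw [← integral_iUnion_fintype hB hd fun s => hf.integrableOn]
  exact setIntegral_le_integral hf (Eventually.of_forall h0)

theorem sum_measureReal_mul_le {ι : Type*} [Fintype ι] {x : ι → ℝ} (hx : Function.Injective x)
    {f : ℝ → ℝ} {ν : Measure ℝ} (hf : Integrable f ν) (h0 : ∀ t, 0 ≤ f t) :
    ∑ s, ν.real {x s} * f (x s) ≤ ∫ t, f t ∂ν := by
  refine le_trans (le_of_eq ?_) (sum_setIntegral_le (B := fun s => {x s})
    (fun s => measurableSet_singleton _) (fun s s' h => ?_) hf h0)
  · simp only [integral_singleton, smul_eq_mul]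
  · exact disjoint_singleton.2 (hx.ne h)

namespace SelfAdjointRealization

namespace EnergyCompletion

open JetSpace EnergySpace UniformSpace

section

variable {ℓ : ℕ} {P : Fin ℓ → ℝ → ℝ} {L : SelfAdjointRealization ℓ P}

/-- Riesz representation of the functional `u ↦ ⟨h, L u⟩` gives an element of the completion. Its
function differs from `h` by a vector orthogonal to the range of `L`, that is, by zero. Hence `h`
need not lie in the domain of `L`. -/
theorem exists_toL2_jet_eq_of_bound (hP : ∀ i, IntegrableOn (P i) (Ioo 0 1)) {h : H}
    (hb : ∃ C, ∀ u : L.EnergySpace, ‖inner ℂ h (op u)‖ ≤ C * ‖u‖) :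
    ∃ v : L.EnergyCompletion, toL2 (jet L v) = h := by
  set f : L.EnergyCompletion →L[ℂ] ℂ := ((innerSL ℂ h).toLinearMap.comp op).extendOfNorm
    (Completion.toComplL (𝕜 := ℂ) (E := L.EnergySpace)).toLinearMap with hf
  have hfu : ∀ u : L.EnergySpace, f (u : L.EnergyCompletion) = inner ℂ h (op u) := fun u => by
    obtain ⟨C, hC⟩ := hb
    refine LinearMap.extendOfNorm_eq (f := (innerSL ℂ h).toLinearMap.comp op)
      (e := (Completion.toComplL (𝕜 := ℂ) (E := L.EnergySpace)).toLinearMap)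
      Completion.denseRange_coe ⟨C, fun x => ?_⟩ u
    exact (hC x).trans_eq (congrArg (C * ·) (Completion.norm_coe x).symm)
  refine ⟨(InnerProductSpace.toDual ℂ L.EnergyCompletion).symm f, ?_⟩
  rw [← sub_eq_zero]
  refine L.eq_zero_of_inner_eq_zero fun u => ?_
  have h1 := hfu (toDomain.symm u)
  rw [← InnerProductSpace.toDual_symm_apply, ← inner_conj_symm, inner_coe_left hP, inner_conj_symm] at h1
  rw [inner_sub_left, sub_eq_zero]
  exact h1

theorem inner_op_eq_dirichlet {φ : ℝ → ℝ} (hφ : IsTestFunction φ) {h : H}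
    (hh : h =ᵐ[unitMeasure] fun t => (φ t : ℂ)) (u : L.EnergySpace) :
    inner ℂ h (op u) = dirichlet P (toJet L u) φ := by
  rw [inner_eq_integral, dirichlet, weakEq_toJet u φ hφ]
  refine integral_congr_ae ?_
  filter_upwards [hh] with t ht
  rw [ht, Complex.conj_ofReal]

end

variable {k : ℕ} {P : Fin (k + 1) → ℝ → ℝ} {L : SelfAdjointRealization (k + 1) P}

theorem norm_toJet_le (hP : ∀ i, IntegrableOn (P i) (Ioo 0 1)) (u : L.EnergySpace) :
    ‖toJet L u‖ ≤ ‖jet L‖ * ‖u‖ := by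
  rw [← jet_coe hP, ← Completion.norm_coe u]
  exact (jet L).le_opNorm _

/-- A constant in the energy estimates for bump functions. -/
def bumpConstant (L : SelfAdjointRealization (k + 1) P) (C : ℝ) : ℝ :=
  C ^ 2 * (4 + 2 * ((k + 2) ^ 2 * ∫ t, ∑ i, |P i t| ∂unitMeasure)) *
    (1 + ∫ t, ∑ i, |P i t| ∂unitMeasure) * ‖jet L‖ ^ 2

theorem integral_sum_abs_nonneg (P : Fin (k + 1) → ℝ → ℝ) : 0 ≤ ∫ t, ∑ i, |P i t| ∂unitMeasure :=
  integral_nonneg fun _ => Finset.sum_nonneg fun _ _ => abs_nonneg _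

theorem bumpConstant_nonneg (L : SelfAdjointRealization (k + 1) P) (C : ℝ) : 0 ≤ bumpConstant L C := by
  have := integral_sum_abs_nonneg P
  unfold bumpConstant
  positivity

/-- The balls are disjoint, so the local densities add up to at most the total one, which the energy
controls. The constant does not depend on the number of bumps. -/
theorem sum_norm_dirichlet_sq_le (hP : ∀ i, IntegrableOn (P i) (Ioo 0 1)) {ι : Type*} [Fintype ι]
    {C : ℝ} (hC : 0 ≤ C) {x h : ι → ℝ} {φ : ι → ℝ → ℝ} (h0 : ∀ s, 0 < h s) (h1 : ∀ s, h s ≤ 1)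
    (hd : Pairwise (Function.onFun Disjoint fun s => Metric.ball (x s) (h s)))
    (hφ : ∀ s, IsBumpFunction (k + 1) C (x s) (h s) (φ s)) (u : L.EnergySpace) :
    ∑ s, ‖dirichlet P (toJet L u) (φ s)‖ ^ 2 * h s ^ (2 * k + 1) ≤ bumpConstant L C * ‖u‖ ^ 2 := by
  set w := toJet L u with hw
  have hS := integral_sum_abs_nonneg P
  set S := ∫ t, ∑ i, |P i t| ∂unitMeasure with hSdef
  set K := C ^ 2 * (4 + 2 * ((k + 2) ^ 2 * S)) with hK
  have hK0 : 0 ≤ K := by positivity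
  calc ∑ s, ‖dirichlet P w (φ s)‖ ^ 2 * h s ^ (2 * k + 1)
      ≤ ∑ s, K * ∫ t in Metric.ball (x s) (h s), density P w t ∂unitMeasure := by
        refine Finset.sum_le_sum fun s _ => ?_
        have h2 := norm_dirichlet_sq_le hP w (hφ s) hC (h0 s) (h1 s)
        rw [div_mul_eq_mul_div, le_div_iff₀ (pow_pos (h0 s) _)] at h2
        exact h2
    _ = K * ∑ s, ∫ t in Metric.ball (x s) (h s), density P w t ∂unitMeasure := by rw [Finset.mul_sum]
    _ ≤ K * ∫ t, density P w t ∂unitMeasure := by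
        gcongr
        exact sum_setIntegral_le (fun s => Metric.isOpen_ball.measurableSet) hd
          (integrable_density hP w) (density_nonneg P w)
    _ ≤ K * ((1 + S) * (‖jet L‖ * ‖u‖) ^ 2) := by
        gcongr
        refine (integral_density_le hP w).trans ?_
        gcongr
        exact norm_toJet_le hP u
    _ = _ := by rw [bumpConstant, hK]; ring

/-- The bump functions belong to the energy space. -/
theorem exists_representer (hP : ∀ i, IntegrableOn (P i) (Ioo 0 1)) {C x h : ℝ} {φ : ℝ → ℝ}
    (hC : 0 ≤ C) (h0 : 0 < h) (h1 : h ≤ 1) (hφ : IsBumpFunction (k + 1) C x h φ) :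
    ∃ v : L.EnergyCompletion, (∀ t ∈ Icc (0 : ℝ) 1, chain (jet L v) (k + 1) t = φ t) ∧
      ∀ u : L.EnergySpace, inner ℂ v (u : L.EnergyCompletion) = dirichlet P (toJet L u) φ := by
  have hm : MemLp (fun t => (φ t : ℂ)) 2 unitMeasure := by
    obtain ⟨K, hK⟩ := hφ.hasCompactSupport.exists_bound_of_continuous hφ.contDiff.continuous
    exact MemLp.of_bound (Complex.continuous_ofReal.comp hφ.contDiff.continuous).aestronglyMeasurable K
      (Eventually.of_forall fun t => by simpa using hK t)
  have hb : ∀ u : L.EnergySpace, ‖inner ℂ (hm.toLp _) (op u)‖ ≤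
      √(bumpConstant L C / h ^ (2 * k + 1)) * ‖u‖ := fun u => by
    -- The family consisting of a single bump.
    have h2 := sum_norm_dirichlet_sq_le hP hC (ι := Unit) (x := fun _ => x) (h := fun _ => h)
      (φ := fun _ => φ) (fun _ => h0) (fun _ => h1) (fun s s' hs => (hs rfl).elim) (fun _ => hφ) u
    rw [inner_op_eq_dirichlet hφ.toIsTestFunction hm.coeFn_toLp]
    refine le_of_sq_le_sq ?_ (by positivity)
    have := bumpConstant_nonneg L C
    rw [mul_pow, Real.sq_sqrt (by positivity), div_mul_eq_mul_div, le_div_iff₀ (pow_pos h0 _)]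
    simpa using h2
  obtain ⟨v, hv⟩ := exists_toL2_jet_eq_of_bound hP ⟨_, hb⟩
  refine ⟨v, fun t ht => ?_, fun u => ?_⟩
  · refine eqOn_Icc_of_ae_eq ((coeFn_toL2 _).symm.trans ?_) (continuous_chain _ k).continuousOn
      (Complex.continuous_ofReal.comp hφ.contDiff.continuous).continuousOn ht
    rw [hv]
    exact hm.coeFn_toLp
  · rw [← inner_op_eq_dirichlet hφ.toIsTestFunction hm.coeFn_toLp, ← hv, ← inner_conj_symm,
      inner_coe_left hP, inner_conj_symm]

theorem norm_sq_le_of_inner_coe_le {v : L.EnergyCompletion} {M : ℝ} (hM : 0 ≤ M)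
    (h : ∀ u : L.EnergySpace, ‖inner ℂ v (u : L.EnergyCompletion)‖ ^ 2 ≤ M * ‖u‖ ^ 2) : ‖v‖ ^ 2 ≤ M := by
  have h1 : ∀ u : L.EnergyCompletion, ‖inner ℂ v u‖ ^ 2 ≤ M * ‖u‖ ^ 2 := fun u => by
    induction u using Completion.induction_on with
    | hp => exact isClosed_le (by fun_prop) (by fun_prop)
    | ih u =>
      rw [Completion.norm_coe]
      exact h u
  have h2 := h1 v
  rw [inner_self_eq_norm_sq_to_K, norm_pow, RCLike.norm_ofReal, abs_norm] at h2
  rcases eq_or_lt_of_le (sq_nonneg ‖v‖) with h3 | h3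
  · rwa [← h3]
  · rw [sq (‖v‖ ^ 2)] at h2
    exact le_of_mul_le_mul_right h2 h3

end EnergyCompletion

end SelfAdjointRealization

end DegenerateString

end

/-! ### Lower bounds for the eigenvalues -/

noncomputable section

namespace DegenerateString

namespace SelfAdjointRealization

namespace EnergyCompletion

open JetSpace EnergySpace UniformSpace

variable {k : ℕ} {P : Fin (k + 1) → ℝ → ℝ} {L : SelfAdjointRealization (k + 1) P}

/-- Duality instead of orthogonality: the norm is computed against the dense domain of `L`, and
Cauchy–Schwarz with weights `h^(2k+1)` separates the coefficients from the Dirichlet forms. -/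
theorem norm_sq_sum_le (hP : ∀ i, IntegrableOn (P i) (Ioo 0 1)) {ι : Type*} [Fintype ι]
    {C : ℝ} (hC : 0 ≤ C) {x h : ι → ℝ} {φ : ι → ℝ → ℝ} (h0 : ∀ s, 0 < h s) (h1 : ∀ s, h s ≤ 1)
    (hd : Pairwise (Function.onFun Disjoint fun s => Metric.ball (x s) (h s)))
    (hφ : ∀ s, IsBumpFunction (k + 1) C (x s) (h s) (φ s)) {v : ι → L.EnergyCompletion}
    (hv : ∀ s, ∀ u : L.EnergySpace, inner ℂ (v s) (u : L.EnergyCompletion) =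
      dirichlet P (toJet L u) (φ s)) (c : ι → ℂ) :
    ‖∑ s, c s • v s‖ ^ 2 ≤ bumpConstant L C * ∑ s, ‖c s‖ ^ 2 / h s ^ (2 * k + 1) := by
  have hS0 : 0 ≤ ∑ s, ‖c s‖ ^ 2 / h s ^ (2 * k + 1) :=
    Finset.sum_nonneg fun s _ => div_nonneg (sq_nonneg _) (pow_pos (h0 s) _).le
  refine norm_sq_le_of_inner_coe_le (mul_nonneg (bumpConstant_nonneg L C) hS0) fun u => ?_
  rw [sum_inner]
  have h2 : ‖∑ s, inner ℂ (c s • v s) (u : L.EnergyCompletion)‖ ≤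
      ∑ s, ‖c s‖ * ‖dirichlet P (toJet L u) (φ s)‖ := by
    refine (norm_sum_le _ _).trans (le_of_eq (Finset.sum_congr rfl fun s _ => ?_))
    rw [inner_smul_left, norm_mul, RCLike.norm_conj, hv]
  calc _ ≤ (∑ s, ‖c s‖ * ‖dirichlet P (toJet L u) (φ s)‖) ^ 2 := by gcongr
    _ ≤ (∑ s, ‖c s‖ ^ 2 / h s ^ (2 * k + 1)) *
        ∑ s, ‖dirichlet P (toJet L u) (φ s)‖ ^ 2 * h s ^ (2 * k + 1) := by
      refine Finset.sum_sq_le_sum_mul_sum_of_sq_le_mul _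
        (fun s _ => div_nonneg (sq_nonneg _) (pow_pos (h0 s) _).le)
        (fun s _ => mul_nonneg (sq_nonneg _) (pow_pos (h0 s) _).le) fun s _ => le_of_eq ?_
      have := (pow_pos (h0 s) (2 * k + 1)).ne'
      field_simp
    _ ≤ (∑ s, ‖c s‖ ^ 2 / h s ^ (2 * k + 1)) * (bumpConstant L C * ‖u‖ ^ 2) := by
      gcongr
      exact sum_norm_dirichlet_sq_le hP hC h0 h1 hd hφ u
    _ = _ := by ring

theorem chain_jet_sum {ι : Type*} [Fintype ι] {C : ℝ} {x h : ι → ℝ} {φ : ι → ℝ → ℝ}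
    (h0 : ∀ s, 0 < h s) (hsub : ∀ s, Metric.ball (x s) (h s) ⊆ Ioo 0 1)
    (hd : Pairwise (Function.onFun Disjoint fun s => Metric.ball (x s) (h s)))
    (hφ : ∀ s, IsBumpFunction (k + 1) C (x s) (h s) (φ s)) {v : ι → L.EnergyCompletion}
    (hv : ∀ s, ∀ t ∈ Icc (0 : ℝ) 1, chain (jet L (v s)) (k + 1) t = φ s t) (c : ι → ℂ) (s : ι) :
    chain (jet L (∑ s, c s • v s)) (k + 1) (x s) = c s := by
  have hx : x s ∈ Icc (0 : ℝ) 1 := Ioo_subset_Icc_self (hsub s (Metric.mem_ball_self (h0 s)))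
  rw [← eval_apply, map_sum, map_sum, Finset.sum_eq_single s]
  · rw [map_smul, map_smul, eval_apply, hv s _ hx, (hφ s).apply_self, Complex.ofReal_one, smul_eq_mul,
      mul_one]
  · intro s' _ hs'
    have h1 : x s ∉ Metric.ball (x s') (h s') := fun h2 =>
      disjoint_left.1 (hd hs') h2 (Metric.mem_ball_self (h0 s))
    have h2 := (hφ s').eq_zero 0 _ h1
    rw [iteratedDeriv_zero] at h2
    rw [map_smul, map_smul, eval_apply, hv s' _ hx, h2, Complex.ofReal_zero, smul_zero]
  · simp

/-- Subspaces on which the quadratic form of the string operator is large. -/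
theorem exists_submodule_le (hP : ∀ i, IntegrableOn (P i) (Ioo 0 1)) {N : ℕ} {a d : ℝ} {μ : Measure ℝ}
    [IsFiniteMeasure μ] {x : ℕ → Fin N → ℝ} {t : ℕ → ℝ} (ha : 0 < a) (ha1 : a ≤ 1) (hd : 0 ≤ d)
    (hd1 : d ≤ 1) (hT : AtomicTower N a d μ x t) :
    ∃ c : ℝ, 0 < c ∧ ∀ J : ℕ, ∃ M : Submodule ℂ L.EnergyCompletion, Module.finrank ℂ M = N * (J + 1) ∧
      ∀ v ∈ M, c * (d * a ^ (2 * k + 1)) ^ J * ‖v‖ ^ 2 ≤ (inner ℂ (stringOperator L μ v) v).re := by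
  obtain ⟨w, hw, hweight⟩ := hT.weight
  obtain ⟨δ, hδ, hδ1, hsub, hdisj⟩ := hT.separated
  obtain ⟨C, hC, hbump⟩ := exists_isBumpFunction (k + 1)
  -- Adding one makes the constant positive, so that division by it is allowed.
  set K := bumpConstant L C + 1 with hK
  have hK0 : 0 < K := add_pos_of_nonneg_of_pos (bumpConstant_nonneg L C) one_pos
  have hh0 : ∀ j, 0 < δ * a ^ j := fun j => by positivity
  have hh1 : ∀ j, δ * a ^ j ≤ 1 := fun j => mul_le_one₀ hδ1 (by positivity) (pow_le_one₀ ha.le ha1)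
  choose φ hφ using fun j i => hbump (x j i) (δ * a ^ j) (hh0 j) (hsub j i)
  choose v hv1 hv2 using fun j i => exists_representer (L := L) hP hC.le (hh0 j) (hh1 j) (hφ j i)
  refine ⟨w * δ ^ (2 * k + 1) / K, by positivity, fun J => ?_⟩
  -- Levels `0` to `J` inclusive: the dimension `N (J + 1)` must exceed `N J` to bound the
  -- eigenvalue of index `N J`.
  let ι := Fin (J + 1) × Fin N
  let X : ι → ℝ := fun s => x s.1 s.2
  let h : ι → ℝ := fun s => δ * a ^ (s.1 : ℕ)
  let V : ι → L.EnergyCompletion := fun s => v s.1 s.2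
  have hdX : Pairwise (Function.onFun Disjoint fun s : ι => Metric.ball (X s) (h s)) :=
    fun s s' hs => hdisj _ _ _ _ fun e => hs (by
      rw [Prod.mk.injEq] at e
      exact Prod.ext (Fin.ext e.1) e.2)
  have hX : Function.Injective X := fun s s' e => by
    by_contra hs
    exact disjoint_left.1 (hdX hs) (Metric.mem_ball_self (hh0 _))
      (by rw [e]; exact Metric.mem_ball_self (hh0 _))
  have hXsub : ∀ s : ι, Metric.ball (X s) (h s) ⊆ Ioo 0 1 := fun s => hsub _ _
  have hval : ∀ (c : ι → ℂ) s, chain (jet L (∑ s, c s • V s)) (k + 1) (X s) = c s :=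
    chain_jet_sum (φ := fun s : ι => φ s.1 s.2) (fun s => hh0 _) hXsub hdX (fun s => hφ _ _)
      fun s => hv1 _ _
  have hli : LinearIndependent ℂ V := Fintype.linearIndependent_iff.2 fun c hc s => by
    rw [← hval c s, hc, ← eval_apply, map_zero, map_zero]
  refine ⟨Submodule.span ℂ (range V), ?_, fun u hu => ?_⟩
  · rw [finrank_span_eq_card hli, Fintype.card_prod, Fintype.card_fin, Fintype.card_fin, mul_comm]
  · obtain ⟨c, rfl⟩ := (Submodule.mem_span_range_iff_exists_fun ℂ).1 hu
    have h1 := norm_sq_sum_le hP hC.le (φ := fun s : ι => φ s.1 s.2) (fun s => hh0 _) (fun s => hh1 _) hdX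
      (fun s => hφ _ _) (v := V) (fun s => hv2 _ _) c
    set u := ∑ s, c s • V s with hu'
    rw [re_inner_stringOperator_self]
    have hS0 : ∀ s : ι, 0 ≤ ‖c s‖ ^ 2 / h s ^ (2 * k + 1) := fun s =>
      div_nonneg (sq_nonneg _) (pow_pos (hh0 _) _).le
    have h2 : ‖u‖ ^ 2 ≤ K * ∑ s, ‖c s‖ ^ 2 / h s ^ (2 * k + 1) := by
      refine h1.trans ?_
      have := Finset.sum_nonneg fun s (_ : s ∈ Finset.univ) => hS0 s
      gcongr
      linarith
    have hcont : Continuous fun s => ‖chain (jet L u) (k + 1) s‖ ^ 2 :=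
      (continuous_chain _ k).norm.pow 2
    have h3 := sum_measureReal_mul_le hX (ν := μ.restrict (Icc 0 1))
      (hcont.continuousOn.integrableOn_compact isCompact_Icc) fun t => sq_nonneg _
    refine le_trans ?_ h3
    calc w * δ ^ (2 * k + 1) / K * (d * a ^ (2 * k + 1)) ^ J * ‖u‖ ^ 2
        ≤ w * δ ^ (2 * k + 1) / K * (d * a ^ (2 * k + 1)) ^ J *
          (K * ∑ s, ‖c s‖ ^ 2 / h s ^ (2 * k + 1)) := by gcongr
      _ = ∑ s, w * δ ^ (2 * k + 1) * (d * a ^ (2 * k + 1)) ^ J * (‖c s‖ ^ 2 / h s ^ (2 * k + 1)) := by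
        rw [← Finset.mul_sum]
        field_simp
      _ ≤ _ := by
        refine Finset.sum_le_sum fun s _ => ?_
        have hxs : X s ∈ Icc (0 : ℝ) 1 := Ioo_subset_Icc_self (hXsub s (Metric.mem_ball_self (hh0 _)))
        rw [hval, measureReal_restrict_apply (measurableSet_singleton _),
          inter_eq_left.2 (singleton_subset_iff.2 hxs)]
        -- The ratio of mass to energy is smallest on the deepest level.
        have h4 : (d * a ^ (2 * k + 1)) ^ J ≤ (d * a ^ (2 * k + 1)) ^ (s.1 : ℕ) :=
          pow_le_pow_of_le_one (by positivity) (mul_le_one₀ hd1 (by positivity) (pow_le_one₀ ha.le ha1))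
            (Nat.lt_succ_iff.1 s.1.2)
        calc w * δ ^ (2 * k + 1) * (d * a ^ (2 * k + 1)) ^ J * (‖c s‖ ^ 2 / h s ^ (2 * k + 1))
            ≤ w * δ ^ (2 * k + 1) * (d * a ^ (2 * k + 1)) ^ (s.1 : ℕ) *
              (‖c s‖ ^ 2 / h s ^ (2 * k + 1)) := by
              have := hS0 s
              gcongr
          _ = w * d ^ (s.1 : ℕ) * ‖c s‖ ^ 2 := by
              simp only [h]
              rw [mul_pow, mul_pow δ, ← pow_mul, ← pow_mul, mul_comm (s.1 : ℕ)]
              field_simp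
          _ ≤ _ := by
              gcongr
              exact hweight _ _

end EnergyCompletion

end SelfAdjointRealization

end DegenerateString

end

/-! ### Conclusion -/

noncomputable section

namespace DegenerateString

namespace SelfAdjointRealization

open EnergyCompletion

variable {k : ℕ} {P : Fin (k + 1) → ℝ → ℝ} (L : SelfAdjointRealization (k + 1) P)

/-- The eigenvalues of a string whose measure is carried by a tower of atoms. -/
theorem exists_isGeometricallyTrapped (hP : ∀ i, IntegrableOn (P i) (Ioo 0 1)) {N : ℕ} (hN : 1 ≤ N)
    {a d : ℝ} {μ : Measure ℝ} [IsFiniteMeasure μ] {x : ℕ → Fin N → ℝ} {t : ℕ → ℝ} (ha : 0 < a)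
    (ha1 : a ≤ 1) (hd : 0 < d) (hd1 : d < 1) (hT : AtomicTower N a d μ x t) :
    ∃ ev, L.IsEigenvalueSequence μ ev ∧ IsGeometricallyTrapped N (k + 1) (d * a ^ (2 * k + 1)) ev := by
  have hr0 : 0 < d * a ^ (2 * k + 1) := by positivity
  have hr1 : d * a ^ (2 * k + 1) < 1 :=
    (mul_le_of_le_one_right hd.le (pow_le_one₀ ha.le ha1)).trans_lt hd1
  obtain ⟨c, hc, hM⟩ := exists_submodule_le (L := L) hP ha ha1 hd.le hd1.le hT
  obtain ⟨ev, e, he⟩ := exists_isEigenSystem (isCompactOperator_stringOperator μ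
    (isCompactOperator_embedding (L := L) ha.le hd.le hr1 hT)) (isPositive_stringOperator μ)
    fun n => by
      obtain ⟨M, hM1, hM2⟩ := hM n
      refine ⟨M, by rw [hM1]; nlinarith, fun v hv hv0 => lt_of_lt_of_le ?_ (hM2 v hv)⟩
      have : 0 < ‖v‖ := norm_pos_iff.2 hv0
      positivity
  have htrap : IsGeometricallyTrapped N (k + 1) (d * a ^ (2 * k + 1)) ev :=
    ⟨he.antitone, he.pos, ⟨_, le_of_isEigenSystem ha.le hT he⟩, c, hc, fun J => by
      obtain ⟨M, hM1, hM2⟩ := hM J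
      exact he.le_of_finrank M (by rw [hM1]; nlinarith) hM2⟩
  have h0 : Tendsto ev atTop (𝓝 0) := htrap.tendsto hr0 hr1
  refine ⟨ev, ⟨he.antitone, he.pos, fun ν hν => ?_, fun ν hν => ?_⟩, htrap⟩
  · rw [he.encard_eq (isPositive_stringOperator μ) h0 hν, rank_eigenspace μ hP]
  · obtain ⟨n, hn⟩ := (h0.eventually (gt_mem_nhds hν)).exists_forall_of_atTop
    refine (finite_Iio n).subset fun j hj => ?_
    by_contra hnj
    exact lt_asymm (show ν < ev j from hj) (hn j (not_lt.1 hnj))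

end SelfAdjointRealization

end DegenerateString

end

theorem mainTheorem1 (n ℓ : ℕ) (hn : 2 ≤ n) (hℓ : 1 ≤ ℓ)
    (p : DegenerateString.SimilarityData n)
    (μ : Measure ℝ) [IsProbabilityMeasure μ] (hμ : p.IsDegenerateSelfSimilarMeasure μ)
    (P : Fin ℓ → ℝ → ℝ) (hP : ∀ i, IntegrableOn (P i) (Ioo 0 1))
    (L : DegenerateString.SelfAdjointRealization ℓ P) :
    1 < p.q ℓ ∧
      ∃ ev : ℕ → ℝ, L.IsEigenvalueSequence μ ev ∧
        Asymptotics.IsEquivalent (𝓝[>] 0)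
          (fun ν : ℝ => (DegenerateString.countingFunction ev ν : ℝ))
          (fun ν : ℝ => ((n : ℝ) - 1) * (Real.log (1 / ν) / Real.log (p.q ℓ))) ∧
        Asymptotics.IsEquivalent atTop
          (fun j : ℕ => Real.log (1 / ev j))
          (fun j : ℕ => (j : ℝ) * (Real.log (p.q ℓ) / ((n : ℝ) - 1))) := by
  obtain ⟨k, rfl⟩ : ∃ k, ℓ = k + 1 := ⟨ℓ - 1, by omega⟩
  have ha := p.a_pos p.m
  have ha1 := (p.a_lt_one hn p.m).le
  have hd := abs_pos.2 p.d_m_ne_zero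
  have hd1 := p.abs_d_m_lt_one
  set r := |p.d p.m| * p.a p.m ^ (2 * k + 1) with hr
  -- The truncated subtraction `2 * (k + 1) - 1` reduces to `2 * k + 1` by definition.
  have hq : p.q (k + 1) = 1 / r := rfl
  have hr0 : 0 < r := by positivity
  have hr1 : r < 1 := (mul_le_of_le_one_right hd.le (pow_le_one₀ ha.le ha1)).trans_lt hd1
  have hN : (((n - 1 : ℕ) : ℝ)) = (n : ℝ) - 1 := by
    rw [Nat.cast_sub (by omega), Nat.cast_one]
  obtain ⟨ev, hev, htrap⟩ := L.exists_isGeometricallyTrapped hP (by omega) ha ha1 hd hd1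
    (hμ.atomicTower hn)
  rw [hq, ← hN]
  exact ⟨one_lt_one_div hr0 hr1, ev, hev, htrap.countingFunction_isEquivalent (by omega) hr0 hr1,
    htrap.isEquivalent_log (by omega) hr0 hr1⟩
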